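/- Let $G$ be a finite group acting smoothly and without fixed points on $S^3$ (every $g\neq 1$ moves every point; $S^3$ is the group of unit quaternions), let $M=S^3/G$ be the quotient $3$-manifold and $\pi\colon S^3\to M$ the projection. A trivialisation of the tangent bundle $TN$ of a $3$-manifold $N$ is a continuous vector bundle isomorphism $TN\cong N\times\mathbb{R}^3$; we write $\tau_p\colon T_pN\to\mathbb{R}^3$ for its fibre at $p$, and $\pi^*(\tau)_x=\tau_{\pi(x)}\circ d\pi_x$. For trivialisations $\sigma_1,\sigma_2$ of $TS^3$ inducing the same orientation, we say that $\sigma_1-\sigma_2=d\in\mathbb{Z}$ if there is a map $f\colon S^3\to S^3$ of degree $d$ such that $\sigma_1$ is homotopic, through trivialisations, to $x\mapsto \mathrm{Ad}(f(x))\circ(\sigma_2)_x$, where $\mathrm{Ad}\colon S^3=SU(2)\to SO(3)$ is the double covering given by conjugation on the imaginary quaternions. (1) Let $\tau_1,\tau_2$ be trivialisations of $TM$ inducing the same orientation. Then $\pi^*(\tau_1)-\pi^*(\tau_2)$ is a well-defined integer (there is exactly one such $d$). It is divisible by $|G|$ if $H_1(M;\mathbb{Z}/2)=0$; and if $H_1(M;\mathbb{Z}/2)\neq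 0$, then $|G|$ is even and $\pi^*(\tau_1)-\pi^*(\tau_2)$ is divisible by $|G|/2$. (2) Consequently the framing invariant is well defined: let $\langle G\rangle=|G|$ if $H_1(M;\mathbb{Z}/2)=0$ and $\langle G\rangle=|G|/2$ otherwise, and let $\tau_{\mathrm{can}}$ be the canonical trivialisation of $TS^3$, which is invariant under left multiplication and is $(i,j,k)$ at the identity. For every trivialisation $\tau$ of $TM$ such that $\pi^*(\tau)$ induces the same orientation as $\tau_{\mathrm{can}}$, the integer $\mathfrak{F}(M,\tau)=\pi^*(\tau)-\tau_{\mathrm{can}}$ is well defined, and its residue class modulo $\langle G\rangle$ does not depend on $\tau$. -/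

import Mathlib

open Set Topology CategoryTheory
open scoped Manifold ContDiff Quaternion

noncomputable section

namespace SphericalFraming

/-! ### The 3-sphere of unit quaternions -/

instance factFinrankQuaternion : Fact (Module.finrank ℝ ℍ[ℝ] = 3 + 1) :=
  ⟨Quaternion.finrank_eq_four⟩

/-- The 3-sphere as the Lie group of unit quaternions, with its standard smooth structure. -/
abbrev S3 : Type := Metric.sphere (0 : ℍ[ℝ]) 1

/-- The model space `ℝ³`, identified with the imaginary quaternions through the basis `i, j, k`. -/
abbrev R3 : Type := EuclideanSpace ℝ (Fin 3)

/-- The coordinates of the imaginary part of a quaternion in the basis `i, j, k`. -/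
def imCoord : ℍ[ℝ] →ₗ[ℝ] R3 where
  toFun w := !₂[w.imI, w.imJ, w.imK]
  map_add' a b := by ext i; fin_cases i <;> simp
  map_smul' c a := by ext i; fin_cases i <;> simp

/-- The imaginary quaternion with given coordinates in the basis `i, j, k`. -/
def imQuat : R3 →ₗ[ℝ] ℍ[ℝ] where
  toFun v := ⟨0, v 0, v 1, v 2⟩
  map_add' _ _ := Quaternion.ext _ _ (zero_add (0 : ℝ)).symm rfl rfl rfl
  map_smul' c _ := Quaternion.ext _ _ (mul_zero c).symm rfl rfl rfl

lemma imQuat_re (v : R3) : (imQuat v).re = 0 := rfl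

lemma imCoord_imQuat (v : R3) : imCoord (imQuat v) = v := by
  ext i; fin_cases i <;> rfl

lemma imQuat_imCoord (w : ℍ[ℝ]) (hw : w.re = 0) : imQuat (imCoord w) = w :=
  Quaternion.ext _ _ hw.symm rfl rfl rfl

lemma continuous_imCoord : Continuous imCoord := imCoord.continuous_of_finiteDimensional
lemma continuous_imQuat : Continuous imQuat := imQuat.continuous_of_finiteDimensional

lemma coe_inv_eq_star (q : S3) : ((q⁻¹ : S3) : ℍ[ℝ]) = star (q : ℍ[ℝ]) := by
  have h : ‖(q : ℍ[ℝ])‖ = 1 := by simp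
  rw [Metric.unitSphere.coe_inv, Quaternion.inv_def, Quaternion.normSq_eq_norm_mul_self, h]
  simp

/-- The double covering `SU(2) → SO(3)`: conjugation by a unit quaternion on the imaginary
quaternions. -/
def Ad (q : S3) : R3 →ₗ[ℝ] R3 where
  toFun v := imCoord (q * imQuat v * (q⁻¹ : S3))
  map_add' a b := by simp [mul_add, add_mul]
  map_smul' c a := by simp

lemma Ad_Ad_inv (q : S3) (v : R3) : Ad q (Ad q⁻¹ v) = v := by
  have hre : ((q⁻¹ : S3) * imQuat v * ((q⁻¹)⁻¹ : S3) : ℍ[ℝ]).re = 0 := by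
    rw [coe_inv_eq_star, inv_inv]
    simp [imQuat_re]
    ring
  have h1 : ((q : ℍ[ℝ]) * ((q⁻¹ : S3) : ℍ[ℝ])) = 1 := by
    rw [← Metric.unitSphere.coe_mul]; simp
  simp only [Ad, LinearMap.coe_mk, AddHom.coe_mk]
  rw [imQuat_imCoord _ hre, inv_inv]
  have : (q : ℍ[ℝ]) * (((q⁻¹ : S3) : ℍ[ℝ]) * imQuat v * q) * ((q⁻¹ : S3) : ℍ[ℝ])
      = (q * ((q⁻¹ : S3) : ℍ[ℝ])) * imQuat v * (q * ((q⁻¹ : S3) : ℍ[ℝ])) := by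
    simp only [mul_assoc]
  rw [this, h1, one_mul, mul_one, imCoord_imQuat]

/-- `Ad q` as a linear automorphism of `ℝ³`. -/
def AdEquiv (q : S3) : R3 ≃ₗ[ℝ] R3 :=
  { Ad q with
    invFun := Ad q⁻¹
    left_inv := fun v => by simpa using Ad_Ad_inv q⁻¹ v
    right_inv := fun v => Ad_Ad_inv q v }

/-! ### Trivialisations of tangent bundles of 3-manifolds -/

/-- A trivialisation of the tangent bundle of a smooth 3-manifold `N`: a continuous map
`TN → ℝ³` which is a linear isomorphism on every fibre, i.e. a vector bundle isomorphism
`TN ≅ N × ℝ³`. -/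
structure TangentTrivialisation (N : Type*) [TopologicalSpace N] [ChartedSpace R3 N]
    [IsManifold (𝓡 3) ∞ N] where
  fiber : ∀ p : N, TangentSpace (𝓡 3) p ≃ₗ[ℝ] R3
  continuous_fiber : Continuous fun v : TangentBundle (𝓡 3) N => fiber v.1 v.2

namespace TangentTrivialisation

variable {N N' : Type*} [TopologicalSpace N] [ChartedSpace R3 N] [IsManifold (𝓡 3) ∞ N]
  [TopologicalSpace N'] [ChartedSpace R3 N'] [IsManifold (𝓡 3) ∞ N']

/-- Two trivialisations induce the same orientation if the linear map comparing them has positive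
determinant at every point. -/
def SameOrientation (σ τ : TangentTrivialisation N) : Prop :=
  ∀ p : N, 0 < LinearMap.det ((τ.fiber p).symm.trans (σ.fiber p) : R3 →ₗ[ℝ] R3)

/-- Homotopy of trivialisations, through trivialisations. -/
def Homotopic (σ τ : TangentTrivialisation N) : Prop :=
  ∃ H : unitInterval → TangentTrivialisation N,
    H 0 = σ ∧ H 1 = τ ∧
      Continuous fun z : unitInterval × TangentBundle (𝓡 3) N => (H z.1).fiber z.2.1 z.2.2

/-- The pullback `π^* τ` of a trivialisation under a local diffeomorphism:
`(π^* τ)_x = τ_{π x} ∘ dπ_x`. -/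
def pullback {π : N → N'} (hπ : IsLocalDiffeomorph (𝓡 3) (𝓡 3) ∞ π)
    (τ : TangentTrivialisation N') : TangentTrivialisation N where
  fiber x := (hπ.mfderivToContinuousLinearEquiv (by simp) x).toLinearEquiv.trans (τ.fiber (π x))
  continuous_fiber :=
    τ.continuous_fiber.comp (hπ.contMDiff.continuous_tangentMap (by simp))

/-- The action of maps `f : N → S³` on trivialisations through the covering `S³ → SO(3)`:
`(f • τ)_p = Ad (f p) ∘ τ_p`. -/
def twist (f : C(N, S3)) (τ : TangentTrivialisation N) : TangentTrivialisation N where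
  fiber p := (τ.fiber p).trans (AdEquiv (f p))
  continuous_fiber := by
    have hf : Continuous fun v : TangentBundle (𝓡 3) N => f v.1 :=
      f.continuous.comp (FiberBundle.continuous_proj R3 (TangentSpace (𝓡 3) : N → Type _))
    have h2 := continuous_imQuat.comp τ.continuous_fiber
    exact continuous_imCoord.comp
      (((continuous_subtype_val.comp hf).mul h2).mul (continuous_subtype_val.comp hf.inv))

end TangentTrivialisation

/-- The differential at `x` of the inclusion of `S³` in the quaternions. -/
def inclDeriv (x : S3) : TangentSpace (𝓡 3) x →ₗ[ℝ] ℍ[ℝ] :=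
  (mvfderiv (𝓡 3) ((↑) : S3 → ℍ[ℝ]) x).toLinearMap

lemma inclDeriv_injective (x : S3) : Function.Injective (inclDeriv x) :=
  injective_mvfderiv_subtypeVal_sphere x

lemma inclDeriv_re (x : S3) (v : TangentSpace (𝓡 3) x) :
    (star (x : ℍ[ℝ]) * inclDeriv x v).re = 0 := by
  have h : inclDeriv x v ∈ (Submodule.span ℝ {(x : ℍ[ℝ])})ᗮ := by
    rw [← range_mvfderiv_subtypeVal (n := 3) x]
    exact ⟨v, rfl⟩
  have h2 := Submodule.mem_orthogonal_singleton_iff_inner_right.1 h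
  rw [Quaternion.inner_def] at h2
  simp at h2 ⊢
  linarith

/-- Left translation of a tangent vector at `x` to the identity, in the basis `i, j, k`. -/
def leftTranslate (x : S3) : TangentSpace (𝓡 3) x →ₗ[ℝ] R3 :=
  imCoord ∘ₗ LinearMap.mulLeft ℝ ((x⁻¹ : S3) : ℍ[ℝ]) ∘ₗ inclDeriv x

lemma leftTranslate_injective (x : S3) : Function.Injective (leftTranslate x) := by
  rw [injective_iff_map_eq_zero]
  intro v hv
  have hv' : imCoord (star (x : ℍ[ℝ]) * inclDeriv x v) = 0 := by
    rw [← coe_inv_eq_star]; exact hv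
  have h := imQuat_imCoord _ (inclDeriv_re x v)
  rw [hv', map_zero] at h
  have hx : star (x : ℍ[ℝ]) ≠ 0 := by
    rw [← coe_inv_eq_star]; exact ne_zero_of_mem_unit_sphere _
  have h0 : inclDeriv x v = 0 := (mul_eq_zero.1 h.symm).resolve_left hx
  exact inclDeriv_injective x (by rw [h0, map_zero])

/-- The canonical trivialisation of `TS³`: the one that is invariant under left multiplication and
is `(i, j, k)` at the identity. -/
def canonical : TangentTrivialisation S3 where
  fiber x := LinearEquiv.ofInjectiveOfFinrankEq (leftTranslate x) (leftTranslate_injective x) rfl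
  continuous_fiber := by
    have h1 : Continuous (tangentMap (𝓡 3) 𝓘(ℝ, ℍ[ℝ]) ((↑) : S3 → ℍ[ℝ])) :=
      (contMDiff_coe_sphere (m := 1)).continuous_tangentMap le_rfl
    have h2 : Continuous fun v : TangentBundle (𝓡 3) S3 => inclDeriv v.1 v.2 :=
      continuous_snd.comp ((tangentBundleModelSpaceHomeomorph 𝓘(ℝ, ℍ[ℝ])).continuous.comp h1)
    have h3 : Continuous fun v : TangentBundle (𝓡 3) S3 => v.1 :=
      FiberBundle.continuous_proj R3 (TangentSpace (𝓡 3) : S3 → Type _)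
    exact continuous_imCoord.comp ((continuous_subtype_val.comp h3.inv).mul h2)

/-! ### Degree of self-maps of `S³` -/

/-- The Jacobian determinant of a map `S³ → S³` at `x`, with respect to the canonical
trivialisation (hence to the fixed orientation) of `S³`. -/
def jacobian (g : S3 → S3) (x : S3) : ℝ :=
  LinearMap.det ((canonical.fiber (g x)).toLinearMap ∘ₗ
    (mfderiv (𝓡 3) (𝓡 3) g x).toLinearMap ∘ₗ (canonical.fiber x).symm.toLinearMap)

/-- `d` is the (Brouwer) degree of the continuous map `f : S³ → S³`: the map `f` is homotopic to a
smooth map `g` which has a regular value `y` whose preimages, counted with the signs of the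
Jacobian determinant of `g`, add up to `d`. -/
def IsDegree (f : C(S3, S3)) (d : ℤ) : Prop :=
  ∃ g : C(S3, S3), ContMDiff (𝓡 3) (𝓡 3) ∞ g ∧ f.Homotopic g ∧
    ∃ y : S3, (∀ x, g x = y → jacobian g x ≠ 0) ∧
      d = ∑ᶠ x ∈ {x : S3 | g x = y}, (SignType.sign (jacobian g x) : ℤ)

/-- `d` is the difference `σ - τ` of two trivialisations of `TS³` (that induce the same
orientation) in the `ℤ`-torsor of homotopy classes of trivialisations: up to homotopy, `σ` is
obtained from `τ` by the action of a map `S³ → SU(2) = S³` of degree `d`. -/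
def IsDifference (σ τ : TangentTrivialisation S3) (d : ℤ) : Prop :=
  ∃ f : C(S3, S3), IsDegree f d ∧ σ.Homotopic (τ.twist f)

/-! ### Quotients of `S³` by free actions of finite groups -/

/-- A smooth action of `G` on `S³` without fixed points. -/
class FreeSmoothAction (G : Type*) [Group G] [MulAction G S3] : Prop where
  contMDiff_smul : ∀ g : G, ContMDiff (𝓡 3) (𝓡 3) ∞ fun x : S3 => g • x
  smul_ne_self : ∀ g : G, g ≠ 1 → ∀ x : S3, g • x ≠ x

section Quotient

variable (G : Type*) [Group G] [MulAction G S3]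

instance continuousConstSMul_of_free [FreeSmoothAction G] : ContinuousConstSMul G S3 :=
  ⟨fun g => (FreeSmoothAction.contMDiff_smul g).continuous⟩

instance isCancelSMul_of_free [FreeSmoothAction G] : IsCancelSMul G S3 :=
  isCancelSMul_iff_eq_one_of_smul_eq.2 fun g x h =>
    by_contra fun hg => FreeSmoothAction.smul_ne_self g hg x h

/-- The quotient `M = S³ / G`, with the quotient topology and the quotient smooth structure, whose
charts are the charts of `S³` composed with local inverses of the projection. -/
abbrev SpaceForm : Type := MulAction.orbitRel.Quotient G S3

/-- The projection `π : S³ → M`. -/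
def proj (x : S3) : SpaceForm G := Quotient.mk (MulAction.orbitRel G S3) x

lemma proj_eq_iff {x y : S3} : proj G x = proj G y ↔ ∃ g : G, g • y = x := by
  unfold proj
  rw [Quotient.eq]
  exact MulAction.orbitRel_apply

lemma proj_smul (g : G) (x : S3) : proj G (g • x) = proj G x :=
  (proj_eq_iff G).2 ⟨g, rfl⟩

variable [Finite G] [FreeSmoothAction G]

lemma isLocalHomeomorph_proj : IsLocalHomeomorph (proj G) :=
  isQuotientCoveringMap_quotientMk_of_properlyDiscontinuousSMul.isCoveringMap.isLocalHomeomorph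

lemma proj_continuous : Continuous (proj G) := (isLocalHomeomorph_proj G).continuous

lemma contMDiffAt_localInverse_proj (x₀ y : S3)
    (hy : proj G y ∈ ((isLocalHomeomorph_proj G).localInverseAt x₀).source) :
    ContMDiffAt (𝓡 3) (𝓡 3) ∞
      (fun w => (isLocalHomeomorph_proj G).localInverseAt x₀ (proj G w)) y := by
  set hq := isLocalHomeomorph_proj G
  set L := hq.localInverseAt x₀ with hL
  have h1 : proj G (L (proj G y)) = proj G y := hq.apply_localInverseAt_of_mem hy
  obtain ⟨g, hg⟩ := (proj_eq_iff G).1 h1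
  have hmem : g • y ∈ L.target := by rw [hg]; exact L.map_source hy
  have hcont : Continuous fun w : S3 => g • w := continuous_const_smul g
  refine (FreeSmoothAction.contMDiff_smul g y).congr_of_eventuallyEq ?_
  filter_upwards [hcont.continuousAt.preimage_mem_nhds (L.open_target.mem_nhds hmem)] with w hw
  have h2 : L (L.symm (g • w)) = g • w := L.right_inv hw
  rw [hL, hq.localInverseAt_symm, proj_smul] at h2
  exact h2

lemma exists_chart_eq (e : OpenPartialHomeomorph (SpaceForm G) R3)
    (he : e ∈ atlas R3 (SpaceForm G)) :
    ∃ x₀ : S3, e = ((isLocalHomeomorph_proj G).localInverseAt x₀).trans (chartAt R3 x₀) := by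
  obtain ⟨m, rfl⟩ := he
  exact ⟨_, rfl⟩

lemma contMDiffAt_chart_proj (e : OpenPartialHomeomorph (SpaceForm G) R3)
    (he : e ∈ atlas R3 (SpaceForm G)) (y : S3) (hy : proj G y ∈ e.source) :
    ContMDiffAt (𝓡 3) (𝓡 3) ∞ (fun w => e (proj G w)) y := by
  obtain ⟨x₀, rfl⟩ := exists_chart_eq G e he
  rw [OpenPartialHomeomorph.trans_source] at hy
  have h1 := contMDiffAt_localInverse_proj G x₀ y hy.1
  have h2 : ContMDiffAt (𝓡 3) (𝓡 3) ∞ (chartAt R3 x₀)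
      ((isLocalHomeomorph_proj G).localInverseAt x₀ (proj G y)) :=
    (contMDiffOn_chart (I := 𝓡 3) (n := ∞)).contMDiffAt
      ((chartAt R3 x₀).open_source.mem_nhds hy.2)
  exact ContMDiffAt.comp (f := fun w => (isLocalHomeomorph_proj G).localInverseAt x₀ (proj G w))
    y h2 h1

instance isManifold_spaceForm : IsManifold (𝓡 3) ∞ (SpaceForm G) := by
  refine isManifold_of_contDiffOn _ _ _ fun e e' he he' => ?_
  obtain ⟨x₀, hx₀⟩ := exists_chart_eq G e he
  intro z hz
  simp only [modelWithCornersSelf_coe, modelWithCornersSelf_coe_symm, Function.comp_id,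
    Function.id_comp, Set.preimage_id, Set.range_id, Set.inter_univ] at hz ⊢
  refine ContDiffAt.contDiffWithinAt ?_
  rw [← contMDiffAt_iff_contDiffAt]
  have hsymm : ∀ w, e.symm w = proj G ((chartAt R3 x₀).symm w) := by
    intro w
    rw [hx₀]
    simp
  rw [OpenPartialHomeomorph.trans_source] at hz
  have hz1 : z ∈ (chartAt R3 x₀).target := by
    have := hz.1
    rw [hx₀] at this
    simp only [OpenPartialHomeomorph.symm_source, OpenPartialHomeomorph.trans_target] at this
    exact this.1
  have hz2 : proj G ((chartAt R3 x₀).symm z) ∈ e'.source := by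
    rw [← hsymm]; exact hz.2
  have h1 : ContMDiffAt (𝓡 3) (𝓡 3) ∞ (chartAt R3 x₀).symm z :=
    (contMDiffOn_chart_symm (I := 𝓡 3) (n := ∞)).contMDiffAt
      ((chartAt R3 x₀).open_target.mem_nhds hz1)
  have h2 := ContMDiffAt.comp z (contMDiffAt_chart_proj G e' he' _ hz2) h1
  refine h2.congr_of_eventuallyEq (Filter.Eventually.of_forall fun w => ?_)
  simp [hsymm]

lemma contMDiff_proj : ContMDiff (𝓡 3) (𝓡 3) ∞ (proj G) := by
  intro y
  set e := chartAt R3 (proj G y)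
  have hy : proj G y ∈ e.source := mem_chart_source R3 _
  have h1 := contMDiffAt_chart_proj G e (chart_mem_atlas R3 _) y hy
  have h2 : ContMDiffAt (𝓡 3) (𝓡 3) ∞ e.symm (e (proj G y)) :=
    (contMDiffOn_chart_symm (I := 𝓡 3) (n := ∞)).contMDiffAt
      (e.open_target.mem_nhds (e.map_source hy))
  refine (ContMDiffAt.comp y h2 h1).congr_of_eventuallyEq ?_
  filter_upwards [(proj_continuous G).continuousAt.preimage_mem_nhds
    (e.open_source.mem_nhds hy)] with w hw
  exact (e.left_inv hw).symm

lemma contMDiffAt_localInverse (x₀ : S3) (m : SpaceForm G)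
    (hm : m ∈ ((isLocalHomeomorph_proj G).localInverseAt x₀).source) :
    ContMDiffAt (𝓡 3) (𝓡 3) ∞ ((isLocalHomeomorph_proj G).localInverseAt x₀) m := by
  set e := chartAt R3 m with he
  have hms : m ∈ e.source := mem_chart_source R3 _
  obtain ⟨x₁, hx₁⟩ := exists_chart_eq G e (chart_mem_atlas R3 _)
  have hsymm : ∀ w, e.symm w = proj G ((chartAt R3 x₁).symm w) := by
    intro w
    rw [hx₁]
    simp
  have hz1 : e m ∈ (chartAt R3 x₁).target := by
    have := e.map_source hms
    rw [hx₁, OpenPartialHomeomorph.trans_target] at this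
    rw [hx₁]
    exact this.1
  have hm' : proj G ((chartAt R3 x₁).symm (e m)) = m := by
    rw [← hsymm]; exact e.left_inv hms
  have h0 : ContMDiffAt (𝓡 3) (𝓡 3) ∞ e m :=
    (contMDiffOn_chart (I := 𝓡 3) (n := ∞)).contMDiffAt (e.open_source.mem_nhds hms)
  have h1 : ContMDiffAt (𝓡 3) (𝓡 3) ∞ (chartAt R3 x₁).symm (e m) :=
    (contMDiffOn_chart_symm (I := 𝓡 3) (n := ∞)).contMDiffAt
      ((chartAt R3 x₁).open_target.mem_nhds hz1)
  have h2 := contMDiffAt_localInverse_proj G x₀ ((chartAt R3 x₁).symm (e m)) (by rwa [hm'])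
  have h3 := ContMDiffAt.comp m h2 (ContMDiffAt.comp m h1 h0)
  refine h3.congr_of_eventuallyEq ?_
  filter_upwards [e.open_source.mem_nhds hms] with w hw
  simp only [Function.comp_apply]
  rw [← hsymm, e.left_inv hw]

/-- The projection is a smooth local diffeomorphism. -/
lemma isLocalDiffeomorph_proj : IsLocalDiffeomorph (𝓡 3) (𝓡 3) ∞ (proj G) := by
  intro x
  set hq := isLocalHomeomorph_proj G
  set L := hq.localInverseAt x
  have hL : ⇑L.symm = proj G := hq.localInverseAt_symm x
  refine ⟨{ toPartialEquiv := L.symm.toPartialEquiv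
            open_source := L.open_target
            open_target := L.open_source
            contMDiffOn_toFun := ?_
            contMDiffOn_invFun := ?_ }, hq.self_mem_localInverseAt_target, ?_⟩
  · change ContMDiffOn _ _ _ (⇑L.symm) _
    rw [hL]
    exact (contMDiff_proj G).contMDiffOn
  · intro m hm
    exact (contMDiffAt_localInverse G x m hm).contMDiffWithinAt
  · intro w _
    exact congrFun hL.symm w

/-- The pullback `π^* τ` to `S³` of a trivialisation `τ` of `TM`. -/
def pullbackProj (τ : TangentTrivialisation (SpaceForm G)) : TangentTrivialisation S3 :=
  τ.pullback (isLocalDiffeomorph_proj G)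

/-- A trivialisation of `TM` is positive if it induces the orientation of `M` that comes from the
fixed orientation of `S³`. -/
def IsPositive (τ : TangentTrivialisation (SpaceForm G)) : Prop :=
  (pullbackProj G τ).SameOrientation canonical

end Quotient

/-- `H₁(X; ℤ/2) = 0`, for singular homology. -/
def FirstHomologyModTwoVanishes (X : Type) [TopologicalSpace X] : Prop :=
  Limits.IsZero (((AlgebraicTopology.singularHomologyFunctor (ModuleCat.{0} (ZMod 2)) 1).obj
    (ModuleCat.of (ZMod 2) (ZMod 2))).obj (TopCat.of X))

open Classical in
/-- The number `⟨G⟩`: it is `|G|` if `H₁(M; ℤ/2) = 0`, and `|G| / 2` otherwise. -/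
def modulus (G : Type*) [Group G] [MulAction G S3] : ℕ :=
  if FirstHomologyModTwoVanishes (SpaceForm G) then Nat.card G else Nat.card G / 2

end SphericalFraming

end

/-! Two trivialisations of TS³ inducing the same orientation differ by a map from S³ to GL⁺(3).
Gram-Schmidt deforms this map into the rotations, and since S³ is simply connected the result lifts
through `Ad` to a map f : S³ → S³, unique up to a global sign. The sign does not affect the homotopy
class, because -1 is joined to 1 inside S³. Hence the difference of the trivialisations is exactly
the degree of f (`isDifference_iff`), and differences add because degrees add under pointwise
products (`IsDegree.mul`).

If both trivialisations are pulled back from M, their comparison is G-invariant, so f(gx) = ±f(x)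
with a sign that depends only on g. This sign is a character χ of G
(`exists_character_card_ker_dvd`), and f is invariant under ker χ. A trivialisation of TM forces G
to preserve orientation, so the preimages of a regular value of a smooth invariant approximation of
f fall into free ker χ-orbits of constant sign, and |ker χ| divides the degree
(`card_dvd_degree_of_invariant`).

The kernel has index 1 or 2. A non-trivial χ would produce a singular 1-cocycle on M that does not
vanish on some loop, so χ = 1 when H₁(M; ℤ/2) = 0
(`character_eq_one_of_firstHomologyModTwoVanishes`). When |G| is odd, averaging over the group shows
H₁(M; ℤ/2) = 0 (`firstHomologyModTwoVanishes_of_odd`); so non-vanishing homology forces |G| even,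
and then |G|/2 divides |ker χ|. Independence of the framing invariant modulo ⟨G⟩ follows by
additivity.

The degree itself is obtained by integration. A smooth g : S³ → S³ is extended homogeneously to ℍ,
and a density φ is pulled back along the extension and integrated over a shell. If φ = det DΦ, the
integrand is the Jacobian of a composite; the Jacobian being a null Lagrangian, the integral is a
homotopy invariant (`weightedDegree_eq_of_norm_sub_lt`). Concentrating φ near a regular value turns
the integral into the signed count times ∫ φ (`IsRadial.exists_nhds_weightedDegree_eq`). -/

noncomputable section

namespace SphericalFraming

/-! ### The Jacobian determinant as a null Lagrangian. -/

section NullLagrangian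

open MeasureTheory

variable {E : Type*} [NormedAddCommGroup E] [NormedSpace ℝ E] [FiniteDimensional ℝ E]

/-- Evaluating the characteristic polynomial of `-L` at `0` by Lagrange interpolation. -/
lemma det_eq_sum_det_smul_id_add (v : ℕ → ℝ) (hv : Function.Injective v) (L : E →L[ℝ] E) :
    L.det = ∑ j ∈ Finset.range (Module.finrank ℝ E + 1),
      (Lagrange.basis (Finset.range (Module.finrank ℝ E + 1)) v j).eval 0 *
        (v j • ContinuousLinearMap.id ℝ E + L).det := by
  have key : ∀ s : ℝ, ((-L : E →L[ℝ] E) : E →ₗ[ℝ] E).charpoly.eval s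
      = (s • ContinuousLinearMap.id ℝ E + L).det := by
    intro s
    rw [LinearMap.eval_charpoly]
    congr 1
    ext x
    simp [Algebra.algebraMap_eq_smul_one]
  have hdeg : ((-L : E →L[ℝ] E) : E →ₗ[ℝ] E).charpoly.degree
      < (Finset.range (Module.finrank ℝ E + 1)).card := by
    rw [Finset.card_range]
    refine lt_of_le_of_lt Polynomial.degree_le_natDegree ?_
    rw [LinearMap.charpoly_natDegree]
    exact_mod_cast Nat.lt_succ_self _
  have h := Lagrange.eq_interpolate (v := v) (hv.injOn) hdeg
  have h0 := congrArg (Polynomial.eval 0) h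
  rw [key, zero_smul, zero_add, Lagrange.interpolate_apply, Polynomial.eval_finsetSum] at h0
  rw [h0]
  refine Finset.sum_congr rfl fun j _ => ?_
  rw [Polynomial.eval_mul, Polynomial.eval_C, key, mul_comm]

/-- Determinants are positive near the identity. -/
lemma exists_forall_det_smul_id_add_pos (K : ℝ) :
    ∃ S : ℝ, K < S ∧ 0 < S ∧ ∀ s ≥ S, ∀ L : E →L[ℝ] E, ‖L‖ ≤ K →
      0 < (s • ContinuousLinearMap.id ℝ E + L).det := by
  have hc : ContinuousAt (fun L : E →L[ℝ] E => L.det) (ContinuousLinearMap.id ℝ E) :=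
    ContinuousLinearMap.continuous_det.continuousAt
  have h1 : ∀ᶠ L in 𝓝 (ContinuousLinearMap.id ℝ E), 0 < (L : E →L[ℝ] E).det :=
    hc.eventually (lt_mem_nhds (by change 0 < LinearMap.det LinearMap.id; rw [LinearMap.det_id]; exact one_pos))
  obtain ⟨δ, hδ, hb⟩ := Metric.eventually_nhds_iff.1 h1
  -- The entry `2 * K / δ` makes `s⁻¹ • L` have norm at most `δ / 2`; the others give `K < S` and `0
  -- < S`.
  refine ⟨max (K + 1) (max 1 (2 * K / δ)), ?_, ?_, ?_⟩
  · exact lt_of_lt_of_le (lt_add_one K) (le_max_left _ _)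
  · exact lt_of_lt_of_le one_pos ((le_max_left _ _).trans (le_max_right _ _))
  intro s hs L hL
  have hs0 : 0 < s := lt_of_lt_of_le one_pos
    (((le_max_left _ _).trans (le_max_right _ _)).trans hs)
  have hsK : 2 * K / δ ≤ s := ((le_max_right _ _).trans (le_max_right _ _)).trans hs
  have hK : 0 ≤ K := (norm_nonneg L).trans hL
  have e : s • ContinuousLinearMap.id ℝ E + L
      = s • (ContinuousLinearMap.id ℝ E + s⁻¹ • L) := by
    rw [smul_add, smul_smul, mul_inv_cancel₀ hs0.ne', one_smul]
  rw [e]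
  have : 0 < (ContinuousLinearMap.id ℝ E + s⁻¹ • L).det := by
    apply hb
    rw [dist_eq_norm, add_sub_cancel_left, norm_smul, Real.norm_eq_abs, abs_of_pos (inv_pos.2 hs0),
      inv_mul_lt_iff₀ hs0]
    rw [div_le_iff₀ hδ] at hsK
    rcases hK.eq_or_lt with h | h
    · rw [← h] at hL; nlinarith
    · linarith
  rw [ContinuousLinearMap.det, ContinuousLinearMap.toLinearMap_smul, LinearMap.det_smul]
  positivity

/-- The term `s • x` dominates `P`: a collision would give s‖x - y‖ ≤ K‖x - y‖, and a preimage of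
`y` is a fixed point of the contraction x ↦ s⁻¹(y - P x). -/
lemma bijective_smul_add_of_lipschitz {K : NNReal} {s : ℝ} (hs : K < s) {P : E → E}
    (hP : LipschitzWith K P) : Function.Bijective fun x => s • x + P x := by
  have hs0 : 0 < s := lt_of_le_of_lt K.2 hs
  constructor
  · intro x y hxy
    have h1 : s • (x - y) = P y - P x := by
      rw [smul_sub, sub_eq_sub_iff_add_eq_add, add_comm (P y)]
      exact hxy
    have h2 := hP.dist_le_mul y x
    rw [dist_eq_norm, ← h1, norm_smul, dist_comm, dist_eq_norm, Real.norm_eq_abs,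
      abs_of_pos hs0] at h2
    by_contra hne
    have : 0 < ‖x - y‖ := norm_pos_iff.2 (sub_ne_zero.2 hne)
    nlinarith
  · intro y
    have hc : ContractingWith (Real.toNNReal (K / s)) fun x => s⁻¹ • (y - P x) := by
      refine ⟨?_, ?_⟩
      · rw [Real.toNNReal_lt_one]
        exact (div_lt_one hs0).2 hs
      · refine LipschitzWith.of_dist_le_mul fun a b => ?_
        rw [Real.coe_toNNReal _ (by positivity), dist_eq_norm, ← smul_sub, norm_smul,
          sub_sub_sub_cancel_left, Real.norm_eq_abs, abs_of_pos (inv_pos.2 hs0), ← dist_eq_norm,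
          div_mul_eq_mul_div, inv_mul_eq_div, dist_comm]
        gcongr
        exact hP.dist_le_mul a b
    refine ⟨hc.fixedPoint, ?_⟩
    have h := hc.fixedPoint_isFixedPt
    have h' : s⁻¹ • (y - P hc.fixedPoint) = hc.fixedPoint := h
    rw [inv_smul_eq_iff₀ hs0.ne'] at h'
    change s • hc.fixedPoint + P hc.fixedPoint = y
    rw [← h', sub_add_cancel]

/-- A bijection sends complements to complements, so the image of `B` is determined by the values
off `B`. -/
lemma image_eq_of_bijective_of_eqOn_compl {X Y : Type*} {A A' : X → Y} (hA : Function.Bijective A)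
    (hA' : Function.Bijective A') {B : Set X} (h : EqOn A A' Bᶜ) : A '' B = A' '' B := by
  rw [← compl_inj_iff, ← image_compl_eq hA, ← image_compl_eq hA', h.image_eq]

variable [MeasurableSpace E] [BorelSpace E] (μ : Measure E) [μ.IsAddHaarMeasure]

lemma integrableOn_det_add_fderiv {P : E → E} (hP : ContDiff ℝ 1 P) {B : Set E}
    (hb : Bornology.IsBounded B) (s : ℝ) :
    IntegrableOn (fun x => (s • ContinuousLinearMap.id ℝ E + fderiv ℝ P x).det) B μ := by
  have hc : Continuous fun x => (s • ContinuousLinearMap.id ℝ E + fderiv ℝ P x).det :=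
    ContinuousLinearMap.continuous_det.comp
      (continuous_const.add (hP.continuous_fderiv one_ne_zero))
  obtain ⟨R, hR⟩ := hb.subset_closedBall 0
  exact (hc.continuousOn.integrableOn_compact (isCompact_closedBall 0 R)).mono_set hR

/-- The Jacobian determinant is a null Lagrangian: its integral over `B` depends only on the values
of the map off `B`. -/
theorem setIntegral_det_fderiv_eq_of_eqOn_compl {P Q : E → E} (hP : ContDiff ℝ 1 P)
    (hQ : ContDiff ℝ 1 Q) {K : NNReal} (hPK : LipschitzWith K P) (hQK : LipschitzWith K Q)
    {B : Set E} (hB : MeasurableSet B) (hb : Bornology.IsBounded B) (hPQ : EqOn P Q Bᶜ) :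
    ∫ x in B, (fderiv ℝ P x).det ∂μ = ∫ x in B, (fderiv ℝ Q x).det ∂μ := by
  obtain ⟨S, hKS, hS0, hS⟩ := exists_forall_det_smul_id_add_pos (E := E) K
  -- For large `s` the map x ↦ s x + R x is injective with positive Jacobian, so its Jacobian
  -- integral is the volume of an image, and that volume only sees values off `B`.
  have vol : ∀ s ≥ S, ∀ R : E → E, ContDiff ℝ 1 R → LipschitzWith K R →
      ∫ x in B, (s • ContinuousLinearMap.id ℝ E + fderiv ℝ R x).det ∂μ
        = ∫ _ in (fun x => s • x + R x) '' B, (1 : ℝ) ∂μ := by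
    intro s hs R hR hRK
    have hd : ∀ x ∈ B, HasFDerivWithinAt (fun x => s • x + R x)
        (s • ContinuousLinearMap.id ℝ E + fderiv ℝ R x) B x := fun x _ =>
      (((hasFDerivAt_id x).const_smul s).add
        (hR.differentiable one_ne_zero x).hasFDerivAt).hasFDerivWithinAt
    rw [integral_image_eq_integral_abs_det_fderiv_smul μ hB hd
      (bijective_smul_add_of_lipschitz (hKS.trans_le hs) hRK).1.injOn]
    refine setIntegral_congr_fun hB fun x _ => ?_
    simp only [smul_eq_mul, mul_one]
    rw [abs_of_pos (hS s hs _ (norm_fderiv_le_of_lipschitz ℝ hRK))]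
  have heq : ∀ s ≥ S, ∫ x in B, (s • ContinuousLinearMap.id ℝ E + fderiv ℝ P x).det ∂μ
      = ∫ x in B, (s • ContinuousLinearMap.id ℝ E + fderiv ℝ Q x).det ∂μ := by
    intro s hs
    rw [vol s hs P hP hPK, vol s hs Q hQ hQK,
      image_eq_of_bijective_of_eqOn_compl (bijective_smul_add_of_lipschitz (hKS.trans_le hs) hPK)
        (bijective_smul_add_of_lipschitz (hKS.trans_le hs) hQK)]
    intro x hx
    simp only [hPQ hx]
  -- The integral is a polynomial in `s` of degree at most the dimension. Interpolation at the nodes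
  -- `S + j`, all in the range where equality is known, recovers its value at s = 0.
  have hv : Function.Injective fun j : ℕ => S + j := fun a b h => by
    simpa using h
  have expand : ∀ R : E → E, ContDiff ℝ 1 R → ∫ x in B, (fderiv ℝ R x).det ∂μ
      = ∑ j ∈ Finset.range (Module.finrank ℝ E + 1),
        (Lagrange.basis (Finset.range (Module.finrank ℝ E + 1)) (fun j : ℕ => S + j) j).eval 0 *
        ∫ x in B, ((S + j) • ContinuousLinearMap.id ℝ E + fderiv ℝ R x).det ∂μ := by
    intro R hR
    simp_rw [← integral_const_mul]
    rw [← integral_finsetSum]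
    · exact integral_congr_ae (Filter.Eventually.of_forall fun x =>
        det_eq_sum_det_smul_id_add _ hv _)
    · exact fun j _ => (integrableOn_det_add_fderiv μ hR hb _).const_mul _
  rw [expand P hP, expand Q hQ]
  refine Finset.sum_congr rfl fun j _ => ?_
  rw [heq _ (by simp)]

end NullLagrangian

end SphericalFraming

end

noncomputable section

namespace SphericalFraming

/-! ### Homotopy invariance of the weighted degree. -/

section WeightedDegree

open MeasureTheory

variable {E : Type*} [NormedAddCommGroup E]

/-- A closed spherical shell around the unit sphere. -/
def shell (E : Type*) [NormedAddCommGroup E] : Set E := {x | 1 / 4 ≤ ‖x‖ ∧ ‖x‖ ≤ 4}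

lemma isClosed_shell : IsClosed (shell E) :=
  (isClosed_le continuous_const continuous_norm).inter (isClosed_le continuous_norm continuous_const)

lemma isBounded_shell : Bornology.IsBounded (shell E) :=
  (Metric.isBounded_closedBall (x := (0 : E)) (r := 4)).subset fun x hx => by
    simpa using hx.2

lemma ne_zero_of_mem_shell {x : E} (hx : x ∈ shell E) : x ≠ 0 := by
  rintro rfl
  have := hx.1
  norm_num at this

variable [NormedSpace ℝ E]

/-- A norm-preserving map that is smooth away from the origin. -/
structure IsRadial (F : E → E) : Prop where
  norm_eq : ∀ x, ‖F x‖ = ‖x‖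
  contDiffAt : ∀ x, x ≠ 0 → ContDiffAt ℝ ∞ F x

lemma IsRadial.continuousOn_fderiv {F : E → E} (hF : IsRadial F) :
    ContinuousOn (fderiv ℝ F) {0}ᶜ := fun x hx =>
  ((hF.contDiffAt x hx).fderiv_right (m := 0) (by simp)).continuousAt.continuousWithinAt

lemma IsRadial.continuousAt {F : E → E} (hF : IsRadial F) {x : E} (hx : x ≠ 0) :
    ContinuousAt F x := (hF.contDiffAt x hx).continuousAt

lemma IsRadial.differentiableAt {F : E → E} (hF : IsRadial F) {x : E} (hx : x ≠ 0) :
    DifferentiableAt ℝ F x := (hF.contDiffAt x hx).differentiableAt (by simp)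

lemma IsRadial.continuousOn_det_fderiv {F : E → E} (hF : IsRadial F) :
    ContinuousOn (fun x => (fderiv ℝ F x).det) {0}ᶜ :=
  ContinuousLinearMap.continuous_det.comp_continuousOn hF.continuousOn_fderiv

/-- Cutting off a map that is smooth away from the origin. -/
lemma contDiff_smul_cutoff {F : E → E} (hF : ∀ x, x ≠ 0 → ContDiffAt ℝ ∞ F x) {η : E → ℝ}
    (hη : ContDiff ℝ ∞ η) {a : ℝ} (ha : 0 < a) (h : ∀ x, ‖x‖ ≤ a → η x = 0) :
    ContDiff ℝ ∞ fun x => η x • F x := by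
  rw [contDiff_iff_contDiffAt]
  intro x
  by_cases hx : x = 0
  · subst hx
    refine (contDiffAt_const (c := (0 : E))).congr_of_eventuallyEq ?_
    filter_upwards [Metric.ball_mem_nhds (0 : E) ha] with y hy
    rw [h y (by simpa using (mem_ball_zero_iff.1 hy).le), zero_smul]
  · exact hη.contDiffAt.smul (hF x hx)

/-- Subtracting the constant Φ(0) makes the composite compactly supported without changing its
Lipschitz constants. -/
lemma exists_lipschitzWith_comp_of_hasCompactSupport {Φ P : E → E} (hΦ : ContDiff ℝ ∞ Φ)
    (hP : ContDiff ℝ ∞ P) (hs : HasCompactSupport P) : ∃ K, LipschitzWith K (Φ ∘ P) := by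
  have h1 : ContDiff ℝ ∞ fun x => Φ (P x) - Φ 0 := (hΦ.comp hP).sub contDiff_const
  have h2 : HasCompactSupport fun x => Φ (P x) - Φ 0 :=
    hs.comp_left (g := fun z => Φ z - Φ 0) (sub_self _)
  obtain ⟨K, hK⟩ := h1.lipschitzWith_of_hasCompactSupport h2 (by simp)
  refine ⟨K, fun x y => ?_⟩
  simpa [edist_eq_enorm_sub] using hK x y

/-- The integral of the pullback of the top-degree form with density `φ` over the shell. -/
def weightedDegree [MeasurableSpace E] (μ : Measure E) (φ : E → ℝ) (F : E → E) : ℝ :=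
  ∫ x in shell E, φ (F x) * (fderiv ℝ F x).det ∂μ

/-- By the chain rule the weighted integrand is the Jacobian of Φ ∘ F. Replacing `F` by a cut-off
`P` lets the null Lagrangian theorem apply despite the singularity at the origin. -/
lemma setIntegral_det_fderiv_comp_eq [MeasurableSpace E] [BorelSpace E] (μ : Measure E) {Φ P F : E → E} (hΦ : ContDiff ℝ ∞ Φ)
    (hF : ∀ x, x ≠ 0 → ContDiffAt ℝ ∞ F x) (h : ∀ x ∈ shell E, P =ᶠ[𝓝 x] F) :
    ∫ x in shell E, (fderiv ℝ (Φ ∘ P) x).det ∂μ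
      = weightedDegree μ (fun y => (fderiv ℝ Φ y).det) F := by
  refine setIntegral_congr_fun isClosed_shell.measurableSet fun x hx => ?_
  have hd : DifferentiableAt ℝ F x := (hF x (ne_zero_of_mem_shell hx)).differentiableAt (by simp)
  have hd' : DifferentiableAt ℝ P x := hd.congr_of_eventuallyEq (h x hx)
  simp only
  rw [fderiv_comp x (hΦ.differentiable (by simp) _) hd', (h x hx).fderiv_eq, (h x hx).eq_of_nhds]
  exact LinearMap.det_comp _ _

variable [FiniteDimensional ℝ E]

lemma isCompact_shell : IsCompact (shell E) :=
  Metric.isCompact_of_isClosed_isBounded isClosed_shell isBounded_shell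

/-- A smooth function that is `1` near a shell and has compact support away from the origin. -/
lemma exists_contDiff_shell_cutoff {a b c d : ℝ} (hab : a < b) (hcd : c < d) :
    ∃ η : E → ℝ, ContDiff ℝ ∞ η ∧ (∀ x, b ≤ ‖x‖ → ‖x‖ ≤ c → η x = 1) ∧
      (∀ x, ‖x‖ ≤ a → η x = 0) ∧ (∀ x, d ≤ ‖x‖ → η x = 0) ∧ ∀ x, η x ∈ Icc (0 : ℝ) 1 := by
  have hs : IsClosed {x : E | ‖x‖ ≤ a ∨ d ≤ ‖x‖} :=
    (isClosed_le continuous_norm continuous_const).union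
      (isClosed_le continuous_const continuous_norm)
  have ht : IsClosed {x : E | b ≤ ‖x‖ ∧ ‖x‖ ≤ c} :=
    (isClosed_le continuous_const continuous_norm).inter
      (isClosed_le continuous_norm continuous_const)
  obtain ⟨f, hf0, hf1, hf⟩ := exists_contMDiffMap_zero_one_of_isClosed 𝓘(ℝ, E) hs ht (by
    rw [Set.disjoint_left]
    rintro x (hx | hx) ⟨h1, h2⟩ <;> linarith) (n := ⊤)
  exact ⟨f, f.contMDiff.contDiff, fun x h1 h2 => hf1 ⟨h1, h2⟩, fun x hx => hf0 (Or.inl hx),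
    fun x hx => hf0 (Or.inr hx), hf⟩

/-- The weighted degree does not change under a homotopy along segments. -/
theorem weightedDegree_eq_of_norm_sub_lt {E : Type*} [NormedAddCommGroup E]
    [InnerProductSpace ℝ E] [FiniteDimensional ℝ E] [MeasurableSpace E] [BorelSpace E]
    (μ : Measure E) [μ.IsAddHaarMeasure] {Φ F F' : E → E} (hΦ : ContDiff ℝ ∞ Φ)
    (hsupp : ∀ y, (fderiv ℝ Φ y).det ≠ 0 → 1 / 2 < ‖y‖ ∧ ‖y‖ < 2)
    (hF : IsRadial F) (hF' : IsRadial F') (hFF' : ∀ x, x ≠ 0 → ‖F' x - F x‖ < 2 * ‖x‖) :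
    weightedDegree μ (fun y => (fderiv ℝ Φ y).det) F
      = weightedDegree μ (fun y => (fderiv ℝ Φ y).det) F' := by
  obtain ⟨η, hη, hη1, hη0, hη0', -⟩ := exists_contDiff_shell_cutoff (E := E) (a := 1 / 16)
    (b := 1 / 8) (c := 8) (d := 16) (by norm_num) (by norm_num)
  obtain ⟨χ, hχ, hχ1, hχ0, hχ0', hχI⟩ := exists_contDiff_shell_cutoff (E := E) (a := 1 / 4)
    (b := 1 / 2) (c := 2) (d := 4) (by norm_num) (by norm_num)
  -- `S` is `F` off the shell and `F'` on 1/2 ≤ ‖x‖ ≤ 2, the region carrying the density.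
  set S : E → E := fun x => F x + χ x • (F' x - F x) with hS
  -- If the segment from `F x` to `F' x` met the origin, its length would be ‖F x‖ + ‖F' x‖ = 2‖x‖.
  have hSne : ∀ x, x ≠ 0 → S x ≠ 0 := by
    intro x hx h0
    have hpos : 0 < ‖x‖ := norm_pos_iff.2 hx
    have h1 := hFF' x hx
    have e1 : F x = -(χ x • (F' x - F x)) := eq_neg_of_add_eq_zero_left h0
    have e2 : F' x = (1 - χ x) • (F' x - F x) := by
      rw [sub_smul, one_smul, sub_eq_add_neg, ← e1]
      abel
    have n1 : ‖x‖ = χ x * ‖F' x - F x‖ := by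
      conv_lhs => rw [← hF.norm_eq x, e1]
      rw [norm_neg, norm_smul, Real.norm_eq_abs, abs_of_nonneg (hχI x).1]
    have n2 : ‖x‖ = (1 - χ x) * ‖F' x - F x‖ := by
      conv_lhs => rw [← hF'.norm_eq x, e2]
      rw [norm_smul, Real.norm_eq_abs, abs_of_nonneg (sub_nonneg.2 (hχI x).2)]
    nlinarith
  set G : E → E := fun x => (‖x‖ * ‖S x‖⁻¹) • S x with hG
  have hGd : ∀ x, x ≠ 0 → ContDiffAt ℝ ∞ G x := by
    intro x hx
    have hSd : ContDiffAt ℝ ∞ S x := (hF.contDiffAt x hx).add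
      (hχ.contDiffAt.smul ((hF'.contDiffAt x hx).sub (hF.contDiffAt x hx)))
    exact (((contDiffAt_id.norm ℝ hx).mul ((hSd.norm ℝ (hSne x hx)).inv
      (norm_ne_zero_iff.2 (hSne x hx)))).smul hSd)
  have hGn : ∀ x, x ≠ 0 → ‖G x‖ = ‖x‖ := by
    intro x hx
    have := norm_ne_zero_iff.2 (hSne x hx)
    rw [hG]
    simp only [norm_smul, norm_mul, norm_inv, norm_norm]
    field_simp
  have hGF : ∀ x, x ∉ shell E → x ≠ 0 → G x = F x := by
    intro x hx hx0
    have h0 : χ x = 0 := by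
      simp only [shell, mem_ofPred_eq, not_and_or, not_le] at hx
      rcases hx with h | h
      · exact hχ0 x h.le
      · exact hχ0' x h.le
    have hSF : S x = F x := by simp [hS, h0]
    have hne := norm_ne_zero_iff.2 hx0
    simp only [hG]
    rw [hSF, hF.norm_eq, mul_inv_cancel₀ hne, one_smul]
  have hGF' : ∀ x, 1 / 2 ≤ ‖x‖ → ‖x‖ ≤ 2 → G x = F' x := by
    intro x h1 h2
    have hSF : S x = F' x := by simp [hS, hχ1 x h1 h2]
    have hne : ‖x‖ ≠ 0 := by linarith
    simp only [hG]
    rw [hSF, hF'.norm_eq, mul_inv_cancel₀ hne, one_smul]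
  have hcs : ∀ R : E → E, HasCompactSupport fun x => η x • R x := by
    intro R
    refine HasCompactSupport.of_support_subset_isCompact (isCompact_closedBall (0 : E) 16) ?_
    intro x hx
    rw [mem_closedBall_zero_iff]
    by_contra h
    exact hx (by simp [hη0' x (not_le.1 h).le])
  have hev : ∀ R : E → E, ∀ x ∈ shell E, (fun x => η x • R x) =ᶠ[𝓝 x] R := by
    intro R x hx
    have ho : IsOpen {x : E | 1 / 8 < ‖x‖ ∧ ‖x‖ < 8} :=
      (isOpen_lt continuous_const continuous_norm).inter
        (isOpen_lt continuous_norm continuous_const)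
    filter_upwards [ho.mem_nhds ⟨by linarith [hx.1], by linarith [hx.2]⟩] with z hz
    rw [hη1 z hz.1.le hz.2.le, one_smul]
  have hP := contDiff_smul_cutoff hF.contDiffAt hη (by norm_num) hη0
  have hQ := contDiff_smul_cutoff hGd hη (by norm_num) hη0
  obtain ⟨K, hK⟩ := exists_lipschitzWith_comp_of_hasCompactSupport hΦ hP (hcs F)
  obtain ⟨K', hK'⟩ := exists_lipschitzWith_comp_of_hasCompactSupport hΦ hQ (hcs G)
  have main := setIntegral_det_fderiv_eq_of_eqOn_compl μ ((hΦ.comp hP).of_le (by simp))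
    ((hΦ.comp hQ).of_le (by simp)) (hK.weaken (le_max_left K K')) (hK'.weaken (le_max_right K K'))
    isClosed_shell.measurableSet isBounded_shell (by
      intro x hx
      by_cases hx0 : x = 0
      · simp [hx0, hη0 0 (by simp)]
      · simp [hGF x hx hx0])
  rw [setIntegral_det_fderiv_comp_eq μ hΦ hF.contDiffAt (hev F),
    setIntegral_det_fderiv_comp_eq μ hΦ hGd (hev G)] at main
  rw [main]
  refine setIntegral_congr_fun isClosed_shell.measurableSet fun x hx => ?_
  have hx0 := ne_zero_of_mem_shell hx
  -- Inside this annulus `G` and `F'` agree; outside it both preserve the norm, so the density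
  -- vanishes at both values.
  by_cases hr : 1 / 2 < ‖x‖ ∧ ‖x‖ < 2
  · have ho : IsOpen {x : E | 1 / 2 < ‖x‖ ∧ ‖x‖ < 2} :=
      (isOpen_lt continuous_const continuous_norm).inter
        (isOpen_lt continuous_norm continuous_const)
    have : G =ᶠ[𝓝 x] F' := by
      filter_upwards [ho.mem_nhds hr] with z hz
      exact hGF' z hz.1.le hz.2.le
    simp only [this.fderiv_eq, this.eq_of_nhds]
  · have z1 : (fderiv ℝ Φ (G x)).det = 0 := by
      by_contra h
      exact hr (hGn x hx0 ▸ hsupp _ h)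
    have z2 : (fderiv ℝ Φ (F' x)).det = 0 := by
      by_contra h
      exact hr (hF'.norm_eq x ▸ hsupp _ h)
    simp only [z1, z2, zero_mul]

end WeightedDegree

end SphericalFraming

end

noncomputable section

namespace SphericalFraming

/-! ### Nonnegative Jacobians with small support. -/

section Bump

/-- The one-dimensional smooth step from `0` to `1` across `[-δ, δ]`. -/
def smoothStep (δ : ℝ) (t : ℝ) : ℝ := Real.smoothTransition ((t + δ) / (2 * δ))

lemma contDiff_smoothStep (δ : ℝ) : ContDiff ℝ ∞ (smoothStep δ) :=
  Real.smoothTransition.contDiff.comp ((contDiff_id.add contDiff_const).div_const _)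

lemma deriv_smoothStep_eq_zero {δ t : ℝ} (hδ : 0 < δ) (ht : δ < |t|) :
    deriv (smoothStep δ) t = 0 := by
  rcases lt_abs.1 ht with h | h
  · have : smoothStep δ =ᶠ[𝓝 t] fun _ => 1 := by
      filter_upwards [lt_mem_nhds h] with s hs
      refine Real.smoothTransition.one_of_one_le ?_
      rw [le_div_iff₀ (by positivity)]
      linarith
    rw [this.deriv_eq, deriv_const]
  · have : smoothStep δ =ᶠ[𝓝 t] fun _ => 0 := by
      filter_upwards [gt_mem_nhds (show t < -δ by linarith)] with s hs
      refine Real.smoothTransition.zero_of_nonpos ?_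
      exact div_nonpos_of_nonpos_of_nonneg (by linarith) (by positivity)
    rw [this.deriv_eq, deriv_const]

lemma monotone_smoothStep {δ : ℝ} (hδ : 0 < δ) : Monotone (smoothStep δ) := fun a b h =>
  Real.smoothTransition.monotone (by gcongr)

lemma exists_deriv_smoothStep_pos {δ : ℝ} (hδ : 0 < δ) : ∃ t, 0 < deriv (smoothStep δ) t := by
  obtain ⟨c, -, hc⟩ := exists_deriv_eq_slope (smoothStep δ) (show -δ < δ by linarith)
    (contDiff_smoothStep δ).continuous.continuousOn
    ((contDiff_smoothStep δ).differentiable (by simp)).differentiableOn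
  refine ⟨c, ?_⟩
  have h1 : smoothStep δ δ = 1 := Real.smoothTransition.one_of_one_le (by
    rw [le_div_iff₀ (by positivity)]; linarith)
  have h0 : smoothStep δ (-δ) = 0 := Real.smoothTransition.zero_of_nonpos (by simp)
  rw [hc, h1, h0]
  apply div_pos <;> linarith

variable {n : ℕ}

/-- The product of smooth steps. -/
def stepMap (n : ℕ) (δ : ℝ) (w : Fin n → ℝ) : Fin n → ℝ := fun i => smoothStep δ (w i)

lemma contDiff_stepMap (δ : ℝ) : ContDiff ℝ ∞ (stepMap n δ) :=
  contDiff_pi.2 fun i => (contDiff_smoothStep δ).comp (contDiff_apply ℝ ℝ i)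

lemma det_fderiv_stepMap (δ : ℝ) (w : Fin n → ℝ) :
    (fderiv ℝ (stepMap n δ) w).det = ∏ i, deriv (smoothStep δ) (w i) := by
  have h : HasFDerivAt (stepMap n δ) (ContinuousLinearMap.pi fun i =>
      ((ContinuousLinearMap.toSpanSingleton ℝ (deriv (smoothStep δ) (w i))).comp
        (ContinuousLinearMap.proj (R := ℝ) (φ := fun _ : Fin n => ℝ) i))) w := by
    rw [hasFDerivAt_pi]
    intro i
    exact ((((contDiff_smoothStep δ).differentiable (by simp) (w i)).hasDerivAt).hasFDerivAt).comp w
      (hasFDerivAt_apply i w)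
  rw [h.fderiv, ContinuousLinearMap.det_pi]
  simp

variable {E : Type*} [NormedAddCommGroup E] [NormedSpace ℝ E] [FiniteDimensional ℝ E]

/-- Every neighbourhood of a point supports the Jacobian of a smooth map which is nonnegative and
positive somewhere. -/
lemma exists_contDiff_det_fderiv_bump (y : E) {V : Set E} (hV : V ∈ 𝓝 y) :
    ∃ Φ : E → E, ContDiff ℝ ∞ Φ ∧ (∀ z, 0 ≤ (fderiv ℝ Φ z).det) ∧
      (∀ z, (fderiv ℝ Φ z).det ≠ 0 → z ∈ V) ∧ ∃ z, (fderiv ℝ Φ z).det ≠ 0 := by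
  let e : E ≃L[ℝ] (Fin (Module.finrank ℝ E) → ℝ) :=
    ContinuousLinearEquiv.ofFinrankEq (by simp)
  have hV' : (fun w => e.symm w + y) ⁻¹' V ∈ 𝓝 (0 : Fin (Module.finrank ℝ E) → ℝ) := by
    apply ContinuousAt.preimage_mem_nhds
    · fun_prop
    · simpa using hV
  obtain ⟨δ, hδ, hball⟩ := Metric.nhds_basis_closedBall.mem_iff.1 hV'
  -- In coordinates centred at `y` this is a product of one-variable steps, so the Jacobian is a
  -- product of nonnegative derivatives supported in the cube of radius `δ`.
  set Φ : E → E := fun z => e.symm (stepMap _ δ (e (z - y))) with hΦ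
  have hdet : ∀ z, (fderiv ℝ Φ z).det = ∏ i, deriv (smoothStep δ) (e (z - y) i) := by
    intro z
    have h1 : HasFDerivAt (fun z => e (z - y)) (e : E →L[ℝ] _) z :=
      e.hasFDerivAt.comp z ((hasFDerivAt_id z).sub_const y)
    have h2 : HasFDerivAt (stepMap (Module.finrank ℝ E) δ)
        (fderiv ℝ (stepMap _ δ) (e (z - y))) (e (z - y)) :=
      ((contDiff_stepMap δ).differentiable (by simp) _).hasFDerivAt
    have h3 : HasFDerivAt Φ ((e.symm : _ →L[ℝ] E).comp
        ((fderiv ℝ (stepMap _ δ) (e (z - y))).comp (e : E →L[ℝ] _))) z :=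
      HasFDerivAt.comp z (g := e.symm) e.symm.hasFDerivAt
        (HasFDerivAt.comp z (g := stepMap _ δ) (f := fun z => e (z - y)) h2 h1)
    rw [h3.fderiv, ← det_fderiv_stepMap]
    exact LinearMap.det_conj (fderiv ℝ (stepMap _ δ) (e (z - y))).toLinearMap
      e.symm.toLinearEquiv
  refine ⟨Φ, ?_, ?_, ?_, ?_⟩
  · exact e.symm.contDiff.comp ((contDiff_stepMap δ).comp
      (e.contDiff.comp (contDiff_id.sub contDiff_const)))
  · intro z
    rw [hdet]
    exact Finset.prod_nonneg fun i _ => (monotone_smoothStep hδ).deriv_nonneg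
  · intro z hz
    rw [hdet, Finset.prod_ne_zero_iff] at hz
    have : e (z - y) ∈ Metric.closedBall (0 : Fin (Module.finrank ℝ E) → ℝ) δ := by
      rw [mem_closedBall_zero_iff, pi_norm_le_iff_of_nonneg hδ.le]
      intro i
      by_contra h
      exact hz i (Finset.mem_univ i) (deriv_smoothStep_eq_zero hδ (not_le.1 h))
    simpa using hball this
  · obtain ⟨t, ht⟩ := exists_deriv_smoothStep_pos hδ
    refine ⟨e.symm (fun _ => t) + y, ?_⟩
    rw [hdet]
    simp [ht.ne']

end Bump

/-! ### The weighted degree as a signed count of preimages. -/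

section Counting

open MeasureTheory

variable {E : Type*} [NormedAddCommGroup E] [NormedSpace ℝ E]

lemma IsRadial.norm_of_mem_fiber {F : E → E} (hF : IsRadial F) {y x : E} (hx : F x = y) :
    ‖x‖ = ‖y‖ := by rw [← hx, hF.norm_eq]

variable [FiniteDimensional ℝ E]

/-- The inverse function theorem, on a neighbourhood shrunk until the Jacobian keeps its sign. -/
lemma IsRadial.exists_local_inverse {F : E → E} (hF : IsRadial F) {x : E} (hx : x ≠ 0)
    (hdet : (fderiv ℝ F x).det ≠ 0) {U : Set E} (hU : U ∈ 𝓝 x) :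
    ∃ W ⊆ U, IsOpen W ∧ x ∈ W ∧ 0 ∉ W ∧ InjOn F W ∧ IsOpen (F '' W) ∧
      ∀ z ∈ W, SignType.sign (fderiv ℝ F z).det = SignType.sign (fderiv ℝ F x).det := by
  have hs : HasStrictFDerivAt F
      (((LinearMap.equivOfDetNeZero _ hdet).toContinuousLinearEquiv : E ≃L[ℝ] E) : E →L[ℝ] E) x := by
    have := (hF.contDiffAt x hx).hasStrictFDerivAt (by simp)
    convert! this using 1
  set p := hs.toOpenPartialHomeomorph F with hp
  have hpF : ⇑p = F := hs.toOpenPartialHomeomorph_coe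
  have hsign : ∀ᶠ z in 𝓝 x, SignType.sign (fderiv ℝ F z).det
      = SignType.sign (fderiv ℝ F x).det := by
    have hc : ContinuousAt (fun z => (fderiv ℝ F z).det) x :=
      hF.continuousOn_det_fderiv.continuousAt (isOpen_compl_singleton.mem_nhds hx)
    rcases hdet.lt_or_gt with h | h
    · filter_upwards [hc.eventually (gt_mem_nhds h)] with z hz
      rw [sign_neg h, sign_neg hz]
    · filter_upwards [hc.eventually (lt_mem_nhds h)] with z hz
      rw [sign_pos h, sign_pos hz]
  have hN : {z | z ∈ U ∧ z ≠ 0 ∧ z ∈ p.source ∧ SignType.sign (fderiv ℝ F z).det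
      = SignType.sign (fderiv ℝ F x).det} ∈ 𝓝 x := by
    filter_upwards [hU, isOpen_compl_singleton.mem_nhds hx,
      p.open_source.mem_nhds hs.mem_toOpenPartialHomeomorph_source, hsign] with z h1 h2 h3 h4
    exact ⟨h1, h2, h3, h4⟩
  obtain ⟨W, hWs, hWo, hxW⟩ := mem_nhds_iff.1 hN
  refine ⟨W, fun z hz => (hWs hz).1, hWo, hxW, fun h => (hWs h).2.1 rfl, ?_, ?_,
    fun z hz => (hWs hz).2.2.2⟩
  · rw [← hpF]
    exact p.injOn.mono fun z hz => (hWs hz).2.2.1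
  · rw [← hpF]
    exact p.isOpen_image_of_subset_source hWo fun z hz => (hWs hz).2.2.1

/-- The fibre is a closed subset of the sphere of radius ‖y‖, hence compact, and local injectivity
makes it discrete. -/
lemma IsRadial.finite_fiber {F : E → E} (hF : IsRadial F) {y : E} (hy : y ≠ 0)
    (hreg : ∀ x, F x = y → (fderiv ℝ F x).det ≠ 0) : {x | F x = y}.Finite := by
  have hx0 : ∀ x, F x = y → x ≠ 0 := fun x hx h => hy (by
    rw [← norm_eq_zero, ← hF.norm_of_mem_fiber hx, h, norm_zero])
  have hcF : ContinuousOn F (Metric.sphere 0 ‖y‖) := fun x hx =>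
    (hF.continuousAt (by rintro rfl; simp at hx; exact hy (norm_eq_zero.1 hx.symm))).continuousWithinAt
  have heq : {x | F x = y} = Metric.sphere 0 ‖y‖ ∩ F ⁻¹' {y} := by
    ext x
    simp only [mem_ofPred_eq, mem_inter_iff, mem_sphere_zero_iff_norm, mem_preimage,
      mem_singleton_iff]
    exact ⟨fun h => ⟨hF.norm_of_mem_fiber h, h⟩, fun h => h.2⟩
  have hcpt : IsCompact {x | F x = y} := by
    rw [heq]
    exact (isCompact_sphere _ _).of_isClosed_subset
      (hcF.preimage_isClosed_of_isClosed Metric.isClosed_sphere isClosed_singleton)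
      inter_subset_left
  refine hcpt.finite ?_
  rw [isDiscrete_iff_forall_mem_exists_isOpen]
  intro x hx
  obtain ⟨W, -, hWo, hxW, -, hinj, -, -⟩ := hF.exists_local_inverse (hx0 x hx) (hreg x hx)
    Filter.univ_mem
  refine ⟨W, hWo, ?_⟩
  ext z
  exact ⟨fun h => hinj h.1 hxW (h.2.trans hx.symm), fun h => h ▸ ⟨hxW, hx⟩⟩

variable [MeasurableSpace E] [BorelSpace E] (μ : Measure E) [μ.IsAddHaarMeasure]

/-- The weighted degree is computed by the signed count of the preimages of a regular value. -/
theorem IsRadial.exists_nhds_weightedDegree_eq {F : E → E} (hF : IsRadial F) {y : E}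
    (hy : ‖y‖ = 1) (hreg : ∀ x, F x = y → (fderiv ℝ F x).det ≠ 0) :
    ∃ V ∈ 𝓝 y, ∀ φ : E → ℝ, Continuous φ → (∀ z, φ z ≠ 0 → z ∈ V) →
      weightedDegree μ φ F
        = ((∑ᶠ x ∈ {x | F x = y}, (SignType.sign (fderiv ℝ F x).det : ℤ) : ℤ) : ℝ)
          * ∫ z, φ z ∂μ := by
  have hy0 : y ≠ 0 := by rintro rfl; simp at hy
  have hfin := hF.finite_fiber hy0 hreg
  have hx1 : ∀ x, F x = y → ‖x‖ = 1 := fun x hx => (hF.norm_of_mem_fiber hx).trans hy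
  have hx0 : ∀ x, F x = y → x ≠ 0 := fun x hx h => by
    have := hx1 x hx
    simp [h] at this
  have hshell : ∀ x, F x = y → shell E ∈ 𝓝 x := by
    intro x hx
    have ho : IsOpen {x : E | 1 / 4 < ‖x‖ ∧ ‖x‖ < 4} :=
      (isOpen_lt continuous_const continuous_norm).inter
        (isOpen_lt continuous_norm continuous_const)
    refine Filter.mem_of_superset (ho.mem_nhds ?_) fun z hz => ⟨hz.1.le, hz.2.le⟩
    rw [mem_ofPred_eq, hx1 x hx]
    norm_num
  obtain ⟨U, hU, hdisj⟩ := hfin.t2_separation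
  have hloc : ∀ x, ∃ W : Set E, F x = y → (W ⊆ U x ∩ shell E ∧ IsOpen W ∧ x ∈ W ∧ 0 ∉ W ∧
      InjOn F W ∧ IsOpen (F '' W) ∧
      ∀ z ∈ W, SignType.sign (fderiv ℝ F z).det = SignType.sign (fderiv ℝ F x).det) := by
    intro x
    by_cases hx : F x = y
    · obtain ⟨W, h⟩ := hF.exists_local_inverse (hx0 x hx) (hreg x hx)
        (Filter.inter_mem ((hU x).2.mem_nhds (hU x).1) (hshell x hx))
      exact ⟨W, fun _ => h⟩
    · exact ⟨∅, fun h => absurd h hx⟩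
  choose W hW using hloc
  set T := hfin.toFinset with hT
  have hmem : ∀ x, x ∈ T ↔ F x = y := fun x => by simp [hT]
  have hUo : IsOpen (⋃ x ∈ T, W x) := isOpen_biUnion fun x hx => (hW x ((hmem x).1 hx)).2.1
  have hcs : ContinuousOn F (shell E) := fun x hx =>
    (hF.continuousAt (ne_zero_of_mem_shell hx)).continuousWithinAt
  have hcl : IsClosed (F '' (shell E \ ⋃ x ∈ T, W x)) :=
    ((isCompact_shell.diff hUo).image_of_continuousOn (hcs.mono sdiff_subset)).isClosed
  -- Every point of this neighbourhood is hit exactly once from each `W x`, and not at all from the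
  -- rest of the shell.
  refine ⟨(⋂ x ∈ T, F '' W x) ∩ (F '' (shell E \ ⋃ x ∈ T, W x))ᶜ, ?_, ?_⟩
  · refine Filter.inter_mem ?_ ?_
    · rw [Filter.biInter_finset_mem]
      intro x hx
      have h := hW x ((hmem x).1 hx)
      exact h.2.2.2.2.2.1.mem_nhds ⟨x, h.2.2.1, (hmem x).1 hx⟩
    · refine hcl.isOpen_compl.mem_nhds ?_
      rintro ⟨x, ⟨-, hx⟩, hxy⟩
      have hxT := (hmem x).2 hxy
      exact hx (mem_biUnion hxT (hW x hxy).2.2.1)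
  intro φ hφ hsupp
  have hint : IntegrableOn (fun x => φ (F x) * (fderiv ℝ F x).det) (shell E) μ := by
    refine ContinuousOn.integrableOn_compact isCompact_shell ?_
    refine (hφ.comp_continuousOn hcs).mul (hF.continuousOn_det_fderiv.mono fun x hx =>
      ne_zero_of_mem_shell hx)
  have hsub : (⋃ x ∈ T, W x) ⊆ shell E := iUnion₂_subset fun x hx =>
    (hW x ((hmem x).1 hx)).1.trans inter_subset_right
  have h1 : weightedDegree μ φ F
      = ∫ x in ⋃ x ∈ T, W x, φ (F x) * (fderiv ℝ F x).det ∂μ := by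
    refine (setIntegral_eq_of_subset_of_forall_sdiff_eq_zero isClosed_shell.measurableSet hsub
      fun x hx => ?_)
    have : φ (F x) = 0 := by
      by_contra h
      exact (hsupp _ h).2 ⟨x, hx, rfl⟩
    rw [this, zero_mul]
  -- Change of variables yields |det|; the sign, constant on `W x`, accounts for the difference from
  -- det.
  have h2 : ∀ x ∈ T, ∫ z in W x, φ (F z) * (fderiv ℝ F z).det ∂μ
      = ((SignType.sign (fderiv ℝ F x).det : ℤ) : ℝ) * ∫ z, φ z ∂μ := by
    intro x hx
    obtain ⟨-, hWo, -, hW0, hinj, -, hsgn⟩ := hW x ((hmem x).1 hx)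
    have h3 : ∫ z, φ z ∂μ = ∫ z in F '' W x, φ z ∂μ := by
      refine (setIntegral_eq_integral_of_forall_compl_eq_zero fun z hz => ?_).symm
      by_contra h
      exact hz (mem_iInter₂.1 (hsupp _ h).1 x hx)
    rw [h3, integral_image_eq_integral_abs_det_fderiv_smul μ hWo.measurableSet
      (fun z hz => (hF.differentiableAt fun h => hW0 (h ▸ hz)).hasFDerivAt.hasFDerivWithinAt) hinj,
      ← integral_const_mul]
    refine setIntegral_congr_fun hWo.measurableSet fun z hz => ?_
    simp only [smul_eq_mul]
    rw [← hsgn z hz, ← mul_assoc, mul_comm (φ (F z))]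
    congr 1
    rcases lt_trichotomy (fderiv ℝ F z).det 0 with h | h | h
    · simp [sign_neg h, abs_of_neg h]
    · simp [h]
    · simp [sign_pos h, abs_of_pos h]
  rw [h1, integral_biUnion_finset T (fun x hx => (hW x ((hmem x).1 hx)).2.1.measurableSet)
    (by
      intro a ha b hb hab
      exact (hdisj ((hmem a).1 ha) ((hmem b).1 hb) hab).mono
        ((hW a ((hmem a).1 ha)).1.trans inter_subset_left)
        ((hW b ((hmem b).1 hb)).1.trans inter_subset_left))
    (fun x hx => hint.mono_set ((subset_biUnion_of_mem hx).trans hsub)),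
    Finset.sum_congr rfl h2, ← Finset.sum_mul]
  congr 1
  rw [finsum_mem_eq_finite_toFinset_sum _ hfin, Int.cast_sum]

end Counting

end SphericalFraming

end

noncomputable section

namespace SphericalFraming

/-! ### Smooth maps into the 3-sphere -/

instance measurableSpaceQuaternion : MeasurableSpace ℍ[ℝ] := borel _

instance borelSpaceQuaternion : BorelSpace ℍ[ℝ] := ⟨rfl⟩

instance pathConnectedSpaceS3 : PathConnectedSpace S3 := by
  rw [← isPathConnected_iff_pathConnectedSpace]
  refine isPathConnected_sphere ?_ 0 zero_le_one
  rw [← Module.finrank_eq_rank, Quaternion.finrank_eq_four]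
  norm_num

lemma norm_coe_S3 (x : S3) : ‖(x : ℍ[ℝ])‖ = 1 := norm_eq_of_mem_sphere x

lemma coe_S3_ne_zero (x : S3) : (x : ℍ[ℝ]) ≠ 0 := ne_zero_of_mem_unit_sphere x

open Classical in
/-- The direction of a nonzero quaternion. -/
def dir (x : ℍ[ℝ]) : S3 :=
  if h : x = 0 then 1 else ⟨‖x‖⁻¹ • x, by simp [norm_smul, norm_ne_zero_iff.2 h]⟩

lemma coe_dir {x : ℍ[ℝ]} (h : x ≠ 0) : (dir x : ℍ[ℝ]) = ‖x‖⁻¹ • x := by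
  rw [dir, dif_neg h]

lemma norm_smul_dir (x : ℍ[ℝ]) : ‖x‖ • (dir x : ℍ[ℝ]) = x := by
  by_cases h : x = 0
  · simp [h]
  · rw [coe_dir h, smul_smul, mul_inv_cancel₀ (norm_ne_zero_iff.2 h), one_smul]

lemma dir_coe (x : S3) : dir (x : ℍ[ℝ]) = x := by
  apply Subtype.ext
  rw [coe_dir (coe_S3_ne_zero x), norm_coe_S3]
  simp

lemma dir_smul {c : ℝ} (hc : 0 < c) (x : ℍ[ℝ]) : dir (c • x) = dir x := by
  by_cases h : x = 0
  · simp [h]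
  · apply Subtype.ext
    rw [coe_dir h, coe_dir (smul_ne_zero hc.ne' h), norm_smul, smul_smul, Real.norm_eq_abs,
      abs_of_pos hc, mul_inv_rev, mul_assoc, inv_mul_cancel₀ hc.ne', mul_one]

lemma continuousOn_dir : ContinuousOn dir {0}ᶜ := by
  rw [Topology.IsInducing.subtypeVal.continuousOn_iff]
  have : ContinuousOn (fun x : ℍ[ℝ] => ‖x‖⁻¹ • x) {0}ᶜ :=
    (continuous_norm.continuousOn.inv₀ fun x hx => norm_ne_zero_iff.2 hx).smul continuousOn_id
  exact this.congr fun x hx => coe_dir hx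

lemma continuous_dir_comp {X : Type*} [TopologicalSpace X] {f : X → ℍ[ℝ]} (hf : Continuous f)
    (h0 : ∀ x, f x ≠ 0) : Continuous fun x => dir (f x) :=
  continuousOn_dir.comp_continuous hf h0

section ContMDiff

variable {F H M : Type*} [NormedAddCommGroup F] [NormedSpace ℝ F] [TopologicalSpace H]
  {I : ModelWithCorners ℝ F H} [TopologicalSpace M] [ChartedSpace H M]

lemma contMDiff_coe_comp {f : M → S3} (hf : ContMDiff I (𝓡 3) ∞ f) :
    ContMDiff I 𝓘(ℝ, ℍ[ℝ]) ∞ fun x => (f x : ℍ[ℝ]) :=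
  contMDiff_coe_sphere.comp hf

variable [IsManifold I ∞ M]

lemma contMDiff_toS3 {f : M → S3} (hf : ContMDiff I 𝓘(ℝ, ℍ[ℝ]) ∞ fun x => (f x : ℍ[ℝ])) :
    ContMDiff I (𝓡 3) ∞ f :=
  ContMDiff.codRestrict_sphere hf fun x => (f x).2

lemma contMDiff_dir_comp {f : M → ℍ[ℝ]} (hf : ContMDiff I 𝓘(ℝ, ℍ[ℝ]) ∞ f) (h0 : ∀ x, f x ≠ 0) :
    ContMDiff I (𝓡 3) ∞ fun x => dir (f x) := by
  apply contMDiff_toS3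
  have h : ContDiffOn ℝ ∞ (fun x : ℍ[ℝ] => ‖x‖⁻¹ • x) {0}ᶜ := fun x hx =>
    (((contDiffAt_id.norm ℝ hx).inv (norm_ne_zero_iff.2 hx)).smul
      contDiffAt_id).contDiffWithinAt
  have := h.contMDiffOn.comp_contMDiff hf h0
  convert! this using 1
  ext1 x
  exact coe_dir (h0 x)

lemma contMDiff_S3_mul {f g : M → S3} (hf : ContMDiff I (𝓡 3) ∞ f)
    (hg : ContMDiff I (𝓡 3) ∞ g) : ContMDiff I (𝓡 3) ∞ fun x => f x * g x := by
  apply contMDiff_toS3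
  have h : ContDiff ℝ ∞ fun p : ℍ[ℝ] × ℍ[ℝ] => p.1 * p.2 := contDiff_mul
  exact h.contMDiff.comp ((contMDiff_coe_comp hf).prodMk_space (contMDiff_coe_comp hg))

end ContMDiff

/-- Smoothness of the direction is available for nowhere vanishing maps, so a bump function replaces
the identity by the map x + b(z)(z - x). It agrees with the identity near `x` and avoids 0, because
b(z)‖z - x‖ < ‖x‖. -/
lemma contMDiffAt_dir {x : ℍ[ℝ]} (hx : x ≠ 0) : ContMDiffAt 𝓘(ℝ, ℍ[ℝ]) (𝓡 3) ∞ dir x := by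
  have hr : 0 < ‖x‖ := norm_pos_iff.2 hx
  let b : ContDiffBump x := ⟨‖x‖ / 2, ‖x‖, by positivity, by linarith⟩
  have hb : ContDiff ℝ ∞ fun z => x + b z • (z - x) :=
    contDiff_const.add (b.contDiff.smul (contDiff_id.sub contDiff_const))
  have h0 : ∀ z, x + b z • (z - x) ≠ 0 := by
    intro z hz
    by_cases h : dist z x < ‖x‖
    · have e : x = -(b z • (z - x)) := eq_neg_of_add_eq_zero_left hz
      have := congrArg norm e
      rw [norm_neg, norm_smul, Real.norm_eq_abs, abs_of_nonneg b.nonneg, ← dist_eq_norm] at this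
      have h1 : b z ≤ 1 := b.le_one
      have h2 : 0 ≤ b z := b.nonneg
      nlinarith [dist_nonneg (x := z) (y := x)]
    · rw [b.zero_of_le_dist (not_lt.1 h), zero_smul, add_zero] at hz
      exact hx hz
  refine (contMDiff_dir_comp hb.contMDiff h0 x).congr_of_eventuallyEq ?_
  filter_upwards [Metric.closedBall_mem_nhds x (half_pos hr)] with z hz
  rw [b.one_of_mem_closedBall hz, one_smul, add_sub_cancel]

/-! ### Homogeneous extension -/

/-- The homogeneous extension of a self-map of the sphere. -/
def rad (g : S3 → S3) (x : ℍ[ℝ]) : ℍ[ℝ] := ‖x‖ • (g (dir x) : ℍ[ℝ])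

lemma rad_coe (g : S3 → S3) (x : S3) : rad g x = g x := by
  rw [rad, norm_coe_S3, one_smul, dir_coe]

lemma rad_smul (g : S3 → S3) {c : ℝ} (hc : 0 < c) (x : ℍ[ℝ]) : rad g (c • x) = c • rad g x := by
  rw [rad, rad, dir_smul hc, norm_smul, Real.norm_eq_abs, abs_of_pos hc, mul_smul]

lemma isRadial_rad {g : S3 → S3} (hg : ContMDiff (𝓡 3) (𝓡 3) ∞ g) : IsRadial (rad g) := by
  refine ⟨fun x => by simp [rad, norm_smul], fun x hx => ?_⟩
  have h1 : ContMDiffAt 𝓘(ℝ, ℍ[ℝ]) 𝓘(ℝ, ℍ[ℝ]) ∞ (fun z => (g (dir z) : ℍ[ℝ])) x :=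
    (contMDiff_coe_comp hg (dir x)).comp x (contMDiffAt_dir hx)
  exact (contDiffAt_id.norm ℝ hx).smul h1.contDiffAt

/-- The extension is homogeneous of degree one, so its derivative is homogeneous of degree zero;
critical points away from the origin therefore come in rays. -/
lemma fderiv_rad_smul {g : S3 → S3} {c : ℝ} (hc : 0 < c) (x : ℍ[ℝ]) :
    fderiv ℝ (rad g) (c • x) = fderiv ℝ (rad g) x := by
  have h1 : (fun z => rad g (c • z)) = fun z => c • rad g z := funext fun z => rad_smul g hc z
  have h2 : fderiv ℝ (fun z => rad g (c • z)) x = c • fderiv ℝ (rad g) (c • x) :=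
    fderiv_comp_smul c
  have h3 : fderiv ℝ (fun z => c • rad g z) x = c • fderiv ℝ (rad g) x :=
    have := invertibleOfNonzero hc.ne'
    fderiv_const_smul_of_invertible (f := rad g) c
  rw [h1, h3] at h2
  exact (smul_right_injective _ hc.ne' h2).symm

/-- Euler's identity for homogeneous functions, by differentiating along the ray through `x`. -/
lemma fderiv_rad_self {g : S3 → S3} (hg : ContMDiff (𝓡 3) (𝓡 3) ∞ g) (x : S3) :
    fderiv ℝ (rad g) x x = g x := by
  have hF := ((isRadial_rad hg).differentiableAt (coe_S3_ne_zero x)).hasFDerivAt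
  have h1 : HasDerivAt (fun t : ℝ => t • (x : ℍ[ℝ])) (x : ℍ[ℝ]) 1 := by
    simpa using (hasDerivAt_id (1 : ℝ)).smul_const (x : ℍ[ℝ])
  have h2 : HasDerivAt (fun t : ℝ => rad g (t • (x : ℍ[ℝ]))) (fderiv ℝ (rad g) x x) 1 :=
    HasFDerivAt.comp_hasDerivAt (l := rad g) (f := fun t : ℝ => t • (x : ℍ[ℝ])) 1
      (by simpa using hF) h1
  have h3 : HasDerivAt (fun t : ℝ => rad g (t • (x : ℍ[ℝ]))) (g x : ℍ[ℝ]) 1 := by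
    have : HasDerivAt (fun t : ℝ => t • (g x : ℍ[ℝ])) (g x : ℍ[ℝ]) 1 := by
      simpa using (hasDerivAt_id (1 : ℝ)).smul_const (g x : ℍ[ℝ])
    refine this.congr_of_eventuallyEq ?_
    filter_upwards [lt_mem_nhds (zero_lt_one (α := ℝ))] with t ht
    rw [rad_smul g ht, rad_coe]
  exact h2.unique h3

lemma mdifferentiableAt_coe_S3 (x : S3) :
    MDifferentiableAt (𝓡 3) 𝓘(ℝ, ℍ[ℝ]) ((↑) : S3 → ℍ[ℝ]) x :=
  (contMDiff_coe_sphere (m := 1)).mdifferentiable one_ne_zero x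

lemma inclDeriv_mfderiv {g : S3 → S3} {x : S3} (hg : MDifferentiableAt (𝓡 3) (𝓡 3) g x)
    (v : TangentSpace (𝓡 3) x) :
    inclDeriv (g x) (mfderiv (𝓡 3) (𝓡 3) g x v)
      = mfderiv (𝓡 3) 𝓘(ℝ, ℍ[ℝ]) (fun z => (g z : ℍ[ℝ])) x v := by
  have := mfderiv_comp x (mdifferentiableAt_coe_S3 (g x)) hg
  exact (congrArg (fun T => T v) this).symm

/-- The chain rule through the inclusion: any ambient extension of `g` computes its tangential
derivative. -/
lemma fderiv_inclDeriv {P : ℍ[ℝ] → ℍ[ℝ]} {g : S3 → S3} {x : S3}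
    (hg : MDifferentiableAt (𝓡 3) (𝓡 3) g x) (hP : DifferentiableAt ℝ P x)
    (h : ∀ z : S3, P z = g z) (v : TangentSpace (𝓡 3) x) :
    fderiv ℝ P x (inclDeriv x v) = inclDeriv (g x) (mfderiv (𝓡 3) (𝓡 3) g x v) := by
  rw [inclDeriv_mfderiv hg]
  have e : (fun z => (g z : ℍ[ℝ])) = P ∘ ((↑) : S3 → ℍ[ℝ]) := funext fun z => (h z).symm
  rw [e, mfderiv_comp x hP.mdifferentiableAt (mdifferentiableAt_coe_S3 x), mfderiv_eq_fderiv]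
  rfl

end SphericalFraming

end

noncomputable section

namespace SphericalFraming

/-! ### The Jacobian and the degree count -/

lemma S3_coe_mul_inv (q : S3) : (q : ℍ[ℝ]) * ((q⁻¹ : S3) : ℍ[ℝ]) = 1 := by
  rw [← Metric.unitSphere.coe_mul, mul_inv_cancel, Metric.unitSphere.coe_one]

lemma S3_coe_inv_mul (q : S3) : ((q⁻¹ : S3) : ℍ[ℝ]) * (q : ℍ[ℝ]) = 1 := by
  rw [← Metric.unitSphere.coe_mul, inv_mul_cancel, Metric.unitSphere.coe_one]

lemma canonical_fiber_apply (x : S3) (v : TangentSpace (𝓡 3) x) :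
    canonical.fiber x v = imCoord (((x⁻¹ : S3) : ℍ[ℝ]) * inclDeriv x v) := rfl

lemma mul_imQuat_canonical_fiber (x : S3) (v : TangentSpace (𝓡 3) x) :
    (x : ℍ[ℝ]) * imQuat (canonical.fiber x v) = inclDeriv x v := by
  rw [canonical_fiber_apply, imQuat_imCoord _ (by rw [coe_inv_eq_star]; exact inclDeriv_re x v),
    ← mul_assoc, S3_coe_mul_inv, one_mul]

/-- The determinant is continuous and nowhere zero on the connected sphere, and equals 1 at the
identity. -/
lemma det_mulLeft_S3_pos (q : S3) :
    0 < LinearMap.det (LinearMap.mulLeft ℝ (q : ℍ[ℝ])) := by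
  have hc : Continuous fun q : S3 => (ContinuousLinearMap.mul ℝ ℍ[ℝ] (q : ℍ[ℝ])).det :=
    ContinuousLinearMap.continuous_det.comp
      ((ContinuousLinearMap.mul ℝ ℍ[ℝ]).continuous.comp continuous_subtype_val)
  have h0 : ∀ q : S3, (ContinuousLinearMap.mul ℝ ℍ[ℝ] (q : ℍ[ℝ])).det ≠ 0 := by
    intro q h
    have : LinearMap.det (LinearMap.mulLeft ℝ (q : ℍ[ℝ]))
        * LinearMap.det (LinearMap.mulLeft ℝ ((q⁻¹ : S3) : ℍ[ℝ])) = 1 := by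
      rw [← LinearMap.det_comp, ← LinearMap.mulLeft_mul, S3_coe_mul_inv, LinearMap.mulLeft_one,
        LinearMap.det_id]
    have h' : LinearMap.det (LinearMap.mulLeft ℝ (q : ℍ[ℝ])) = 0 := h
    rw [h', zero_mul] at this
    exact zero_ne_one this
  have h1 : (ContinuousLinearMap.mul ℝ ℍ[ℝ] ((1 : S3) : ℍ[ℝ])).det = 1 := by
    change LinearMap.det (LinearMap.mulLeft ℝ ((1 : S3) : ℍ[ℝ])) = 1
    rw [Metric.unitSphere.coe_one, LinearMap.mulLeft_one, LinearMap.det_id]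
  by_contra h
  obtain ⟨x, hx⟩ := mem_range_of_exists_le_of_exists_ge hc ⟨q, not_lt.1 h⟩
    ⟨1, by rw [h1]; exact zero_le_one⟩
  exact h0 x hx

/-- The splitting of a quaternion into its real and imaginary parts. -/
def reImEquiv : (ℝ × R3) ≃ₗ[ℝ] ℍ[ℝ] where
  toFun p := (p.1 : ℍ[ℝ]) + imQuat p.2
  invFun w := (w.re, imCoord w)
  map_add' p q := by simp only [Prod.fst_add, Prod.snd_add, map_add, Quaternion.coe_add]; abel
  map_smul' c p := by
    simp only [Prod.smul_fst, Prod.smul_snd, map_smul, smul_add, RingHom.id_apply, smul_eq_mul,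
      Quaternion.coe_mul, Quaternion.coe_mul_eq_smul]
  left_inv p := by
    refine Prod.ext ?_ ?_
    · simp [imQuat_re]
    · have : imCoord (p.1 : ℍ[ℝ]) = 0 := by ext i; fin_cases i <;> simp [imCoord]
      change imCoord ((p.1 : ℍ[ℝ]) + imQuat p.2) = p.2
      rw [map_add, imCoord_imQuat, this, zero_add]
  right_inv w := by
    have : imQuat (imCoord w) = w - (w.re : ℍ[ℝ]) := by
      have h : imCoord (w - (w.re : ℍ[ℝ])) = imCoord w := by
        ext i; fin_cases i <;> simp [imCoord]
      rw [← h, imQuat_imCoord _ (by simp)]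
    simp only [this, add_sub_cancel]

lemma det_of_map_one_of_map_imQuat {T : ℍ[ℝ] →ₗ[ℝ] ℍ[ℝ]} {A : R3 →ₗ[ℝ] R3} (h1 : T 1 = 1)
    (hA : ∀ v, T (imQuat v) = imQuat (A v)) : LinearMap.det T = LinearMap.det A := by
  have : T = reImEquiv.toLinearMap ∘ₗ (LinearMap.prodMap LinearMap.id A) ∘ₗ
      reImEquiv.symm.toLinearMap := by
    apply LinearMap.ext
    intro w
    obtain ⟨p, rfl⟩ := reImEquiv.surjective w
    simp only [LinearMap.comp_apply, LinearEquiv.coe_coe, LinearEquiv.symm_apply_apply]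
    change T ((p.1 : ℍ[ℝ]) + imQuat p.2) = (p.1 : ℍ[ℝ]) + imQuat (A p.2)
    rw [map_add, hA]
    congr 1
    rw [← mul_one (p.1 : ℍ[ℝ]), Quaternion.coe_mul_eq_smul, map_smul, h1]
  rw [this, LinearMap.det_conj, LinearMap.det_prodMap, LinearMap.det_id, one_mul]

/-- After left translating source and target to the identity, the derivative fixes 1 by Euler's
identity and acts on the imaginary quaternions with determinant `jacobian g x`. The translations
have positive determinant. -/
lemma sign_det_fderiv_rad {g : S3 → S3} (hg : ContMDiff (𝓡 3) (𝓡 3) ∞ g) (x : S3) :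
    SignType.sign (fderiv ℝ (rad g) x).det = SignType.sign (jacobian g x) := by
  have key : LinearMap.det (LinearMap.mulLeft ℝ (((g x)⁻¹ : S3) : ℍ[ℝ]) ∘ₗ
      (fderiv ℝ (rad g) x).toLinearMap ∘ₗ LinearMap.mulLeft ℝ (x : ℍ[ℝ])) = jacobian g x := by
    refine det_of_map_one_of_map_imQuat ?_ ?_
    · simp only [LinearMap.comp_apply, LinearMap.mulLeft_apply, mul_one,
        ContinuousLinearMap.coe_coe]
      rw [fderiv_rad_self hg, S3_coe_inv_mul]
    · intro v
      obtain ⟨w, rfl⟩ := (canonical.fiber x).surjective v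
      simp only [LinearMap.comp_apply, LinearMap.mulLeft_apply, ContinuousLinearMap.coe_coe,
        LinearEquiv.coe_coe, LinearEquiv.symm_apply_apply]
      rw [mul_imQuat_canonical_fiber, fderiv_inclDeriv (hg.mdifferentiable (by simp) x)
        ((isRadial_rad hg).differentiableAt (coe_S3_ne_zero x)) (rad_coe g),
        ← mul_imQuat_canonical_fiber, ← mul_assoc, S3_coe_inv_mul, one_mul]
  rw [← key, LinearMap.det_comp, LinearMap.det_comp, sign_mul, sign_mul,
    sign_pos (det_mulLeft_S3_pos _), sign_pos (det_mulLeft_S3_pos _), one_mul, mul_one]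

lemma det_fderiv_rad_ne_zero_iff {g : S3 → S3} (hg : ContMDiff (𝓡 3) (𝓡 3) ∞ g) (x : S3) :
    (fderiv ℝ (rad g) x).det ≠ 0 ↔ jacobian g x ≠ 0 := by
  rw [← sign_ne_zero, sign_det_fderiv_rad hg, sign_ne_zero]

/-- `y` is a regular value of `g`. -/
def IsRegularValue (g : S3 → S3) (y : S3) : Prop := ∀ x, g x = y → jacobian g x ≠ 0

/-- The number of preimages of `y`, counted with signs. -/
def signedCount (g : S3 → S3) (y : S3) : ℤ :=
  ∑ᶠ x ∈ {x : S3 | g x = y}, (SignType.sign (jacobian g x) : ℤ)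

/-- The extension preserves norms, so only unit vectors can map to a unit vector. -/
lemma setOf_rad_eq (g : S3 → S3) (y : S3) :
    {x : ℍ[ℝ] | rad g x = y} = ((↑) : S3 → ℍ[ℝ]) '' {x | g x = y} := by
  ext x
  constructor
  · intro hx
    have hn : ‖x‖ = 1 := by
      have := congrArg norm (show rad g x = y from hx)
      simpa [rad, norm_smul] using this
    refine ⟨⟨x, mem_sphere_zero_iff_norm.2 hn⟩, ?_, rfl⟩
    apply Subtype.ext
    rw [← rad_coe]
    exact hx
  · rintro ⟨z, hz, rfl⟩
    change rad g z = y
    rw [rad_coe, show g z = y from hz]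

lemma IsRegularValue.det_fderiv_rad_ne_zero {g : S3 → S3} (hg : ContMDiff (𝓡 3) (𝓡 3) ∞ g) {y : S3}
    (hy : IsRegularValue g y) (x : ℍ[ℝ]) (hx : rad g x = y) : (fderiv ℝ (rad g) x).det ≠ 0 := by
  have : x ∈ {x : ℍ[ℝ] | rad g x = y} := hx
  rw [setOf_rad_eq] at this
  obtain ⟨z, hz, rfl⟩ := this
  exact (det_fderiv_rad_ne_zero_iff hg z).2 (hy z hz)

lemma IsRegularValue.finite_fiber {g : S3 → S3} (hg : ContMDiff (𝓡 3) (𝓡 3) ∞ g) {y : S3}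
    (hy : IsRegularValue g y) : {x | g x = y}.Finite := by
  have := (isRadial_rad hg).finite_fiber (coe_S3_ne_zero y) (hy.det_fderiv_rad_ne_zero hg)
  rw [setOf_rad_eq] at this
  exact this.of_finite_image Subtype.val_injective.injOn

lemma finsum_sign_det_fderiv_rad {g : S3 → S3} (hg : ContMDiff (𝓡 3) (𝓡 3) ∞ g) (y : S3) :
    ∑ᶠ x ∈ {x : ℍ[ℝ] | rad g x = y}, (SignType.sign (fderiv ℝ (rad g) x).det : ℤ)
      = signedCount g y := by
  rw [setOf_rad_eq, finsum_mem_image Subtype.val_injective.injOn]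
  simp_rw [sign_det_fderiv_rad hg]
  rfl

lemma norm_rad_sub_lt {g g' : S3 → S3} (h : ∀ x, ‖(g' x : ℍ[ℝ]) - g x‖ < 2) (x : ℍ[ℝ])
    (hx : x ≠ 0) : ‖rad g' x - rad g x‖ < 2 * ‖x‖ := by
  rw [rad, rad, ← smul_sub, norm_smul, norm_norm, mul_comm]
  exact mul_lt_mul_of_pos_right (h _) (norm_pos_iff.2 hx)

/-! ### Homotopy invariance of the signed count. -/

section Homotopy

open MeasureTheory

lemma exists_contMDiff_S3_approx (f : C(S3, S3)) {ε : ℝ} (hε : 0 < ε) :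
    ∃ p : S3 → ℍ[ℝ], ContMDiff (𝓡 3) 𝓘(ℝ, ℍ[ℝ]) ∞ p ∧ ∀ x, ‖p x - f x‖ < ε := by
  obtain ⟨p, hp, -⟩ := Continuous.exists_contMDiff_approx (𝓡 3) ⊤
    (continuous_subtype_val.comp f.continuous) (continuous_const (y := ε)) fun _ => hε
  exact ⟨p, p.contMDiff, fun x => by simpa [dist_eq_norm] using hp x⟩

/-- Radial projection moves `p` by |1 - ‖p‖|, which is at most ‖p - q‖ because ‖q‖ = 1. -/
lemma norm_dir_sub_le (p : ℍ[ℝ]) (q : S3) :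
    ‖(dir p : ℍ[ℝ]) - q‖ ≤ 2 * ‖p - q‖ := by
  have h1 : (dir p : ℍ[ℝ]) - p = (1 - ‖p‖) • (dir p : ℍ[ℝ]) := by
    rw [sub_smul, one_smul, norm_smul_dir]
  have h2 : ‖(dir p : ℍ[ℝ]) - p‖ ≤ ‖p - q‖ := by
    have := abs_norm_sub_norm_le (q : ℍ[ℝ]) p
    rw [h1, norm_smul, norm_coe_S3 (dir p), mul_one, Real.norm_eq_abs]
    rwa [norm_coe_S3, norm_sub_rev] at this
  calc ‖(dir p : ℍ[ℝ]) - q‖ = ‖((dir p : ℍ[ℝ]) - p) + (p - q)‖ := by rw [sub_add_sub_cancel]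
    _ ≤ _ := norm_add_le _ _
    _ ≤ _ := by linarith

/-- An approximation within 1/4 in the quaternions is projected back to the sphere, which at most
doubles the error. -/
lemma exists_smooth_approx (f : C(S3, S3)) :
    ∃ g : C(S3, S3), ContMDiff (𝓡 3) (𝓡 3) ∞ g ∧ ∀ x, ‖(g x : ℍ[ℝ]) - f x‖ < 1 / 2 := by
  obtain ⟨p, hp, hpf⟩ := exists_contMDiff_S3_approx f (ε := 1 / 4) (by norm_num)
  have h0 : ∀ x, p x ≠ 0 := by
    intro x h
    have := hpf x
    rw [h, zero_sub, norm_neg, norm_coe_S3] at this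
    norm_num at this
  have hs := contMDiff_dir_comp hp h0
  exact ⟨⟨_, hs.continuous⟩, hs, fun x => (norm_dir_sub_le (p x) (f x)).trans_lt
    (by linarith [hpf x])⟩

/-- Maps to the sphere that are nowhere antipodal are homotopic. -/
lemma homotopic_of_norm_sub_lt {f g : C(S3, S3)} (h : ∀ x, ‖(f x : ℍ[ℝ]) - g x‖ < 2) :
    f.Homotopic g := by
  have h0 : ∀ p : unitInterval × S3,
      (f p.2 : ℍ[ℝ]) + (p.1 : ℝ) • ((g p.2 : ℍ[ℝ]) - f p.2) ≠ 0 := by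
    rintro ⟨t, x⟩ hz
    simp only at hz
    have e1 : (f x : ℍ[ℝ]) = -((t : ℝ) • ((g x : ℍ[ℝ]) - f x)) := eq_neg_of_add_eq_zero_left hz
    have e2 : (g x : ℍ[ℝ]) = (1 - (t : ℝ)) • ((g x : ℍ[ℝ]) - f x) := by
      rw [sub_smul, one_smul, sub_eq_add_neg, ← e1]
      abel
    have n1 := congrArg norm e1
    have n2 := congrArg norm e2
    rw [norm_neg, norm_smul, Real.norm_eq_abs, abs_of_nonneg t.2.1, norm_coe_S3] at n1
    rw [norm_smul, Real.norm_eq_abs, abs_of_nonneg (sub_nonneg.2 t.2.2), norm_coe_S3] at n2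
    have := h x
    rw [norm_sub_rev] at this
    nlinarith
  refine ⟨{ toFun := fun p => dir ((f p.2 : ℍ[ℝ]) + (p.1 : ℝ) • ((g p.2 : ℍ[ℝ]) - f p.2))
            continuous_toFun := continuous_dir_comp (by fun_prop) h0
            map_zero_left := fun x => ?_
            map_one_left := fun x => ?_ }⟩
  · simp [dir_coe]
  · simp [dir_coe]

/-- Two smooth homotopic maps have the same weighted degree. -/
lemma weightedDegree_rad_eq_of_homotopic {g g' : C(S3, S3)} (hg : ContMDiff (𝓡 3) (𝓡 3) ∞ g)
    (hg' : ContMDiff (𝓡 3) (𝓡 3) ∞ g') (h : g.Homotopic g') {Φ : ℍ[ℝ] → ℍ[ℝ]}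
    (hΦ : ContDiff ℝ ∞ Φ)
    (hsupp : ∀ y, (fderiv ℝ Φ y).det ≠ 0 → 1 / 2 < ‖y‖ ∧ ‖y‖ < 2)
    (μ : Measure ℍ[ℝ]) [μ.IsAddHaarMeasure] :
    weightedDegree μ (fun y => (fderiv ℝ Φ y).det) (rad g)
      = weightedDegree μ (fun y => (fderiv ℝ Φ y).det) (rad g') := by
  obtain ⟨H⟩ := h
  have step : ∀ a b : C(S3, S3), ContMDiff (𝓡 3) (𝓡 3) ∞ a → ContMDiff (𝓡 3) (𝓡 3) ∞ b →
      (∀ x, ‖(b x : ℍ[ℝ]) - a x‖ < 2) → weightedDegree μ (fun y => (fderiv ℝ Φ y).det) (rad a)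
      = weightedDegree μ (fun y => (fderiv ℝ Φ y).det) (rad b) := fun a b ha hb hab =>
    weightedDegree_eq_of_norm_sub_lt μ hΦ hsupp (isRadial_rad ha) (isRadial_rad hb)
      (norm_rad_sub_lt hab)
  -- The slices of the homotopy are only continuous, so each is replaced by a smooth approximation
  -- before taking the weighted degree.
  choose A hA hAf using exists_smooth_approx
  let J : unitInterval → ℝ := fun t => weightedDegree μ (fun y => (fderiv ℝ Φ y).det)
    (rad (A (H.curry t)))
  -- Slices at distance less than 1 have approximations at distance less than 1/2 + 1 + 1/2 = 2, the
  -- bound allowed by `step`.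
  have hJ : IsLocallyConstant J := by
    rw [IsLocallyConstant.iff_eventually_eq]
    intro t
    filter_upwards [H.curry.continuous.continuousAt.preimage_mem_nhds
      (Metric.ball_mem_nhds (H.curry t) one_pos)] with s hs
    refine step _ _ (hA _) (hA _) fun x => ?_
    have h1 := hAf (H.curry t) x
    have h2 := hAf (H.curry s) x
    have h3 : ‖(H.curry s x : ℍ[ℝ]) - H.curry t x‖ < 1 := by
      rw [← dist_eq_norm]
      exact (ContinuousMap.dist_apply_le_dist x).trans_lt hs
    calc _ = ‖((A (H.curry t) x : ℍ[ℝ]) - H.curry t x) - ((H.curry s x : ℍ[ℝ]) - H.curry t x)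
          - ((A (H.curry s) x : ℍ[ℝ]) - H.curry s x)‖ := by congr 1; abel
      _ ≤ _ := norm_sub_le _ _
      _ ≤ _ := add_le_add_left (norm_sub_le _ _) _
      _ < 2 := by linarith
  have h01 : J 0 = J 1 := hJ.apply_eq_of_isPreconnected isPreconnected_univ (mem_univ _)
    (mem_univ _)
  have c0 : H.curry 0 = g := by ext1 x; simp
  have c1 : H.curry 1 = g' := by ext1 x; simp
  have e0 := step _ _ (hA g) hg fun x => by
    rw [norm_sub_rev]; linarith [hAf g x]
  have e1 := step _ _ (hA g') hg' fun x => by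
    rw [norm_sub_rev]; linarith [hAf g' x]
  have h : weightedDegree μ (fun y => (fderiv ℝ Φ y).det) (rad (A (H.curry 0)))
      = weightedDegree μ (fun y => (fderiv ℝ Φ y).det) (rad (A (H.curry 1))) := h01
  rw [c0, c1] at h
  rw [← e0, ← e1, h]

/-- A density supported close enough to `y` computes both counts, each multiplied by the same
positive integral; the weighted degrees agree by homotopy invariance. -/
lemma signedCount_eq_of_homotopic {g g' : C(S3, S3)} (hg : ContMDiff (𝓡 3) (𝓡 3) ∞ g)
    (hg' : ContMDiff (𝓡 3) (𝓡 3) ∞ g') (h : g.Homotopic g') {y : S3} (hy : IsRegularValue g y)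
    (hy' : IsRegularValue g' y) : signedCount g y = signedCount g' y := by
  obtain ⟨V, hV, h1⟩ := (isRadial_rad hg).exists_nhds_weightedDegree_eq Measure.addHaar
    (norm_coe_S3 y) (hy.det_fderiv_rad_ne_zero hg)
  obtain ⟨V', hV', h2⟩ := (isRadial_rad hg').exists_nhds_weightedDegree_eq Measure.addHaar
    (norm_coe_S3 y) (hy'.det_fderiv_rad_ne_zero hg')
  have ho : IsOpen {x : ℍ[ℝ] | 1 / 2 < ‖x‖ ∧ ‖x‖ < 2} :=
    (isOpen_lt continuous_const continuous_norm).inter (isOpen_lt continuous_norm continuous_const)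
  obtain ⟨Φ, hΦ, hpos, hsupp, z, hz⟩ := exists_contDiff_det_fderiv_bump (y : ℍ[ℝ])
    (Filter.inter_mem (Filter.inter_mem hV hV')
      (ho.mem_nhds (by rw [mem_ofPred_eq, norm_coe_S3]; norm_num)))
  have hc : Continuous fun y => (fderiv ℝ Φ y).det :=
    ContinuousLinearMap.continuous_det.comp (hΦ.continuous_fderiv (by simp))
  have hcs : HasCompactSupport fun y => (fderiv ℝ Φ y).det :=
    HasCompactSupport.of_support_subset_isCompact (isCompact_closedBall (0 : ℍ[ℝ]) 2) fun w hw => by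
      rw [mem_closedBall_zero_iff]
      exact (hsupp w hw).2.2.le
  have hI := hc.integral_pos_of_hasCompactSupport_nonneg_nonzero (μ := Measure.addHaar) hcs hpos hz
  have := weightedDegree_rad_eq_of_homotopic hg hg' h hΦ (fun w hw => (hsupp w hw).2)
    Measure.addHaar
  rw [h1 _ hc fun w hw => (hsupp w hw).1.1, h2 _ hc fun w hw => (hsupp w hw).1.2,
    finsum_sign_det_fderiv_rad hg, finsum_sign_det_fderiv_rad hg'] at this
  exact_mod_cast mul_right_cancel₀ hI.ne' this

end Homotopy

end SphericalFraming

end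

noncomputable section

namespace SphericalFraming

/-! ### The degree is well defined -/

/-- The Jacobian determinant as a function of the value and of the derivative. -/
def jacobianOfDeriv (p x : S3) (D : R3 →L[ℝ] R3) : ℝ :=
  LinearMap.det ((canonical.fiber p).toLinearMap ∘ₗ
    (D : TangentSpace (𝓡 3) x →L[ℝ] TangentSpace (𝓡 3) p).toLinearMap ∘ₗ
    (canonical.fiber x).symm.toLinearMap)

lemma jacobian_congr {g h : S3 → S3} {x : S3} (hgh : g =ᶠ[𝓝 x] h) :
    jacobian g x = jacobian h x := by
  -- The type of the derivative depends on the value at `x`; regarding it as an endomorphism of ℝ³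
  -- allows value and derivative to be replaced separately.
  change jacobianOfDeriv (g x) x (mfderiv (𝓡 3) (𝓡 3) g x)
    = jacobianOfDeriv (h x) x (mfderiv (𝓡 3) (𝓡 3) h x)
  have h1 : (mfderiv (𝓡 3) (𝓡 3) g x : R3 →L[ℝ] R3) = mfderiv (𝓡 3) (𝓡 3) h x := hgh.mfderiv_eq
  rw [hgh.eq_of_nhds, h1]

lemma jacobian_comp {h g : S3 → S3} {x : S3} (hh : MDifferentiableAt (𝓡 3) (𝓡 3) h (g x))
    (hg : MDifferentiableAt (𝓡 3) (𝓡 3) g x) :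
    jacobian (h ∘ g) x = jacobian h (g x) * jacobian g x := by
  unfold jacobian
  rw [← LinearMap.det_comp, mfderiv_comp x hh hg]
  congr 1
  ext1 v
  simp

/-- Left multiplication extends to a linear map of the quaternions, and the factor `u` cancels
against the inverse in the left translation. -/
lemma canonical_mfderiv_mul_left (u x : S3) (v : TangentSpace (𝓡 3) x) :
    canonical.fiber (u * x) (mfderiv (𝓡 3) (𝓡 3) (fun z : S3 => u * z) x v)
      = canonical.fiber x v := by
  have hs : ContMDiff (𝓡 3) (𝓡 3) ∞ fun z : S3 => u * z := contMDiff_S3_mul contMDiff_const contMDiff_id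
  have hP : HasFDerivAt (fun z : ℍ[ℝ] => (u : ℍ[ℝ]) * z) (ContinuousLinearMap.mul ℝ ℍ[ℝ] u) x :=
    (ContinuousLinearMap.mul ℝ ℍ[ℝ] (u : ℍ[ℝ])).hasFDerivAt
  have key := fderiv_inclDeriv (P := fun z : ℍ[ℝ] => (u : ℍ[ℝ]) * z)
    (hs.mdifferentiable (by simp) x) hP.differentiableAt (fun z => rfl) v
  rw [canonical_fiber_apply, ← key, hP.fderiv, ContinuousLinearMap.mul_apply', ← mul_assoc,
    ← Metric.unitSphere.coe_mul, mul_inv_rev, inv_mul_cancel_right, canonical_fiber_apply]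

lemma contMDiff_mul_left (u : S3) : ContMDiff (𝓡 3) (𝓡 3) ∞ fun z : S3 => u * z :=
  contMDiff_S3_mul contMDiff_const contMDiff_id

lemma jacobian_mul_left (u x : S3) : jacobian (fun z : S3 => u * z) x = 1 := by
  unfold jacobian
  convert! LinearMap.det_id
  ext1 v
  simp only [LinearMap.comp_apply, LinearEquiv.coe_coe, ContinuousLinearMap.coe_coe,
    LinearMap.id_apply]
  rw [canonical_mfderiv_mul_left, LinearEquiv.apply_symm_apply]

/-- Left translation of a map to the sphere. -/
def leftMul (u : S3) (f : C(S3, S3)) : C(S3, S3) := ⟨fun x => u * f x, by fun_prop⟩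

lemma homotopic_leftMul (u : S3) (f : C(S3, S3)) : f.Homotopic (leftMul u f) := by
  have γ := PathConnectedSpace.somePath (1 : S3) u
  exact ⟨{ toFun := fun p => γ p.1 * f p.2
           continuous_toFun := by fun_prop
           map_zero_left := fun x => by simp
           map_one_left := fun x => by simp [leftMul] }⟩

lemma contMDiff_leftMul {f : C(S3, S3)} (hf : ContMDiff (𝓡 3) (𝓡 3) ∞ f) (u : S3) :
    ContMDiff (𝓡 3) (𝓡 3) ∞ (leftMul u f) := (contMDiff_mul_left u).comp hf

lemma jacobian_leftMul {f : C(S3, S3)} (hf : ContMDiff (𝓡 3) (𝓡 3) ∞ f) (u x : S3) :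
    jacobian (leftMul u f) x = jacobian f x := by
  have := jacobian_comp (x := x) ((contMDiff_mul_left u).mdifferentiable (by simp) (f x))
    (hf.mdifferentiable (by simp) x)
  rw [jacobian_mul_left, one_mul] at this
  exact this

lemma leftMul_eq_iff (u : S3) (f : C(S3, S3)) (x y : S3) :
    leftMul u f x = u * y ↔ f x = y := mul_right_inj u

lemma isRegularValue_leftMul {f : C(S3, S3)} (hf : ContMDiff (𝓡 3) (𝓡 3) ∞ f) (u : S3) {y : S3}
    (hy : IsRegularValue f y) : IsRegularValue (leftMul u f) (u * y) := fun x hx => by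
  rw [jacobian_leftMul hf]
  exact hy x ((leftMul_eq_iff u f x y).1 hx)

lemma signedCount_leftMul {f : C(S3, S3)} (hf : ContMDiff (𝓡 3) (𝓡 3) ∞ f) (u y : S3) :
    signedCount (leftMul u f) (u * y) = signedCount f y := by
  unfold signedCount
  simp_rw [leftMul_eq_iff, jacobian_leftMul hf]

/-- The degree is unique. -/
theorem IsDegree.unique {f : C(S3, S3)} {d d' : ℤ} (h : IsDegree f d) (h' : IsDegree f d') :
    d = d' := by
  obtain ⟨g, hg, hfg, y, hy, rfl⟩ := h
  obtain ⟨g', hg', hfg', y', hy', rfl⟩ := h'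
  -- Left translation moves the regular value of the second map to that of the first, changing
  -- neither its count nor its homotopy class.
  have hy'' := isRegularValue_leftMul hg' (y * y'⁻¹) hy'
  have e := signedCount_leftMul hg' (y * y'⁻¹) y'
  rw [inv_mul_cancel_right] at hy'' e
  exact (signedCount_eq_of_homotopic hg (contMDiff_leftMul hg' _)
    ((hfg.symm.trans hfg').trans (homotopic_leftMul _ g')) hy hy'').trans e

lemma IsDegree.of_homotopic {f f' : C(S3, S3)} {d : ℤ} (h : IsDegree f d) (hf : f'.Homotopic f) :
    IsDegree f' d := by
  obtain ⟨g, hg, hfg, h⟩ := h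
  exact ⟨g, hg, hf.trans hfg, h⟩

open MeasureTheory in
/-- Sard's theorem for self-maps of the sphere. -/
lemma exists_isRegularValue_ne {g : S3 → S3} (hg : ContMDiff (𝓡 3) (𝓡 3) ∞ g) (p : S3) :
    ∃ y, IsRegularValue g y ∧ y ≠ p := by
  set μ : Measure ℍ[ℝ] := Measure.addHaar
  set C : Set ℍ[ℝ] := {x | x ≠ 0 ∧ (fderiv ℝ (rad g) x).det = 0}
  have h1 : μ (rad g '' C) = 0 :=
    addHaar_image_eq_zero_of_det_fderivWithin_eq_zero μ (f' := fderiv ℝ (rad g))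
      (fun x hx => ((isRadial_rad hg).differentiableAt hx.1).hasFDerivAt.hasFDerivWithinAt)
      fun x hx => hx.2
  -- Discarding the null line through `p` as well as the null set of critical values leaves a vector
  -- whose direction is regular and different from `p`.
  have h2 : μ (Submodule.span ℝ {(p : ℍ[ℝ])} : Set ℍ[ℝ]) = 0 := by
    apply Measure.addHaar_submodule
    intro htop
    have := finrank_span_le_card (R := ℝ) {(p : ℍ[ℝ])}
    rw [htop, finrank_top, Quaternion.finrank_eq_four] at this
    simp at this
  have h3 : (rad g '' C ∪ (Submodule.span ℝ {(p : ℍ[ℝ])} : Set ℍ[ℝ])) ≠ univ := by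
    intro h
    have : μ univ = 0 := by rw [← h]; exact measure_union_null h1 h2
    exact (NeZero.ne μ) (Measure.measure_univ_eq_zero.1 this)
  obtain ⟨z, hz⟩ := (ne_univ_iff_exists_notMem _).1 h3
  rw [mem_union, not_or] at hz
  have hz0 : z ≠ 0 := fun h => hz.2 (by rw [h]; exact Submodule.zero_mem _)
  have hn : 0 < ‖z‖ := norm_pos_iff.2 hz0
  refine ⟨dir z, fun x hx hjac => hz.1 ⟨‖z‖ • (x : ℍ[ℝ]), ⟨?_, ?_⟩, ?_⟩, ?_⟩
  · exact smul_ne_zero hn.ne' (coe_S3_ne_zero x)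
  · rw [fderiv_rad_smul hn]
    by_contra h
    exact (det_fderiv_rad_ne_zero_iff hg x).1 h hjac
  · rw [rad_smul g hn, rad_coe, hx, norm_smul_dir]
  · intro h
    apply hz.2
    rw [← norm_smul_dir z, h]
    exact Submodule.smul_mem _ _ (Submodule.mem_span_singleton_self _)

/-- The degree exists. -/
theorem exists_isDegree (f : C(S3, S3)) : ∃ d, IsDegree f d := by
  obtain ⟨g, hg, hgf⟩ := exists_smooth_approx f
  obtain ⟨y, hy, -⟩ := exists_isRegularValue_ne hg 1
  exact ⟨_, g, hg, homotopic_of_norm_sub_lt fun x => by rw [norm_sub_rev]; linarith [hgf x],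
    y, hy, rfl⟩

/-! ### Additivity of the degree -/

/-- A map homotopic to the identity which collapses the hemisphere `re ≥ 0` to `1`. -/
def collapse (x : S3) : S3 :=
  dir (1 + Real.smoothTransition (-2 * (x : ℍ[ℝ]).re) • ((x : ℍ[ℝ]) - 1))

/-- The segment from 1 to `x` meets the origin only when x = -1, and then at its midpoint t = 1/2.
-/
lemma S3_re_eq_neg_one {x : S3} {t : ℝ} (h : (1 : ℍ[ℝ]) + t • ((x : ℍ[ℝ]) - 1) = 0)
    (ht : t ∈ Icc (0 : ℝ) 1) : (x : ℍ[ℝ]).re = -1 ∧ t < 1 := by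
  have e1 : (1 : ℍ[ℝ]) = -(t • ((x : ℍ[ℝ]) - 1)) := eq_neg_of_add_eq_zero_left h
  have e2 : (x : ℍ[ℝ]) = (1 - t) • ((x : ℍ[ℝ]) - 1) := by
    rw [sub_smul, one_smul, sub_eq_add_neg, ← e1]; abel
  have n1 := congrArg norm e1
  have n2 := congrArg norm e2
  rw [norm_neg, norm_smul, Real.norm_eq_abs, abs_of_nonneg ht.1, norm_one] at n1
  rw [norm_smul, Real.norm_eq_abs, abs_of_nonneg (sub_nonneg.2 ht.2), norm_coe_S3] at n2
  have ht2 : t = 1 / 2 := by nlinarith [norm_nonneg ((x : ℍ[ℝ]) - 1)]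
  have r := congrArg (fun w : ℍ[ℝ] => w.re) e1
  rw [ht2] at r
  simp at r
  exact ⟨by linarith, by linarith⟩

lemma collapse_arg_ne_zero (x : S3) :
    (1 : ℍ[ℝ]) + Real.smoothTransition (-2 * (x : ℍ[ℝ]).re) • ((x : ℍ[ℝ]) - 1) ≠ 0 := by
  intro h
  obtain ⟨h1, h2⟩ := S3_re_eq_neg_one h
    ⟨Real.smoothTransition.nonneg _, Real.smoothTransition.le_one _⟩
  rw [h1, Real.smoothTransition.one_of_one_le (by norm_num)] at h2
  exact lt_irrefl _ h2

/-- The real part as a continuous linear form. -/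
def reCLM : ℍ[ℝ] →L[ℝ] ℝ := LinearMap.toContinuousLinearMap
  { toFun := fun w => w.re, map_add' := fun _ _ => rfl, map_smul' := fun _ _ => rfl }

lemma contMDiff_collapse : ContMDiff (𝓡 3) (𝓡 3) ∞ collapse := by
  refine contMDiff_dir_comp ?_ collapse_arg_ne_zero
  have h : ContDiff ℝ ∞ fun w : ℍ[ℝ] =>
      (1 : ℍ[ℝ]) + Real.smoothTransition (-2 * reCLM w) • (w - 1) :=
    contDiff_const.add ((Real.smoothTransition.contDiff.comp
      (contDiff_const.mul reCLM.contDiff)).smul (contDiff_id.sub contDiff_const))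
  exact h.contMDiff.comp contMDiff_coe_sphere

lemma collapse_of_nonneg {x : S3} (hx : 0 ≤ (x : ℍ[ℝ]).re) : collapse x = 1 := by
  rw [collapse, Real.smoothTransition.zero_of_nonpos (by linarith), zero_smul, add_zero]
  exact dir_coe 1

lemma collapse_homotopic_id :
    (⟨collapse, contMDiff_collapse.continuous⟩ : C(S3, S3)).Homotopic (ContinuousMap.id S3) := by
  -- The parameter along the segment from 1 to `x` is raised from its cut-off value to 1. At x = -1
  -- it is 1 throughout, so the midpoint of that segment is avoided.
  let l : unitInterval × S3 → ℝ := fun p =>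
    (1 - (p.1 : ℝ)) * Real.smoothTransition (-2 * (p.2 : ℍ[ℝ]).re) + p.1
  have hl0 : ∀ p, 0 ≤ l p := fun p => add_nonneg (mul_nonneg (sub_nonneg.2 p.1.2.2)
    (Real.smoothTransition.nonneg _)) p.1.2.1
  have hl1 : ∀ p, l p ≤ 1 := fun p => by
    have h1 := Real.smoothTransition.le_one (-2 * (p.2 : ℍ[ℝ]).re)
    have h2 := sub_nonneg.2 p.1.2.2
    simp only [l]
    nlinarith
  have h0 : ∀ p, (1 : ℍ[ℝ]) + l p • ((p.2 : ℍ[ℝ]) - 1) ≠ 0 := by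
    intro p h
    obtain ⟨h1, h2⟩ := S3_re_eq_neg_one h ⟨hl0 p, hl1 p⟩
    simp only [l] at h2
    rw [h1, Real.smoothTransition.one_of_one_le (by norm_num)] at h2
    linarith
  have hc : Continuous l := by
    have : Continuous fun p : unitInterval × S3 => (p.2 : ℍ[ℝ]).re :=
      reCLM.continuous.comp (continuous_subtype_val.comp continuous_snd)
    exact ((continuous_const.sub (continuous_subtype_val.comp continuous_fst)).mul
      (Real.smoothTransition.continuous.comp (continuous_const.mul this))).add
      (continuous_subtype_val.comp continuous_fst)
  refine ⟨{ toFun := fun p => dir (1 + l p • ((p.2 : ℍ[ℝ]) - 1))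
            continuous_toFun := continuous_dir_comp (by fun_prop) h0
            map_zero_left := fun x => ?_
            map_one_left := fun x => ?_ }⟩
  · simp [l, collapse]
  · simp [l, dir_coe]

lemma contMDiff_S3_neg : ContMDiff (𝓡 3) (𝓡 3) ∞ fun x : S3 => -x := contMDiff_neg_sphere

/-- Precomposition with `collapse`, normalised. -/
lemma exists_homotopic_eq_one_of_re_nonneg (f : C(S3, S3)) : ∃ g : C(S3, S3),
    ContMDiff (𝓡 3) (𝓡 3) ∞ g ∧ f.Homotopic g ∧ ∀ x : S3, 0 ≤ (x : ℍ[ℝ]).re → g x = 1 := by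
  obtain ⟨g, hg, hgf⟩ := exists_smooth_approx f
  have hfg : f.Homotopic g := homotopic_of_norm_sub_lt fun x => by
    rw [norm_sub_rev]; linarith [hgf x]
  let r : C(S3, S3) := ⟨collapse, contMDiff_collapse.continuous⟩
  have hr : g.Homotopic (g.comp r) := by
    have := (ContinuousMap.Homotopic.refl g).comp collapse_homotopic_id.symm
    rwa [ContinuousMap.comp_id] at this
  refine ⟨leftMul (g 1)⁻¹ (g.comp r), contMDiff_leftMul (f := g.comp r) (ContMDiff.comp (g := g) hg contMDiff_collapse) _,
    (hfg.trans hr).trans (homotopic_leftMul _ _), fun x hx => ?_⟩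
  simp [leftMul, r, collapse_of_nonneg hx]

/-- The antipodal map exchanges the hemispheres. It is applied before and after the deformation, so
being an involution it drops out. -/
lemma exists_homotopic_eq_one_of_re_nonpos (f : C(S3, S3)) : ∃ g : C(S3, S3),
    ContMDiff (𝓡 3) (𝓡 3) ∞ g ∧ f.Homotopic g ∧ ∀ x : S3, (x : ℍ[ℝ]).re ≤ 0 → g x = 1 := by
  let n : C(S3, S3) := ⟨fun x => -x, contMDiff_S3_neg.continuous⟩
  obtain ⟨g, hg, hfg, h1⟩ := exists_homotopic_eq_one_of_re_nonneg (f.comp n)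
  refine ⟨g.comp n, ContMDiff.comp (g := g) hg contMDiff_S3_neg, ?_, fun x hx => h1 _ ?_⟩
  · have := hfg.comp (ContinuousMap.Homotopic.refl n)
    have e : (f.comp n).comp n = f := by ext1 x; simp [n]
    rwa [e] at this
  · change 0 ≤ (-(x : ℍ[ℝ])).re
    simpa using hx

lemma continuous_S3_re : Continuous fun x : S3 => (x : ℍ[ℝ]).re :=
  reCLM.continuous.comp continuous_subtype_val

/-- The degree of a pointwise product is the sum of the degrees. -/
theorem IsDegree.mul {f f' : C(S3, S3)} {d d' : ℤ} (h : IsDegree f d) (h' : IsDegree f' d') :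
    IsDegree (f * f') (d + d') := by
  obtain ⟨g, hg, hfg, h1⟩ := exists_homotopic_eq_one_of_re_nonneg f
  obtain ⟨g', hg', hfg', h1'⟩ := exists_homotopic_eq_one_of_re_nonpos f'
  obtain ⟨P, hPx⟩ : ∃ P : C(S3, S3), ∀ x, P x = g x * g' x := ⟨g * g', fun _ => rfl⟩
  have hP : ContMDiff (𝓡 3) (𝓡 3) ∞ P := by
    rw [funext hPx]
    exact contMDiff_S3_mul hg hg'
  have hfP : (f * f').Homotopic P := by
    obtain ⟨A⟩ := hfg
    obtain ⟨B⟩ := hfg'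
    exact ⟨{ toFun := fun p => A p * B p
             continuous_toFun := by fun_prop
             map_zero_left := fun x => by simp
             map_one_left := fun x => by simp [hPx] }⟩
  -- Since y ≠ 1, preimages of `y` under `g` have negative real part and those under `g'` positive
  -- real part; near each of them the product coincides with the relevant factor.
  obtain ⟨y, hy, hy1⟩ := exists_isRegularValue_ne hP 1
  have loc : ∀ x, g x = y → P x = y ∧ jacobian P x = jacobian g x := by
    intro x hx
    have hneg : (x : ℍ[ℝ]).re < 0 := by
      by_contra h
      exact hy1 (hx ▸ h1 x (not_lt.1 h))
    have ev : ⇑P =ᶠ[𝓝 x] g := by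
      filter_upwards [(isOpen_lt continuous_S3_re continuous_const).mem_nhds hneg] with z hz
      rw [hPx, h1' z (le_of_lt hz), mul_one]
    exact ⟨ev.eq_of_nhds.trans hx, jacobian_congr ev⟩
  have loc' : ∀ x, g' x = y → P x = y ∧ jacobian P x = jacobian g' x := by
    intro x hx
    have hpos : 0 < (x : ℍ[ℝ]).re := by
      by_contra h
      exact hy1 (hx ▸ h1' x (not_lt.1 h))
    have ev : ⇑P =ᶠ[𝓝 x] g' := by
      filter_upwards [(isOpen_lt continuous_const continuous_S3_re).mem_nhds hpos] with z hz
      rw [hPx, h1 z (le_of_lt hz), one_mul]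
    exact ⟨ev.eq_of_nhds.trans hx, jacobian_congr ev⟩
  have hreg : IsRegularValue g y := fun x hx => (loc x hx).2 ▸ hy x (loc x hx).1
  have hreg' : IsRegularValue g' y := fun x hx => (loc' x hx).2 ▸ hy x (loc' x hx).1
  have hU : {x | P x = y} = {x | g x = y} ∪ {x | g' x = y} := by
    ext x
    refine ⟨fun hx => ?_, fun hx => hx.elim (fun h => (loc x h).1) fun h => (loc' x h).1⟩
    rcases le_total (x : ℍ[ℝ]).re 0 with h | h
    · left
      have : P x = y := hx
      rwa [hPx, h1' x h, mul_one] at this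
    · right
      have : P x = y := hx
      rwa [hPx, h1 x h, one_mul] at this
  have hdisj : Disjoint {x | g x = y} {x | g' x = y} := by
    rw [Set.disjoint_left]
    intro x hx hx'
    rcases le_total (x : ℍ[ℝ]).re 0 with h | h
    · exact hy1 ((show g' x = y from hx') ▸ h1' x h)
    · exact hy1 ((show g x = y from hx) ▸ h1 x h)
  have hcount : signedCount P y = signedCount g y + signedCount g' y := by
    unfold signedCount
    rw [hU, finsum_mem_union hdisj (hreg.finite_fiber hg) (hreg'.finite_fiber hg')]
    congr 1
    · exact finsum_mem_congr rfl fun x hx => by rw [(loc x hx).2]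
    · exact finsum_mem_congr rfl fun x hx => by rw [(loc' x hx).2]
  refine ⟨P, hP, hfP, y, hy, ?_⟩
  change d + d' = signedCount P y
  rw [hcount, h.unique ⟨g, hg, hfg, y, hreg, rfl⟩, h'.unique ⟨g', hg', hfg', y, hreg', rfl⟩]
  rfl

/-! ### Invariant maps -/

/-- `T` splits into free orbits, each contributing |G| times the common value of `s` on it. -/
lemma card_dvd_sum_of_smul_invariant {G X : Type*} [Group G] [Finite G] [MulAction G X]
    (hfree : ∀ (g : G) (x : X), g • x = x → g = 1) (T : Finset X)
    (hT : ∀ (g : G) (x : X), x ∈ T → g • x ∈ T) (s : X → ℤ)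
    (hs : ∀ (g : G) (x : X), x ∈ T → s (g • x) = s x) : (Nat.card G : ℤ) ∣ ∑ x ∈ T, s x := by
  classical
  have := Fintype.ofFinite G
  let π : X → MulAction.orbitRel.Quotient G X := Quotient.mk _
  rw [← Finset.sum_fiberwise_of_maps_to (g := π) (t := T.image π)
    (fun x hx => Finset.mem_image_of_mem π hx)]
  refine Finset.dvd_sum fun o ho => ?_
  obtain ⟨x, hx, rfl⟩ := Finset.mem_image.1 ho
  have e : T.filter (fun z => π z = π x) = Finset.univ.image fun g : G => g • x := by
    ext z
    simp only [Finset.mem_filter, Finset.mem_image, Finset.mem_univ, true_and, π, Quotient.eq]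
    constructor
    · rintro ⟨-, g, hg⟩
      exact ⟨g, hg⟩
    · rintro ⟨g, rfl⟩
      exact ⟨hT g x hx, g, rfl⟩
  rw [e, Finset.sum_image]
  · rw [Finset.sum_congr rfl fun g _ => hs g x hx, Finset.sum_const, Finset.card_univ,
      nsmul_eq_mul, Nat.card_eq_fintype_card]
    exact dvd_mul_right _ _
  · intro a _ b _ hab
    have := hfree (b⁻¹ * a) x (by
      rw [mul_smul, show a • x = b • x from hab, inv_smul_smul])
    exact (inv_mul_eq_one.1 this).symm

/-- The degree of a map that is invariant under a free orientation preserving action is divisible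
by the order of the group. -/
theorem card_dvd_degree_of_invariant {G : Type*} [Group G] [Finite G] [MulAction G S3]
    [FreeSmoothAction G] (hor : ∀ (g : G) (x : S3), 0 < jacobian (fun z => g • z) x)
    (f : C(S3, S3)) (hf : ∀ (g : G) (x : S3), f (g • x) = f x) {d : ℤ} (hd : IsDegree f d) :
    (Nat.card G : ℤ) ∣ d := by
  have := Fintype.ofFinite G
  obtain ⟨p, hp, hpf⟩ := exists_contMDiff_S3_approx f (ε := 1 / 4) (by norm_num)
  have hcard : (0 : ℝ) < Fintype.card G := by exact_mod_cast Fintype.card_pos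
  -- Averaging makes the smooth approximation invariant, and keeps it close to `f` because `f` is
  -- invariant.
  let q : S3 → ℍ[ℝ] := fun x => (Fintype.card G : ℝ)⁻¹ • ∑ g : G, p (g • x)
  have hq : ContMDiff (𝓡 3) 𝓘(ℝ, ℍ[ℝ]) ∞ q := by
    have hs : ContMDiff (𝓡 3) 𝓘(ℝ, ℍ[ℝ]) ∞ fun x : S3 => ∑ g : G, p (g • x) :=
      contMDiff_finsetSum fun g _ => hp.comp (FreeSmoothAction.contMDiff_smul g)
    exact (contDiff_const_smul (𝕜 := ℝ) (Fintype.card G : ℝ)⁻¹).contMDiff.comp hs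
  have hqf : ∀ x, ‖q x - f x‖ ≤ 1 / 4 := by
    intro x
    have e : q x - f x = (Fintype.card G : ℝ)⁻¹ • ∑ g : G, (p (g • x) - f (g • x)) := by
      simp only [q, hf, Finset.sum_sub_distrib, Finset.sum_const, Finset.card_univ, smul_sub]
      rw [← Nat.cast_smul_eq_nsmul ℝ, smul_smul, inv_mul_cancel₀ hcard.ne', one_smul]
    rw [e, norm_smul, norm_inv, Real.norm_eq_abs, abs_of_pos hcard, inv_mul_le_iff₀ hcard]
    refine (norm_sum_le _ _).trans ((Finset.sum_le_sum fun g _ => (hpf (g • x)).le).trans ?_)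
    simp
  have hqinv : ∀ (g : G) (x : S3), q (g • x) = q x := by
    intro g x
    simp only [q]
    congr 1
    exact Fintype.sum_equiv (Equiv.mulRight g) _ _ fun k => by simp [mul_smul]
  have h0 : ∀ x, q x ≠ 0 := by
    intro x h
    have := hqf x
    rw [h, zero_sub, norm_neg, norm_coe_S3] at this
    norm_num at this
  let γ : C(S3, S3) := ⟨fun x => dir (q x), (contMDiff_dir_comp hq h0).continuous⟩
  have hγ : ContMDiff (𝓡 3) (𝓡 3) ∞ γ := contMDiff_dir_comp hq h0
  have hfγ : f.Homotopic γ := homotopic_of_norm_sub_lt fun x => by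
    rw [norm_sub_rev]
    exact (norm_dir_sub_le (q x) (f x)).trans_lt (by linarith [hqf x])
  have hγinv : ∀ (g : G) (x : S3), γ (g • x) = γ x := fun g x => congrArg dir (hqinv g x)
  have hjac : ∀ (g : G) (x : S3), SignType.sign (jacobian γ (g • x))
      = SignType.sign (jacobian γ x) := by
    intro g x
    have h1 := jacobian_comp (h := γ) (g := fun z => g • z) (x := x)
      (hγ.mdifferentiable (by simp) _)
      ((FreeSmoothAction.contMDiff_smul g).mdifferentiable (by simp) x)
    have h2 : ⇑γ ∘ (fun z => g • z) = γ := funext fun z => hγinv g z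
    rw [h2] at h1
    rw [h1, sign_mul, sign_pos (hor g x), mul_one]
  obtain ⟨y, hy, -⟩ := exists_isRegularValue_ne hγ 1
  have hfin := hy.finite_fiber hγ
  rw [hd.unique ⟨γ, hγ, hfγ, y, hy, rfl⟩, finsum_mem_eq_finite_toFinset_sum _ hfin]
  refine card_dvd_sum_of_smul_invariant (G := G) ?_ _ ?_ _ ?_
  · intro g x h
    by_contra hg
    exact FreeSmoothAction.smul_ne_self g hg x h
  · intro g x hx
    rw [Finite.mem_toFinset, mem_ofPred_eq] at hx ⊢
    rw [hγinv, hx]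
  · intro g x _
    rw [hjac]

end SphericalFraming

end

noncomputable section

namespace SphericalFraming

/-! ### The 3-sphere is simply connected -/

instance locallyPathConnectedSpaceS3 : LocallyPathConnectedSpace S3 :=
  ChartedSpace.locallyPathConnectedSpace R3 S3

lemma segment_ne_zero_of_norm_sub_lt {q : S3} {p : ℍ[ℝ]} (h : ‖p - q‖ < 1) {s : ℝ}
    (hs : s ∈ Icc (0 : ℝ) 1) : (q : ℍ[ℝ]) + s • (p - q) ≠ 0 := by
  intro h0
  have e1 : (q : ℍ[ℝ]) = -(s • (p - q)) := eq_neg_of_add_eq_zero_left h0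
  have n1 := congrArg norm e1
  rw [norm_neg, norm_smul, Real.norm_eq_abs, abs_of_nonneg hs.1, norm_coe_S3] at n1
  nlinarith [norm_nonneg (p - q), hs.2]

/-- A loop in the sphere that misses a point is null-homotopic. -/
lemma path_homotopic_refl_of_notMem_range {x v : S3} (δ : Path x x) (hv : ∀ t, δ t ≠ v) :
    δ.Homotopic (Path.refl x) := by
  -- Stereographic projection from `v` carries the loop to a vector space, where it contracts along
  -- straight lines.
  obtain ⟨e, hsrc', htgt⟩ : ∃ e : OpenPartialHomeomorph S3 (ℝ ∙ (v : ℍ[ℝ]))ᗮ,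
      e.source = {v}ᶜ ∧ e.target = univ :=
    ⟨stereographic (norm_coe_S3 v), stereographic_source _, stereographic_target _⟩
  have hsrc : ∀ t, δ t ∈ e.source := fun t => by
    rw [hsrc']
    exact hv t
  have hx : x ∈ e.source := by simpa using hsrc 0
  have hc : Continuous fun t => e (δ t) := e.continuousOn.comp_continuous δ.continuous hsrc
  have hsymm : Continuous e.symm := by
    rw [← continuousOn_univ, ← htgt]
    exact e.continuousOn_symm
  refine ⟨{ toFun := fun p => e.symm (e (δ p.2) + (p.1 : ℝ) • (e x - e (δ p.2)))
            continuous_toFun := hsymm.comp ((hc.comp continuous_snd).add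
              ((continuous_subtype_val.comp continuous_fst).smul
                (continuous_const.sub (hc.comp continuous_snd))))
            map_zero_left := fun t => ?_
            map_one_left := fun t => ?_
            prop' := fun s t ht => ?_ }⟩
  · change e.symm (e (δ t) + ((0 : unitInterval) : ℝ) • (e x - e (δ t))) = δ t
    rw [Icc.coe_zero, zero_smul, add_zero, e.left_inv (hsrc t)]
  · change e.symm (e (δ t) + ((1 : unitInterval) : ℝ) • (e x - e (δ t))) = x
    rw [Icc.coe_one, one_smul, add_sub_cancel, e.left_inv hx]
  · have h : δ t = x := by rcases ht with rfl | rfl <;> simp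
    change e.symm (e (δ t) + (s : ℝ) • (e x - e (δ t))) = δ t
    rw [h, sub_self, smul_zero, add_zero, e.left_inv hx]

/-- Every loop in the sphere is homotopic to one that misses a point. -/
lemma exists_path_homotopic_notMem_range {x : S3} (γ : Path x x) :
    ∃ δ : Path x x, γ.Homotopic δ ∧ ∃ v, ∀ t, δ t ≠ v := by
  obtain ⟨q, hq, hqγ, -⟩ := Continuous.exists_contDiff_approx (E := ℝ) (F := ℍ[ℝ]) 1
    (f := fun t => (γ.extend t : ℍ[ℝ])) (continuous_subtype_val.comp γ.continuous_extend)
    (continuous_const (y := (1 / 4 : ℝ))) fun _ => by norm_num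
  -- The affine correction restores both endpoints to `x`, at a cost of at most another 1/4.
  let p : ℝ → ℍ[ℝ] := fun t => q t + ((1 - t) • ((x : ℍ[ℝ]) - q 0) + t • ((x : ℍ[ℝ]) - q 1))
  have hp : ContDiff ℝ 1 p := hq.add (((contDiff_const.sub contDiff_id).smul contDiff_const).add
    (contDiff_id.smul contDiff_const))
  have h0 : ‖(x : ℍ[ℝ]) - q 0‖ < 1 / 4 := by
    have := hqγ 0
    rwa [γ.extend_zero, dist_eq_norm, norm_sub_rev] at this
  have h1 : ‖(x : ℍ[ℝ]) - q 1‖ < 1 / 4 := by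
    have := hqγ 1
    rwa [γ.extend_one, dist_eq_norm, norm_sub_rev] at this
  have hpγ : ∀ t : unitInterval, ‖p t - γ t‖ < 1 := by
    intro t
    have h2 := hqγ t
    rw [γ.extend_apply t.2, dist_eq_norm] at h2
    have e : p t - γ t = (q t - γ t) +
        ((1 - (t : ℝ)) • ((x : ℍ[ℝ]) - q 0) + (t : ℝ) • ((x : ℍ[ℝ]) - q 1)) := by
      simp only [p]; abel
    rw [e]
    refine (norm_add_le _ _).trans_lt ?_
    have h3 := norm_add_le ((1 - (t : ℝ)) • ((x : ℍ[ℝ]) - q 0)) ((t : ℝ) • ((x : ℍ[ℝ]) - q 1))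
    rw [norm_smul, norm_smul, Real.norm_eq_abs, Real.norm_eq_abs, abs_of_nonneg t.2.1,
      abs_of_nonneg (sub_nonneg.2 t.2.2)] at h3
    have h4 := t.2.1
    have h5 := t.2.2
    have h6 : ‖q t - γ t‖ < 1 / 4 := h2
    nlinarith
  have hp0 : p 0 = x := by simp [p]
  have hp1 : p 1 = x := by simp [p]
  have hne : ∀ z : unitInterval × unitInterval,
      (γ z.2 : ℍ[ℝ]) + (z.1 : ℝ) • (p z.2 - γ z.2) ≠ 0 := fun z =>
    segment_ne_zero_of_norm_sub_lt (hpγ z.2) z.1.2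
  have hpne : ∀ t : unitInterval, p t ≠ 0 := fun t => by simpa using hne (1, t)
  have hpc := hp.continuous
  let δ : Path x x :=
    { toFun := fun t => dir (p t)
      continuous_toFun := continuous_dir_comp (by fun_prop) hpne
      source' := by simp [hp0, dir_coe]
      target' := by simp [hp1, dir_coe] }
  refine ⟨δ, ⟨{ toFun := fun z => dir ((γ z.2 : ℍ[ℝ]) + (z.1 : ℝ) • (p z.2 - γ z.2))
                continuous_toFun := continuous_dir_comp (by fun_prop) hne
                map_zero_left := fun t => by simp [dir_coe]
                map_one_left := fun t => by simp [δ]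
                prop' := fun s t ht => ?_ }⟩, ?_⟩
  · rcases ht with rfl | rfl <;> simp [hp0, hp1, dir_coe]
  -- The cone over a C¹ curve is a C¹ image of ℝ² in ℝ⁴, so some direction is missed.
  · have hd : Dense (range fun z : ℝ × ℝ => z.2 • p z.1)ᶜ :=
      ContDiff.dense_compl_range_of_finrank_lt_finrank
        (contDiff_snd.smul (hp.comp contDiff_fst)) (by
          rw [Quaternion.finrank_eq_four, Module.finrank_prod, Module.finrank_self]
          norm_num)
    obtain ⟨w, hw0, hw⟩ := hd.inter_open_nonempty {0}ᶜ isOpen_compl_singleton ⟨1, one_ne_zero⟩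
    refine ⟨dir w, fun t ht => hw ⟨(t, ‖w‖ * ‖p t‖⁻¹), ?_⟩⟩
    have h : dir (p t) = dir w := ht
    change (‖w‖ * ‖p t‖⁻¹) • p t = w
    rw [mul_smul, ← coe_dir (hpne t), h, norm_smul_dir]

instance simplyConnectedSpaceS3 : SimplyConnectedSpace S3 := by
  rw [simply_connected_iff_loops_nullhomotopic]
  refine ⟨inferInstance, fun x γ => ?_⟩
  obtain ⟨δ, hγδ, v, hv⟩ := exists_path_homotopic_notMem_range γ
  exact hγδ.trans (path_homotopic_refl_of_notMem_range δ hv)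

end SphericalFraming

end

noncomputable section

namespace SphericalFraming

/-! ### The double covering of the space of orthonormal frames -/

instance mulS3 : Mul S3 := inferInstance
instance groupS3 : Group S3 := inferInstance
instance divisionMonoidS3 : DivisionMonoid S3 := inferInstance
instance negS3 : Neg S3 := inferInstance
instance hasDistribNegS3 : HasDistribNeg S3 := inferInstance

/-- The standard basis vectors of `ℝ³`. -/
def basisVec (i : Fin 3) : R3 := EuclideanSpace.single i 1

lemma imQuat_inj {v w : R3} : imQuat v = imQuat w ↔ v = w :=
  ⟨fun h => by rw [← imCoord_imQuat v, h, imCoord_imQuat], fun h => by rw [h]⟩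

lemma norm_imQuat (v : R3) : ‖imQuat v‖ = ‖v‖ := by
  have h : ‖imQuat v‖ ^ 2 = ‖v‖ ^ 2 := by
    rw [EuclideanSpace.norm_sq_eq, Fin.sum_univ_three, pow_two, ← Quaternion.normSq_eq_norm_mul_self,
      Quaternion.normSq_def']
    change (0 : ℝ) ^ 2 + v 0 ^ 2 + v 1 ^ 2 + v 2 ^ 2 = _
    simp
  exact (sq_eq_sq₀ (norm_nonneg _) (norm_nonneg _)).1 h

lemma re_conj (q : S3) (v : R3) : ((q : ℍ[ℝ]) * imQuat v * ((q⁻¹ : S3) : ℍ[ℝ])).re = 0 := by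
  rw [coe_inv_eq_star]
  simp [imQuat_re]
  ring

lemma imQuat_Ad (q : S3) (v : R3) :
    imQuat (Ad q v) = (q : ℍ[ℝ]) * imQuat v * ((q⁻¹ : S3) : ℍ[ℝ]) :=
  imQuat_imCoord _ (re_conj q v)

lemma Ad_eq_iff (q : S3) (v w : R3) :
    Ad q v = w ↔ (q : ℍ[ℝ]) * imQuat v = imQuat w * (q : ℍ[ℝ]) := by
  rw [← imQuat_inj, imQuat_Ad]
  constructor
  · intro h
    rw [← h, mul_assoc, S3_coe_inv_mul, mul_one]
  · intro h
    rw [h, mul_assoc, S3_coe_mul_inv, mul_one]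

lemma Ad_mul (p q : S3) (v : R3) : Ad (p * q) v = Ad p (Ad q v) := by
  rw [← imQuat_inj, imQuat_Ad, imQuat_Ad, imQuat_Ad, mul_inv_rev, Metric.unitSphere.coe_mul,
    Metric.unitSphere.coe_mul]
  simp only [mul_assoc]

lemma Ad_one (v : R3) : Ad 1 v = v := by
  rw [Ad_eq_iff, Metric.unitSphere.coe_one, one_mul, mul_one]

lemma Ad_neg (q : S3) (v : R3) : Ad (-q) v = Ad q v := by
  rw [Ad_eq_iff]
  have := (Ad_eq_iff q v _).1 rfl
  change -(q : ℍ[ℝ]) * imQuat v = _ * -(q : ℍ[ℝ])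
  rw [neg_mul, this, mul_neg]

lemma norm_Ad (q : S3) (v : R3) : ‖Ad q v‖ = ‖v‖ := by
  rw [← norm_imQuat, imQuat_Ad, norm_mul, norm_mul, norm_coe_S3, norm_coe_S3, one_mul, mul_one,
    norm_imQuat]

lemma inner_Ad (q : S3) (v w : R3) : inner ℝ (Ad q v) (Ad q w) = inner ℝ v w :=
  LinearIsometry.inner_map_map (⟨Ad q, norm_Ad q⟩ : R3 →ₗᵢ[ℝ] R3) v w

lemma continuous_Ad : Continuous fun p : S3 × R3 => Ad p.1 p.2 := by
  have h1 : Continuous fun p : S3 × R3 => (p.1 : ℍ[ℝ]) := continuous_subtype_val.comp continuous_fst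
  have h2 : Continuous fun p : S3 × R3 => imQuat p.2 :=
    Continuous.comp (g := fun v => imQuat v) continuous_imQuat continuous_snd
  have h3 : Continuous fun p : S3 × R3 => ((p.1⁻¹ : S3) : ℍ[ℝ]) := by
    have h : (fun p : S3 × R3 => ((p.1⁻¹ : S3) : ℍ[ℝ])) = fun p => star (p.1 : ℍ[ℝ]) :=
      funext fun p => coe_inv_eq_star p.1
    rw [h]
    exact h1.star
  exact continuous_imCoord.comp ((h1.mul h2).mul h3)

lemma continuous_Ad_apply (v : R3) : Continuous fun q : S3 => Ad q v :=
  Continuous.comp (g := fun p : S3 × R3 => Ad p.1 p.2) (f := fun q => (q, v)) continuous_Ad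
    (Continuous.prodMk_left v)

/-- The determinant is continuous and nowhere zero on the connected sphere, and `Ad 1` is the
identity. -/
lemma det_Ad_pos (q : S3) : 0 < LinearMap.det (Ad q) := by
  have hc : Continuous fun q : S3 => (LinearMap.toContinuousLinearMap (Ad q)).det := by
    have h : Continuous fun q : S3 => LinearMap.toContinuousLinearMap (Ad q) := by
      refine continuous_clm_apply.2 fun v => ?_
      have h1 : Continuous fun q : S3 => Ad q v := continuous_Ad_apply v
      exact h1
    exact ContinuousLinearMap.continuous_det.comp h
  have h0 : ∀ q : S3, (LinearMap.toContinuousLinearMap (Ad q)).det ≠ 0 := by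
    intro q h
    have h' : LinearMap.det (Ad q) = 0 := h
    exact (LinearEquiv.isUnit_det' (AdEquiv q)).ne_zero h'
  have h1 : (LinearMap.toContinuousLinearMap (Ad 1)).det = 1 := by
    change LinearMap.det (Ad 1) = 1
    rw [show Ad 1 = LinearMap.id from LinearMap.ext Ad_one, LinearMap.det_id]
  by_contra h
  obtain ⟨x, hx⟩ := mem_range_of_exists_le_of_exists_ge hc ⟨q, not_lt.1 h⟩
    ⟨1, by rw [h1]; exact zero_le_one⟩
  exact h0 x hx

/-- Orthonormal pairs in `ℝ³`. -/
abbrev Frame : Type := {p : R3 × R3 // ‖p.1‖ = 1 ∧ ‖p.2‖ = 1 ∧ inner ℝ p.1 p.2 = 0}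

/-- The frame `(q i q⁻¹, q j q⁻¹)`. -/
def adFrame (q : S3) : Frame :=
  ⟨(Ad q (basisVec 0), Ad q (basisVec 1)), by
    refine ⟨?_, ?_, ?_⟩
    · simp [norm_Ad, basisVec]
    · simp [norm_Ad, basisVec]
    · simp [inner_Ad, basisVec, EuclideanSpace.inner_single_left]⟩

lemma continuous_adFrame : Continuous adFrame :=
  Continuous.subtype_mk ((continuous_Ad_apply _).prodMk (continuous_Ad_apply _)) _

lemma adFrame_neg (q : S3) : adFrame (-q) = adFrame q := by
  apply Subtype.ext
  simp [adFrame, Ad_neg]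

lemma adFrame_mul_eq {p q q' : S3} (h : adFrame q = adFrame q') :
    adFrame (p * q) = adFrame (p * q') := by
  have h1 : Ad q (basisVec 0) = Ad q' (basisVec 0) := congrArg (fun F : Frame => F.1.1) h
  have h2 : Ad q (basisVec 1) = Ad q' (basisVec 1) := congrArg (fun F : Frame => F.1.2) h
  apply Subtype.ext
  simp [adFrame, Ad_mul, h1, h2]

/-- Commuting with i and j kills all imaginary coordinates, leaving a real unit quaternion. -/
lemma eq_one_or_neg_one_of_adFrame {p : S3} (h : adFrame p = adFrame 1) : p = 1 ∨ p = -1 := by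
  have h1 : Ad p (basisVec 0) = basisVec 0 := by
    have : Ad p (basisVec 0) = Ad 1 (basisVec 0) := congrArg (fun F : Frame => F.1.1) h
    rwa [Ad_one] at this
  have h2 : Ad p (basisVec 1) = basisVec 1 := by
    have : Ad p (basisVec 1) = Ad 1 (basisVec 1) := congrArg (fun F : Frame => F.1.2) h
    rwa [Ad_one] at this
  rw [Ad_eq_iff] at h1 h2
  have e (i j : Fin 3) : basisVec i j = if j = i then 1 else 0 := by simp [basisVec]
  have hre (i : Fin 3) : (imQuat (basisVec i)).re = 0 := rfl
  have hI (i : Fin 3) : (imQuat (basisVec i)).imI = if 0 = i then 1 else 0 := e i 0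
  have hJ (i : Fin 3) : (imQuat (basisVec i)).imJ = if 1 = i then 1 else 0 := e i 1
  have hK (i : Fin 3) : (imQuat (basisVec i)).imK = if 2 = i then 1 else 0 := e i 2
  have a1 := congrArg (fun w : ℍ[ℝ] => w.imJ) h1
  have a2 := congrArg (fun w : ℍ[ℝ] => w.imK) h1
  have a3 := congrArg (fun w : ℍ[ℝ] => w.imK) h2
  simp [Quaternion.imJ_mul, Quaternion.imK_mul, hre, hI, hJ, hK] at a1 a2 a3
  have z1 : (p : ℍ[ℝ]).imK = 0 := by linarith
  have z2 : (p : ℍ[ℝ]).imJ = 0 := by linarith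
  have z3 : (p : ℍ[ℝ]).imI = 0 := by linarith
  have hn2 : (p : ℍ[ℝ]).re * (p : ℍ[ℝ]).re = 1 := by
    have := Quaternion.normSq_eq_norm_mul_self (p : ℍ[ℝ])
    rw [norm_coe_S3 p, Quaternion.normSq_def', z1, z2, z3] at this
    linarith
  rcases mul_self_eq_one_iff.1 hn2 with h | h
  · left
    exact Subtype.ext (Quaternion.ext _ _ (by simp [h]) (by simp [z3]) (by simp [z2]) (by simp [z1]))
  · right
    exact Subtype.ext (Quaternion.ext _ _ (by simp [h]) (by simp [z3]) (by simp [z2]) (by simp [z1]))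

lemma adFrame_eq_iff {q q' : S3} : adFrame q = adFrame q' ↔ q = q' ∨ q = -q' := by
  constructor
  · intro h
    have := adFrame_mul_eq (p := q'⁻¹) h
    rw [inv_mul_cancel] at this
    rcases eq_one_or_neg_one_of_adFrame this with h | h
    · left
      exact (inv_mul_eq_one.1 h).symm
    · right
      rw [inv_mul_eq_iff_eq_mul, mul_neg, mul_one] at h
      exact h
  · rintro (rfl | rfl)
    · rfl
    · exact adFrame_neg _

/-- The Clifford relation: it yields both that unit vectors square to -1 and that orthogonal vectors
anticommute. -/
lemma imQuat_mul_add_mul (v w : R3) :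
    imQuat v * imQuat w + imQuat w * imQuat v = ((-2 * inner ℝ v w : ℝ) : ℍ[ℝ]) := by
  have h : inner ℝ v w = v 0 * w 0 + v 1 * w 1 + v 2 * w 2 := by
    rw [PiLp.inner_apply, Fin.sum_univ_three]
    simp [mul_comm]
  rw [h]
  refine Quaternion.ext _ _ ?_ ?_ ?_ ?_
  all_goals
    simp only [Quaternion.re_add, Quaternion.imI_add, Quaternion.imJ_add, Quaternion.imK_add,
      Quaternion.re_mul, Quaternion.imI_mul, Quaternion.imJ_mul, Quaternion.imK_mul,
      Quaternion.re_coe, Quaternion.imI_coe, Quaternion.imJ_coe, Quaternion.imK_coe,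
      show (imQuat v).re = 0 from rfl, show (imQuat v).imI = v 0 from rfl,
      show (imQuat v).imJ = v 1 from rfl, show (imQuat v).imK = v 2 from rfl,
      show (imQuat w).re = 0 from rfl, show (imQuat w).imI = w 0 from rfl,
      show (imQuat w).imJ = w 1 from rfl, show (imQuat w).imK = w 2 from rfl]
    ring

lemma imQuat_mul_self {v : R3} (hv : ‖v‖ = 1) : imQuat v * imQuat v = -1 := by
  have h := imQuat_mul_add_mul v v
  rw [real_inner_self_eq_norm_sq, hv] at h
  have h2 : (2 : ℝ) • (imQuat v * imQuat v) = (2 : ℝ) • (-1 : ℍ[ℝ]) := by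
    rw [two_smul, h]
    refine Quaternion.ext _ _ ?_ ?_ ?_ ?_ <;> simp
  exact smul_right_injective _ (two_ne_zero' ℝ) h2

lemma imQuat_mul_comm_of_inner {v w : R3} (h : inner ℝ v w = 0) :
    imQuat v * imQuat w = -(imQuat w * imQuat v) := by
  have h1 := imQuat_mul_add_mul v w
  rw [h, mul_zero, Quaternion.coe_zero] at h1
  exact eq_neg_of_add_eq_zero_left h1

/-- A rotation taking `u` to `v` and fixing a vector orthogonal to both. -/
lemma exists_Ad_eq {u v w : R3} (hu : ‖u‖ = 1) (hv : ‖v‖ = 1) (hw : ‖w‖ = 1)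
    (hwu : inner ℝ w u = 0) (hwv : inner ℝ w v = 0) :
    ∃ q : S3, Ad q u = v ∧ Ad q w = w := by
  have hU := imQuat_mul_self hu
  have hV := imQuat_mul_self hv
  have hWU := imQuat_mul_comm_of_inner hwu
  have hWV := imQuat_mul_comm_of_inner hwv
  -- The direction of 1 - vu intertwines u with v, since (1 - vu)u = u + v = v(1 - vu). It
  -- degenerates only for v = -u, where the half-turn about `w` serves instead.
  by_cases h : 1 - imQuat v * imQuat u = 0
  · have hvu : imQuat v = -imQuat u := by
      have h1 : imQuat u = imQuat v * imQuat u * imQuat u := by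
        rw [← sub_eq_zero.1 h, one_mul]
      rw [mul_assoc, hU, mul_neg, mul_one] at h1
      rw [h1, neg_neg]
    have hW : ‖imQuat w‖ = 1 := by rw [norm_imQuat, hw]
    refine ⟨⟨imQuat w, by simpa using hW⟩, (Ad_eq_iff _ _ _).2 ?_, (Ad_eq_iff _ _ _).2 rfl⟩
    change imQuat w * imQuat u = imQuat v * imQuat w
    rw [hWU, hvu, neg_mul]
  · have hd := norm_smul_dir (1 - imQuat v * imQuat u)
    have hn : ‖1 - imQuat v * imQuat u‖ ≠ 0 := norm_ne_zero_iff.2 h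
    have key : ∀ a b : R3, (1 - imQuat v * imQuat u) * imQuat a
        = imQuat b * (1 - imQuat v * imQuat u) →
        Ad (dir (1 - imQuat v * imQuat u)) a = b := by
      intro a b hab
      rw [Ad_eq_iff]
      rw [← hd, smul_mul_assoc, mul_smul_comm] at hab
      exact smul_right_injective _ hn hab
    refine ⟨dir (1 - imQuat v * imQuat u), key _ _ ?_, key _ _ ?_⟩
    · rw [sub_mul, mul_sub, mul_assoc, hU, ← mul_assoc, hV]
      simp [add_comm]
    · rw [sub_mul, mul_sub, mul_assoc, ← neg_eq_iff_eq_neg.2 hWU, ← mul_assoc, hWV]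
      simp [mul_assoc]

lemma exists_unit_orthogonal (u v : R3) :
    ∃ w : R3, ‖w‖ = 1 ∧ inner ℝ w u = 0 ∧ inner ℝ w v = 0 := by
  have h : (Submodule.span ℝ ({u, v} : Set R3))ᗮ ≠ ⊥ := by
    intro h
    rw [Submodule.orthogonal_eq_bot_iff] at h
    have h1 := finrank_span_finset_le_card (R := ℝ) ({u, v} : Finset R3)
    rw [Finset.coe_pair, Set.finrank, h, finrank_top, finrank_euclideanSpace_fin] at h1
    have := Finset.card_le_two (a := u) (b := v)
    omega
  obtain ⟨x, hx, hx0⟩ := Submodule.exists_mem_ne_zero_of_ne_bot h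
  have hu : inner ℝ x u = 0 := by
    rw [real_inner_comm]
    exact hx u (Submodule.subset_span (by simp))
  have hv : inner ℝ x v = 0 := by
    rw [real_inner_comm]
    exact hx v (Submodule.subset_span (by simp))
  refine ⟨‖x‖⁻¹ • x, norm_smul_inv_norm hx0, ?_, ?_⟩
  · rw [real_inner_smul_left, hu, mul_zero]
  · rw [real_inner_smul_left, hv, mul_zero]

/-- One rotation carries the first basis vector to `u`; a second, fixing `u`, then carries the image
of the second basis vector to `v`. -/
lemma surjective_adFrame : Function.Surjective adFrame := by
  rintro ⟨⟨u, v⟩, hu, hv, huv⟩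
  simp only at hu hv huv
  obtain ⟨w, hw, hwi, hwu⟩ := exists_unit_orthogonal (basisVec 0) u
  obtain ⟨p, hp, -⟩ := exists_Ad_eq (by simp [basisVec]) hu hw hwi hwu
  have hpv : ‖Ad p (basisVec 1)‖ = 1 := by simp [norm_Ad, basisVec]
  have hpu : inner ℝ u (Ad p (basisVec 1)) = 0 := by
    rw [← hp, inner_Ad]
    simp [basisVec, EuclideanSpace.inner_single_left]
  obtain ⟨q, hq, hq'⟩ := exists_Ad_eq hpv hv hu hpu huv
  refine ⟨q * p, Subtype.ext (Prod.ext ?_ ?_)⟩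
  · change Ad (q * p) (basisVec 0) = u
    rw [Ad_mul, hp, hq']
  · change Ad (q * p) (basisVec 1) = v
    rw [Ad_mul, hq]

/-- By compactness the map is a quotient map, and its fibres are the cosets of the discrete subgroup
{1, -1}. -/
lemma isCoveringMap_adFrame : IsCoveringMap adFrame := by
  have hq : IsQuotientMap adFrame :=
    continuous_adFrame.isClosedMap.isQuotientMap continuous_adFrame surjective_adFrame
  let Z : Subgroup S3 :=
    { carrier := {1, -1}
      mul_mem' := by rintro a b (rfl | rfl) (rfl | rfl) <;> simp
      one_mem' := by simp
      inv_mem' := by rintro a (rfl | rfl) <;> simp }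
  have hZ : IsDiscrete (Z : Set S3) := (show (Z : Set S3).Finite from Set.toFinite {1, -1}).isDiscrete
  refine (hq.isQuotientCoveringMap_of_subgroup Z hZ fun {a b} => ?_).isCoveringMap
  rw [eq_comm, adFrame_eq_iff]
  change _ ↔ b * a⁻¹ = 1 ∨ b * a⁻¹ = -1
  rw [mul_inv_eq_one, mul_inv_eq_iff_eq_mul, neg_mul, one_mul]

/-! ### Gram-Schmidt -/

/-- The component of `A e₁` orthogonal to the unit vector along `A e₀`. -/
def gramSchmidtSnd (A : R3 →ₗ[ℝ] R3) : R3 :=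
  A (basisVec 1) - inner ℝ (‖A (basisVec 0)‖⁻¹ • A (basisVec 0)) (A (basisVec 1)) •
    (‖A (basisVec 0)‖⁻¹ • A (basisVec 0))

lemma apply_basisVec_zero_ne_zero {A : R3 →ₗ[ℝ] R3} (hA : Function.Injective A) :
    A (basisVec 0) ≠ 0 := by
  rw [Ne, map_eq_zero_iff A hA]
  intro h
  have := congrArg (fun v : R3 => v 0) h
  simp [basisVec] at this

lemma gramSchmidtSnd_ne_zero {A : R3 →ₗ[ℝ] R3} (hA : Function.Injective A) :
    gramSchmidtSnd A ≠ 0 := by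
  unfold gramSchmidtSnd
  rw [← map_smul, ← map_smul, ← map_sub, Ne, map_eq_zero_iff A hA]
  intro h
  have := congrArg (fun v : R3 => v 1) h
  simp [basisVec] at this

/-- The orthonormal frame produced by the Gram-Schmidt process from the first two columns of an
injective linear map. -/
def gramSchmidtFrame (A : R3 →ₗ[ℝ] R3) (hA : Function.Injective A) : Frame :=
  ⟨(‖A (basisVec 0)‖⁻¹ • A (basisVec 0), ‖gramSchmidtSnd A‖⁻¹ • gramSchmidtSnd A), by
    have h0 : ‖‖A (basisVec 0)‖⁻¹ • A (basisVec 0)‖ = 1 :=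
      norm_smul_inv_norm (𝕜 := ℝ) (apply_basisVec_zero_ne_zero hA)
    refine ⟨h0, norm_smul_inv_norm (𝕜 := ℝ) (gramSchmidtSnd_ne_zero hA), ?_⟩
    rw [real_inner_smul_right]
    refine mul_eq_zero_of_right _ ?_
    rw [gramSchmidtSnd, inner_sub_right, real_inner_smul_right _ (‖A (basisVec 0)‖⁻¹ • _),
      real_inner_self_eq_norm_sq, h0]
    ring⟩

lemma continuous_gramSchmidtFrame {X : Type*} [TopologicalSpace X] {A : X → R3 →ₗ[ℝ] R3}
    (hA : ∀ x, Function.Injective (A x)) (hc : ∀ v, Continuous fun x => A x v) :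
    Continuous fun x => gramSchmidtFrame (A x) (hA x) := by
  have h0 : Continuous fun x => ‖A x (basisVec 0)‖⁻¹ • A x (basisVec 0) :=
    ((hc _).norm.inv₀ fun x => norm_ne_zero_iff.2 (apply_basisVec_zero_ne_zero (hA x))).smul (hc _)
  have h1 : Continuous fun x => gramSchmidtSnd (A x) :=
    (hc (basisVec 1)).sub (Continuous.fun_smul (h0.inner (hc (basisVec 1))) h0)
  exact Continuous.subtype_mk (h0.prodMk
    ((h1.norm.inv₀ fun x => norm_ne_zero_iff.2 (gramSchmidtSnd_ne_zero (hA x))).smul h1)) _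

lemma gramSchmidtFrame_Ad (q : S3) (hA : Function.Injective (Ad q)) :
    gramSchmidtFrame (Ad q) hA = adFrame q := by
  have h0 : ‖Ad q (basisVec 0)‖⁻¹ • Ad q (basisVec 0) = Ad q (basisVec 0) := by
    simp [norm_Ad, basisVec]
  have h1 : gramSchmidtSnd (Ad q) = Ad q (basisVec 1) := by
    rw [gramSchmidtSnd, h0, inner_Ad]
    simp [basisVec, EuclideanSpace.inner_single_left]
  refine Subtype.ext (Prod.ext h0 ?_)
  change ‖gramSchmidtSnd (Ad q)‖⁻¹ • gramSchmidtSnd (Ad q) = Ad q (basisVec 1)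
  rw [h1]
  simp [norm_Ad, basisVec]

lemma det_of_triangular {T : R3 →ₗ[ℝ] R3} {r s t : ℝ} (h0 : T (basisVec 0) = r • basisVec 0)
    (h1 : T (basisVec 1) = s • basisVec 0 + t • basisVec 1) :
    LinearMap.det T = r * t * T (basisVec 2) 2 := by
  rw [← LinearMap.det_toMatrix (EuclideanSpace.basisFun (Fin 3) ℝ).toBasis, Matrix.det_fin_three]
  have h (i j : Fin 3) : LinearMap.toMatrix (EuclideanSpace.basisFun (Fin 3) ℝ).toBasis
      (EuclideanSpace.basisFun (Fin 3) ℝ).toBasis T i j = T (basisVec j) i := by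
    rw [LinearMap.toMatrix_apply]
    simp [basisVec]
  simp only [h, h0, h1]
  simp [basisVec]

/-- The straight line from an orientation preserving map to the rotation which the Gram-Schmidt
process associates with it runs through orientation preserving maps. -/
lemma det_segment_pos {A : R3 →ₗ[ℝ] R3} (hA : Function.Injective A) (hdet : 0 < LinearMap.det A)
    {q : S3} (hq : adFrame q = gramSchmidtFrame A hA) {t : ℝ} (ht : t ∈ Icc (0 : ℝ) 1) :
    0 < LinearMap.det ((1 - t) • A + t • Ad q) := by
  have hr := norm_pos_iff.2 (apply_basisVec_zero_ne_zero hA)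
  have hs := norm_pos_iff.2 (gramSchmidtSnd_ne_zero hA)
  have q0 : ‖A (basisVec 0)‖⁻¹ • A (basisVec 0) = Ad q (basisVec 0) :=
    (congrArg (fun F : Frame => F.1.1) hq).symm
  have q1 : ‖gramSchmidtSnd A‖⁻¹ • gramSchmidtSnd A = Ad q (basisVec 1) :=
    (congrArg (fun F : Frame => F.1.2) hq).symm
  have hinv (v : R3) : Ad q⁻¹ (Ad q v) = v := by simpa using Ad_Ad_inv q⁻¹ v
  -- Composing with the inverse rotation makes `A` upper triangular. Its first two diagonal entries
  -- are norms, and the third is positive because the determinant is. Convex combinations with the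
  -- identity keep this form.
  have T0 : (Ad q⁻¹ ∘ₗ A) (basisVec 0) = ‖A (basisVec 0)‖ • basisVec 0 := by
    have : A (basisVec 0) = ‖A (basisVec 0)‖ • Ad q (basisVec 0) := by
      rw [← q0, smul_inv_smul₀ hr.ne']
    rw [LinearMap.comp_apply]
    conv_lhs => rw [this]
    rw [map_smul, hinv]
  have T1 : (Ad q⁻¹ ∘ₗ A) (basisVec 1) =
      inner ℝ (‖A (basisVec 0)‖⁻¹ • A (basisVec 0)) (A (basisVec 1)) • basisVec 0 +
      ‖gramSchmidtSnd A‖ • basisVec 1 := by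
    have h1 : gramSchmidtSnd A = ‖gramSchmidtSnd A‖ • Ad q (basisVec 1) := by
      rw [← q1, smul_inv_smul₀ hs.ne']
    have h2 : A (basisVec 1) = inner ℝ (‖A (basisVec 0)‖⁻¹ • A (basisVec 0)) (A (basisVec 1)) •
        Ad q (basisVec 0) + ‖gramSchmidtSnd A‖ • Ad q (basisVec 1) := by
      rw [← h1, ← q0, gramSchmidtSnd]
      abel
    rw [LinearMap.comp_apply]
    conv_lhs => rw [h2]
    rw [map_add, map_smul, map_smul, hinv, hinv]
  have hT : 0 < LinearMap.det (Ad q⁻¹ ∘ₗ A) := by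
    rw [LinearMap.det_comp]
    exact mul_pos (det_Ad_pos _) hdet
  rw [det_of_triangular T0 T1] at hT
  have hz := pos_of_mul_pos_right hT (mul_pos hr hs).le
  have hfac : (1 - t) • A + t • Ad q = Ad q ∘ₗ ((1 - t) • (Ad q⁻¹ ∘ₗ A) + t • LinearMap.id) := by
    ext1 v
    simp [Ad_Ad_inv]
  have pos {a : ℝ} (ha : 0 < a) : 0 < (1 - t) * a + t := by
    rcases ht.1.eq_or_lt with h | h
    · rw [← h]; linarith
    · have := mul_nonneg (sub_nonneg.2 ht.2) ha.le
      linarith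
  have hT' : LinearMap.det ((1 - t) • (Ad q⁻¹ ∘ₗ A) + t • LinearMap.id) =
      ((1 - t) * ‖A (basisVec 0)‖ + t) * ((1 - t) * ‖gramSchmidtSnd A‖ + t) *
        ((1 - t) * (Ad q⁻¹ ∘ₗ A) (basisVec 2) 2 + t) := by
    rw [det_of_triangular (r := (1 - t) * ‖A (basisVec 0)‖ + t)
      (t := (1 - t) * ‖gramSchmidtSnd A‖ + t)
      (s := (1 - t) * inner ℝ (‖A (basisVec 0)‖⁻¹ • A (basisVec 0)) (A (basisVec 1)))]
    · simp [basisVec]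
    · rw [LinearMap.add_apply, LinearMap.smul_apply, T0, LinearMap.smul_apply, LinearMap.id_apply]
      module
    · rw [LinearMap.add_apply, LinearMap.smul_apply, T1, LinearMap.smul_apply, LinearMap.id_apply]
      module
  rw [hfac, LinearMap.det_comp, hT']
  exact mul_pos (det_Ad_pos _) (mul_pos (mul_pos (pos hr) (pos hs)) (pos hz))

end SphericalFraming

end

noncomputable section

namespace SphericalFraming

/-! ### Comparison of trivialisations -/

namespace TangentTrivialisation

section Comparison

variable {N : Type*} [TopologicalSpace N] [ChartedSpace R3 N] [IsManifold (𝓡 3) ∞ N]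

lemma ext_fiber {σ τ : TangentTrivialisation N} (h : ∀ p v, σ.fiber p v = τ.fiber p v) :
    σ = τ := by
  cases σ
  cases τ
  congr 1
  funext p
  exact LinearEquiv.ext (h p)

set_option maxHeartbeats 1000000 in
/-- The inverse of a trivialisation is continuous. -/
lemma continuous_symm (τ : TangentTrivialisation N) :
    Continuous fun z : N × R3 => (⟨z.1, (τ.fiber z.1).symm z.2⟩ : TangentBundle (𝓡 3) N) := by
  rw [continuous_iff_continuousAt]
  rintro ⟨p₀, v₀⟩
  set e := trivializationAt R3 (TangentSpace (𝓡 3) : N → Type _) p₀ with he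
  have hp₀ : p₀ ∈ e.baseSet := FiberBundle.mem_baseSet_trivializationAt' p₀
  have hbase : e.baseSet ∈ 𝓝 p₀ := e.open_baseSet.mem_nhds hp₀
  let A : N → R3 →L[ℝ] R3 := fun p =>
    LinearMap.toContinuousLinearMap ((τ.fiber p).toLinearMap ∘ₗ (e.symmL ℝ p).toLinearMap)
  let B : N → R3 →L[ℝ] R3 := fun p =>
    LinearMap.toContinuousLinearMap ((e.continuousLinearMapAt ℝ p).toLinearMap ∘ₗ
      (τ.fiber p).symm.toLinearMap)
  have hA : ContinuousOn A e.baseSet := by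
    refine continuousOn_clm_apply.2 fun v => ?_
    have h1 : ContinuousOn (fun p : N => (p, v)) e.baseSet := (Continuous.prodMk_left v).continuousOn
    have h2 := e.continuousOn_symm.comp h1 fun p hp => ⟨hp, mem_univ _⟩
    refine (τ.continuous_fiber.comp_continuousOn h2).congr fun p hp => ?_
    change τ.fiber p (e.symmL ℝ p v) = τ.fiber p (e.symm p v)
    rw [Bundle.Trivialization.symmL_apply _ hp]
  have hAB : ∀ p ∈ e.baseSet, A p * B p = 1 := by
    intro p hp
    ext1 v
    change τ.fiber p (e.symmL ℝ p (e.continuousLinearMapAt ℝ p ((τ.fiber p).symm v))) = v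
    rw [Bundle.Trivialization.symmL_continuousLinearMapAt _ hp, LinearEquiv.apply_symm_apply]
  have hBA : ∀ p ∈ e.baseSet, B p * A p = 1 := by
    intro p hp
    ext1 v
    change e.continuousLinearMapAt ℝ p ((τ.fiber p).symm (τ.fiber p (e.symmL ℝ p v))) = v
    rw [LinearEquiv.symm_apply_apply, Bundle.Trivialization.continuousLinearMapAt_symmL _ hp]
  -- In a local trivialisation the fibre maps are units of the Banach algebra of endomorphisms,
  -- where inversion is continuous.
  have hB : ContinuousAt B p₀ := by
    have h := NormedRing.inverse_continuousAt (⟨A p₀, B p₀, hAB p₀ hp₀, hBA p₀ hp₀⟩ : (R3 →L[ℝ] R3)ˣ)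
    refine (ContinuousAt.comp (f := A) h (hA.continuousAt hbase)).congr ?_
    filter_upwards [hbase] with p hp
    exact Ring.inverse_unit (⟨A p, B p, hAB p hp, hBA p hp⟩ : (R3 →L[ℝ] R3)ˣ)
  have hcont : ContinuousAt (fun z : N × R3 => B z.1 z.2) (p₀, v₀) :=
    (ContinuousAt.comp (g := B) (f := Prod.fst) (x := (p₀, v₀)) hB continuousAt_fst).clm_apply
      continuousAt_snd
  have h3 : ContinuousAt (fun z : N × R3 =>
      (⟨z.1, e.symm z.1 (B z.1 z.2)⟩ : TangentBundle (𝓡 3) N)) (p₀, v₀) := by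
    have h4 := e.continuousOn_symm.continuousAt (x := (p₀, B p₀ v₀))
      (prod_mem_nhds hbase Filter.univ_mem)
    exact ContinuousAt.comp (f := fun z : N × R3 => (z.1, B z.1 z.2)) (x := (p₀, v₀)) h4
      (continuousAt_fst.prodMk hcont)
  refine h3.congr ?_
  filter_upwards [prod_mem_nhds hbase Filter.univ_mem] with z hz
  have h5 : e.symm z.1 (B z.1 z.2) = (τ.fiber z.1).symm z.2 := by
    rw [← Bundle.Trivialization.symmL_apply (R := ℝ) e hz.1]
    exact Bundle.Trivialization.symmL_continuousLinearMapAt _ hz.1 _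
  rw [h5]

/-- The linear map comparing two trivialisations at a point. -/
def comparison (σ τ : TangentTrivialisation N) (p : N) : R3 →ₗ[ℝ] R3 :=
  ((τ.fiber p).symm.trans (σ.fiber p) : R3 →ₗ[ℝ] R3)

lemma comparison_apply (σ τ : TangentTrivialisation N) (p : N) (v : R3) :
    comparison σ τ p v = σ.fiber p ((τ.fiber p).symm v) := rfl

lemma comparison_fiber (σ τ : TangentTrivialisation N) (p : N) (v : TangentSpace (𝓡 3) p) :
    comparison σ τ p (τ.fiber p v) = σ.fiber p v := by
  rw [comparison_apply, LinearEquiv.symm_apply_apply]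

lemma comparison_injective (σ τ : TangentTrivialisation N) (p : N) :
    Function.Injective (comparison σ τ p) :=
  ((τ.fiber p).symm.trans (σ.fiber p)).injective

lemma comparison_det_ne_zero (σ τ : TangentTrivialisation N) (p : N) :
    LinearMap.det (comparison σ τ p) ≠ 0 :=
  (LinearEquiv.isUnit_det' ((τ.fiber p).symm.trans (σ.fiber p))).ne_zero

lemma comparison_comp (ρ σ τ : TangentTrivialisation N) (p : N) :
    comparison ρ σ p ∘ₗ comparison σ τ p = comparison ρ τ p :=
  LinearMap.ext fun v => comparison_fiber ρ σ p ((τ.fiber p).symm v)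

lemma SameOrientation.symm {σ τ : TangentTrivialisation N} (h : σ.SameOrientation τ) :
    τ.SameOrientation σ := fun p => by
  have h1 : LinearMap.det (comparison τ σ p) * LinearMap.det (comparison σ τ p) = 1 := by
    rw [← LinearMap.det_comp, comparison_comp]
    have : comparison τ τ p = LinearMap.id :=
      LinearMap.ext fun v => LinearEquiv.apply_symm_apply _ _
    rw [this, LinearMap.det_id]
  exact pos_of_mul_pos_left (h1 ▸ zero_lt_one) (h p).le

lemma SameOrientation.trans {ρ σ τ : TangentTrivialisation N} (h : ρ.SameOrientation σ)
    (h' : σ.SameOrientation τ) : ρ.SameOrientation τ := fun p => by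
  have h1 : LinearMap.det (comparison ρ σ p) * LinearMap.det (comparison σ τ p) =
      LinearMap.det (comparison ρ τ p) := by
    rw [← LinearMap.det_comp, comparison_comp]
  exact h1 ▸ mul_pos (h p) (h' p)

lemma continuous_comparison {X : Type*} [TopologicalSpace X] {H : X → TangentTrivialisation N}
    (hH : Continuous fun z : X × TangentBundle (𝓡 3) N => (H z.1).fiber z.2.1 z.2.2)
    (τ : TangentTrivialisation N) :
    Continuous fun z : (X × N) × R3 => comparison (H z.1.1) τ z.1.2 z.2 :=
  hH.comp (Continuous.prodMk (continuous_fst.comp continuous_fst)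
    (τ.continuous_symm.comp (Continuous.prodMk (continuous_snd.comp continuous_fst) continuous_snd)))

lemma continuous_comparison_const (σ τ : TangentTrivialisation N) :
    Continuous fun z : N × R3 => comparison σ τ z.1 z.2 :=
  σ.continuous_fiber.comp τ.continuous_symm

lemma Homotopic.trans {ρ σ τ : TangentTrivialisation N} (h : ρ.Homotopic σ)
    (h' : σ.Homotopic τ) : ρ.Homotopic τ := by
  obtain ⟨H, h0, h1, hc⟩ := h
  obtain ⟨K, k0, k1, kc⟩ := h'
  refine ⟨fun t => if (t : ℝ) ≤ 1 / 2 then H (Set.projIcc 0 1 zero_le_one (2 * t))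
    else K (Set.projIcc 0 1 zero_le_one (2 * t - 1)), ?_, ?_, ?_⟩
  · simp [h0]
  · norm_num [k1]
  · have e : (fun z : unitInterval × TangentBundle (𝓡 3) N =>
        (if (z.1 : ℝ) ≤ 1 / 2 then H (Set.projIcc 0 1 zero_le_one (2 * z.1))
        else K (Set.projIcc 0 1 zero_le_one (2 * z.1 - 1))).fiber z.2.1 z.2.2) = fun z =>
        if (z.1 : ℝ) ≤ 1 / 2 then (H (Set.projIcc 0 1 zero_le_one (2 * z.1))).fiber z.2.1 z.2.2
        else (K (Set.projIcc 0 1 zero_le_one (2 * z.1 - 1))).fiber z.2.1 z.2.2 := by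
      funext z
      split_ifs <;> rfl
    have ht : Continuous fun z : unitInterval × TangentBundle (𝓡 3) N => (z.1 : ℝ) :=
      continuous_subtype_val.comp continuous_fst
    have e1 : Continuous fun z : unitInterval × TangentBundle (𝓡 3) N =>
        (Set.projIcc (0 : ℝ) 1 zero_le_one (2 * z.1), z.2) :=
      (continuous_projIcc.comp (Continuous.fun_mul continuous_const ht)).prodMk continuous_snd
    have e2 : Continuous fun z : unitInterval × TangentBundle (𝓡 3) N =>
        (Set.projIcc (0 : ℝ) 1 zero_le_one (2 * z.1 - 1), z.2) :=
      (continuous_projIcc.comp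
        (Continuous.fun_sub (Continuous.fun_mul continuous_const ht) continuous_const)).prodMk
        continuous_snd
    rw [e]
    refine Continuous.if_le (hc.comp e1) (kc.comp e2) ht continuous_const ?_
    intro z hz
    rw [hz]
    norm_num [h1, k0]

lemma Homotopic.twist {σ τ : TangentTrivialisation N} (h : σ.Homotopic τ) (f : C(N, S3)) :
    (σ.twist f).Homotopic (τ.twist f) := by
  obtain ⟨H, h0, h1, hc⟩ := h
  refine ⟨fun t => (H t).twist f, congrArg _ h0, congrArg _ h1, ?_⟩
  have hf : Continuous fun z : unitInterval × TangentBundle (𝓡 3) N => f z.2.1 :=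
    f.continuous.comp ((FiberBundle.continuous_proj R3 (TangentSpace (𝓡 3) : N → Type _)).comp
      continuous_snd)
  exact Continuous.comp (g := fun p : S3 × R3 => Ad p.1 p.2)
    (f := fun z : unitInterval × TangentBundle (𝓡 3) N => (f z.2.1, (H z.1).fiber z.2.1 z.2.2))
    continuous_Ad (Continuous.prodMk hf hc)

lemma twist_twist (τ : TangentTrivialisation N) (f g : C(N, S3)) :
    (τ.twist g).twist f = τ.twist (f * g) :=
  ext_fiber fun p v => (Ad_mul (f p) (g p) (τ.fiber p v)).symm

lemma comparison_twist (τ : TangentTrivialisation N) (f : C(N, S3)) (p : N) :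
    comparison (τ.twist f) τ p = Ad (f p) :=
  LinearMap.ext fun v => congrArg (Ad (f p)) ((τ.fiber p).apply_symm_apply v)

end Comparison

end TangentTrivialisation

end SphericalFraming

end

noncomputable section

namespace SphericalFraming

/-! ### Differences of trivialisations as degrees -/

lemma ne_neg_self_S3 (q : S3) : q ≠ -q := by
  intro h
  have h1 : (q : ℍ[ℝ]) = -(q : ℍ[ℝ]) := congrArg Subtype.val h
  rw [eq_neg_iff_add_eq_zero, ← two_smul ℝ] at h1
  exact coe_S3_ne_zero q ((smul_eq_zero.1 h1).resolve_left two_ne_zero)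

/-- Two maps to the sphere that agree up to sign on a connected space agree up to a global sign. -/
lemma eq_or_eq_neg_of_forall {X : Type*} [TopologicalSpace X] [PreconnectedSpace X]
    {f g : X → S3} (hf : Continuous f) (hg : Continuous g) (h : ∀ x, f x = g x ∨ f x = -g x) :
    (∀ x, f x = g x) ∨ ∀ x, f x = -g x := by
  have hc : {x | f x = g x}ᶜ = {x | f x = -g x} := by
    ext x
    change ¬ f x = g x ↔ f x = -g x
    exact ⟨(h x).resolve_left, fun h1 h2 => ne_neg_self_S3 (g x) (h2.symm.trans h1)⟩
  have hcl : IsClopen {x | f x = g x} := by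
    refine ⟨isClosed_eq hf hg, ?_⟩
    rw [← isClosed_compl_iff, hc]
    exact isClosed_eq hf hg.neg
  rcases isClopen_iff.1 hcl with h0 | h0
  · right
    intro x
    have : x ∈ {x | f x = g x}ᶜ := by rw [h0]; exact fun h => h
    rwa [hc] at this
  · left
    intro x
    have : x ∈ {x | f x = g x} := by rw [h0]; exact mem_univ x
    exact this

namespace TangentTrivialisation

/-- The orthonormal frame field comparing two trivialisations. -/
def comparisonFrame {N : Type*} [TopologicalSpace N] [ChartedSpace R3 N] [IsManifold (𝓡 3) ∞ N]
    (σ τ : TangentTrivialisation N) (p : N) : Frame :=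
  gramSchmidtFrame (comparison σ τ p) (comparison_injective σ τ p)

lemma comparisonFrame_twist {N : Type*} [TopologicalSpace N] [ChartedSpace R3 N]
    [IsManifold (𝓡 3) ∞ N] (τ : TangentTrivialisation N) (f : C(N, S3)) (p : N) :
    comparisonFrame (τ.twist f) τ p = adFrame (f p) := by
  have h := comparison_injective (τ.twist f) τ p
  unfold comparisonFrame
  simp only [comparison_twist] at h ⊢
  exact gramSchmidtFrame_Ad _ h

variable {σ τ : TangentTrivialisation S3}

/-- The sphere is simply connected and locally path connected, so the comparison frame lifts through
the double covering. -/
lemma exists_lift_comparisonFrame (σ τ : TangentTrivialisation S3) :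
    ∃ f : C(S3, S3), ∀ x, adFrame (f x) = comparisonFrame σ τ x := by
  have hc : Continuous (comparisonFrame σ τ) :=
    continuous_gramSchmidtFrame (comparison_injective σ τ) fun v =>
      (continuous_comparison_const σ τ).comp (Continuous.prodMk_left v)
  obtain ⟨q, hq⟩ := surjective_adFrame (comparisonFrame σ τ 1)
  obtain ⟨f, ⟨-, hf⟩, -⟩ :=
    isCoveringMap_adFrame.existsUnique_continuousMap_lifts ⟨comparisonFrame σ τ, hc⟩ 1 q hq
  exact ⟨f, congrFun hf⟩

/-- The straight line from the comparison map to `Ad (f x)` stays invertible by `det_segment_pos`,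
hence is a homotopy of trivialisations. -/
lemma homotopic_twist_of_lift (h : σ.SameOrientation τ) {f : C(S3, S3)}
    (hf : ∀ x, adFrame (f x) = comparisonFrame σ τ x) : σ.Homotopic (τ.twist f) := by
  let L : unitInterval → S3 → R3 →ₗ[ℝ] R3 := fun t x =>
    (1 - (t : ℝ)) • comparison σ τ x + (t : ℝ) • Ad (f x)
  have hL : ∀ t x, IsUnit (LinearMap.det (L t x)) := fun t x =>
    (det_segment_pos (comparison_injective σ τ x) (h x) (hf x) t.2).ne'.isUnit
  have hLc : Continuous fun z : (unitInterval × S3) × R3 => L z.1.1 z.1.2 z.2 := by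
    have ht : Continuous fun z : (unitInterval × S3) × R3 => (z.1.1 : ℝ) :=
      continuous_subtype_val.comp (continuous_fst.comp continuous_fst)
    have h1 : Continuous fun z : (unitInterval × S3) × R3 => comparison σ τ z.1.2 z.2 :=
      Continuous.comp (g := fun z : S3 × R3 => comparison σ τ z.1 z.2)
        (f := fun z : (unitInterval × S3) × R3 => (z.1.2, z.2)) (continuous_comparison_const σ τ)
        ((continuous_snd.comp continuous_fst).prodMk continuous_snd)
    have h2 : Continuous fun z : (unitInterval × S3) × R3 => Ad (f z.1.2) z.2 :=
      Continuous.comp (g := fun z : S3 × R3 => Ad z.1 z.2)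
        (f := fun z : (unitInterval × S3) × R3 => (f z.1.2, z.2)) continuous_Ad
        ((f.continuous.comp (continuous_snd.comp continuous_fst)).prodMk continuous_snd)
    exact ((continuous_const.sub ht).smul h1).add (ht.smul h2)
  refine ⟨fun t =>
    { fiber := fun x => (τ.fiber x).trans (LinearMap.equivOfDetNeZero (L t x) (hL t x).ne_zero)
      continuous_fiber := ?_ }, ?_, ?_, ?_⟩
  · have h1 : Continuous fun v : TangentBundle (𝓡 3) S3 => ((t, v.1), τ.fiber v.1 v.2) :=
      ((continuous_const (y := t)).prodMk
        (FiberBundle.continuous_proj R3 (TangentSpace (𝓡 3) : S3 → Type _))).prodMk τ.continuous_fiber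
    exact hLc.comp h1
  · refine ext_fiber fun x v => ?_
    change (1 - ((0 : unitInterval) : ℝ)) • comparison σ τ x (τ.fiber x v) +
      ((0 : unitInterval) : ℝ) • Ad (f x) (τ.fiber x v) = σ.fiber x v
    rw [Icc.coe_zero, sub_zero, one_smul, zero_smul, add_zero, comparison_fiber]
  · refine ext_fiber fun x v => ?_
    change (1 - ((1 : unitInterval) : ℝ)) • comparison σ τ x (τ.fiber x v) +
      ((1 : unitInterval) : ℝ) • Ad (f x) (τ.fiber x v) = Ad (f x) (τ.fiber x v)
    rw [Icc.coe_one, sub_self, one_smul, zero_smul, zero_add]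
  · have h1 : Continuous fun z : unitInterval × TangentBundle (𝓡 3) S3 =>
        ((z.1, z.2.1), τ.fiber z.2.1 z.2.2) :=
      (continuous_fst.prodMk ((FiberBundle.continuous_proj R3
        (TangentSpace (𝓡 3) : S3 → Type _)).comp continuous_snd)).prodMk
        (τ.continuous_fiber.comp continuous_snd)
    exact hLc.comp h1

/-- The map by which `τ` has to be twisted to obtain `σ` is unique up to homotopy. -/
lemma homotopic_of_homotopic_twist {f f' : C(S3, S3)}
    (hf : ∀ x, adFrame (f x) = comparisonFrame σ τ x) (h : σ.Homotopic (τ.twist f')) :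
    f'.Homotopic f := by
  obtain ⟨H, h0, h1, hH⟩ := h
  have hc : Continuous fun z : unitInterval × S3 => comparisonFrame (H z.1) τ z.2 :=
    continuous_gramSchmidtFrame (fun z : unitInterval × S3 => comparison_injective (H z.1) τ z.2)
      fun v => (continuous_comparison hH τ).comp (Continuous.prodMk_left v)
  let C : C(unitInterval × S3, Frame) := ⟨_, hc⟩
  have hC0 : ∀ x, C (0, x) = adFrame (f x) := fun x => by
    rw [hf]
    change comparisonFrame (H 0) τ x = _
    rw [h0]
  -- The frames along the homotopy are lifted starting from `f`. The far end lifts the same frame as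
  -- `f'`, so it is ±f'; a minus sign is removed by a path from 1 to -1 in the sphere.
  let L := isCoveringMap_adFrame.liftHomotopy C f hC0
  have hL : ∀ z, adFrame (L z) = C z := congrFun (isCoveringMap_adFrame.liftHomotopy_lifts C f hC0)
  have hL0 : ∀ x, L (0, x) = f x := isCoveringMap_adFrame.liftHomotopy_zero C f hC0
  let g : C(S3, S3) := L.comp ⟨fun x => (1, x), Continuous.prodMk_right _⟩
  have hg : f.Homotopic g := ⟨⟨L, hL0, fun _ => rfl⟩⟩
  have hgf : ∀ x, g x = f' x ∨ g x = -f' x := fun x => by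
    rw [← adFrame_eq_iff]
    refine (hL (1, x)).trans ?_
    change comparisonFrame (H 1) τ x = _
    rw [h1, comparisonFrame_twist]
  rcases eq_or_eq_neg_of_forall g.continuous f'.continuous hgf with h | h
  · have : g = f' := ContinuousMap.ext h
    rw [← this]
    exact hg.symm
  · have : leftMul (-1) g = f' := ContinuousMap.ext fun x => by
      change -1 * g x = f' x
      rw [h, neg_mul_neg, one_mul]
    rw [← this]
    exact (homotopic_leftMul (-1) g).symm.trans hg.symm

/-- One lift of the comparison frame decides all differences, so existence and uniqueness of
differences reduce to those of the degree. -/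
lemma isDifference_iff (h : σ.SameOrientation τ) {f : C(S3, S3)}
    (hf : ∀ x, adFrame (f x) = comparisonFrame σ τ x) (d : ℤ) :
    IsDifference σ τ d ↔ IsDegree f d := by
  constructor
  · rintro ⟨f', hd, hf'⟩
    exact hd.of_homotopic (homotopic_of_homotopic_twist hf hf').symm
  · intro hd
    exact ⟨f, hd, homotopic_twist_of_lift h hf⟩

lemma exists_isDifference (h : σ.SameOrientation τ) : ∃ d, IsDifference σ τ d := by
  obtain ⟨f, hf⟩ := exists_lift_comparisonFrame σ τ
  obtain ⟨d, hd⟩ := exists_isDegree f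
  exact ⟨d, (isDifference_iff h hf d).2 hd⟩

lemma _root_.SphericalFraming.IsDifference.unique (h : σ.SameOrientation τ) {d d' : ℤ}
    (hd : IsDifference σ τ d) (hd' : IsDifference σ τ d') : d = d' := by
  obtain ⟨f, hf⟩ := exists_lift_comparisonFrame σ τ
  exact ((isDifference_iff h hf d).1 hd).unique ((isDifference_iff h hf d').1 hd')

lemma _root_.SphericalFraming.IsDifference.trans {ρ : TangentTrivialisation S3} {d d' : ℤ}
    (hd : IsDifference ρ σ d) (hd' : IsDifference σ τ d') : IsDifference ρ τ (d + d') := by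
  obtain ⟨f, hf, h⟩ := hd
  obtain ⟨f', hf', h'⟩ := hd'
  refine ⟨f * f', hf.mul hf', h.trans ?_⟩
  rw [← twist_twist]
  exact h'.twist f

end TangentTrivialisation

end SphericalFraming

end

noncomputable section

namespace SphericalFraming

/-! ### Pullbacks to the universal cover -/

section Pullback

open TangentTrivialisation

variable {G : Type*} [Group G] [MulAction G S3]

instance freeSmoothActionSubgroup [FreeSmoothAction G] (K : Subgroup G) :
    FreeSmoothAction K where
  contMDiff_smul g := FreeSmoothAction.contMDiff_smul (g : G)
  smul_ne_self g hg x := FreeSmoothAction.smul_ne_self (g : G) (fun h => hg (Subtype.ext h)) x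

variable [Finite G] [FreeSmoothAction G]

lemma pullbackProj_fiber_apply (τ : TangentTrivialisation (SpaceForm G)) (x : S3)
    (v : TangentSpace (𝓡 3) x) :
    (pullbackProj G τ).fiber x v =
      τ.fiber (proj G x) (mfderiv (𝓡 3) (𝓡 3) (proj G) x v) := rfl

/-- The differential of the projection cancels, so the comparison of pullbacks depends only on the
point of the quotient. -/
lemma comparison_pullbackProj (σ τ : TangentTrivialisation (SpaceForm G)) (x : S3) :
    comparison (pullbackProj G σ) (pullbackProj G τ) x = comparison σ τ (proj G x) := by
  ext1 v
  obtain ⟨w, rfl⟩ := ((pullbackProj G τ).fiber x).surjective v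
  rw [comparison_fiber, pullbackProj_fiber_apply, pullbackProj_fiber_apply, comparison_fiber]

lemma comparisonFrame_pullbackProj (σ τ : TangentTrivialisation (SpaceForm G)) (x : S3) :
    comparisonFrame (pullbackProj G σ) (pullbackProj G τ) x = comparisonFrame σ τ (proj G x) := by
  unfold comparisonFrame
  congr 1
  exact comparison_pullbackProj σ τ x

lemma sameOrientation_pullbackProj_iff {σ τ : TangentTrivialisation (SpaceForm G)} :
    (pullbackProj G σ).SameOrientation (pullbackProj G τ) ↔ σ.SameOrientation τ := by
  constructor
  · intro h m
    obtain ⟨x, rfl⟩ := Quotient.exists_rep m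
    have := h x
    change 0 < LinearMap.det (comparison _ _ _) at this
    rwa [comparison_pullbackProj] at this
  · intro h x
    change 0 < LinearMap.det (comparison _ _ _)
    rw [comparison_pullbackProj]
    exact h _

/-- A pulled back trivialisation is invariant under the deck transformations. -/
lemma pullbackProj_fiber_smul (τ : TangentTrivialisation (SpaceForm G)) (g : G) (x : S3)
    (v : TangentSpace (𝓡 3) x) :
    (pullbackProj G τ).fiber (g • x) (mfderiv (𝓡 3) (𝓡 3) (fun z : S3 => g • z) x v) =
      (pullbackProj G τ).fiber x v := by
  have h1 : tangentMap (𝓡 3) (𝓡 3) (proj G ∘ fun z : S3 => g • z) ⟨x, v⟩ =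
      tangentMap (𝓡 3) (𝓡 3) (proj G) (tangentMap (𝓡 3) (𝓡 3) (fun z : S3 => g • z) ⟨x, v⟩) :=
    tangentMap_comp_at _ ((contMDiff_proj G).mdifferentiable (by simp) _)
      ((FreeSmoothAction.contMDiff_smul g).mdifferentiable (by simp) _)
  have h2 : (proj G ∘ fun z : S3 => g • z) = proj G := funext fun z => proj_smul G g z
  rw [h2] at h1
  exact (congrArg (fun w : TangentBundle (𝓡 3) (SpaceForm G) => τ.fiber w.1 w.2) h1).symm

/-- If the tangent bundle of the quotient can be trivialised, then the action preserves the
orientation. -/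
lemma jacobian_smul_pos (τ : TangentTrivialisation (SpaceForm G)) (g : G) (x : S3) :
    0 < jacobian (fun z => g • z) x := by
  set P := pullbackProj G τ
  have hc : Continuous fun x => (LinearMap.toContinuousLinearMap (comparison canonical P x)).det := by
    have h : Continuous fun x => LinearMap.toContinuousLinearMap (comparison canonical P x) := by
      refine continuous_clm_apply.2 fun v => ?_
      exact Continuous.comp (g := fun z : S3 × R3 => comparison canonical P z.1 z.2)
        (f := fun x : S3 => (x, v)) (continuous_comparison_const canonical P)
        (Continuous.prodMk_left v)
    exact ContinuousLinearMap.continuous_det.comp h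
  have hne : ∀ x, (LinearMap.toContinuousLinearMap (comparison canonical P x)).det ≠ 0 :=
    fun x => comparison_det_ne_zero canonical P x
  -- The orientation of `P` relative to the canonical trivialisation cannot change over the
  -- connected sphere.
  have hsign : 0 < LinearMap.det (comparison canonical P (g • x)) *
      LinearMap.det (comparison canonical P x) := by
    by_contra hneg
    rcases mul_nonpos_iff.1 (not_lt.1 hneg) with ⟨h1, h2⟩ | ⟨h1, h2⟩
    · obtain ⟨y, hy⟩ := mem_range_of_exists_le_of_exists_ge hc ⟨x, h2⟩ ⟨g • x, h1⟩
      exact hne y hy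
    · obtain ⟨y, hy⟩ := mem_range_of_exists_le_of_exists_ge hc ⟨g • x, h1⟩ ⟨x, h2⟩
      exact hne y hy
  have hid : LinearMap.det (comparison canonical P x) * LinearMap.det (comparison P canonical x) =
      1 := by
    rw [← LinearMap.det_comp, comparison_comp]
    have : comparison canonical canonical x = LinearMap.id :=
      LinearMap.ext fun v => (canonical.fiber x).apply_symm_apply v
    rw [this, LinearMap.det_id]
  have hjac : jacobian (fun z => g • z) x =
      LinearMap.det (comparison canonical P (g • x)) * LinearMap.det (comparison P canonical x) := by
    rw [← LinearMap.det_comp, jacobian]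
    congr 1
    ext1 v
    change canonical.fiber (g • x) (mfderiv (𝓡 3) (𝓡 3) (fun z : S3 => g • z) x
      ((canonical.fiber x).symm v)) = comparison canonical P (g • x) (P.fiber x
      ((canonical.fiber x).symm v))
    rw [← pullbackProj_fiber_smul τ g x, comparison_fiber]
  rw [hjac]
  have h0 : LinearMap.det (comparison P canonical x) ≠ 0 := comparison_det_ne_zero _ _ _
  have h3 : LinearMap.det (comparison canonical P (g • x)) * LinearMap.det (comparison P canonical x)
      = LinearMap.det (comparison canonical P (g • x)) * LinearMap.det (comparison canonical P x) *
        LinearMap.det (comparison P canonical x) ^ 2 := by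
    linear_combination -(LinearMap.det (comparison canonical P (g • x)) *
      LinearMap.det (comparison P canonical x)) * hid
  rw [h3]
  exact mul_pos hsign (by positivity)

/-- The difference of two pulled back trivialisations is divisible by the order of the kernel of a
character of order at most two. -/
theorem exists_character_card_ker_dvd {σ τ : TangentTrivialisation (SpaceForm G)}
    (h : σ.SameOrientation τ) {d : ℤ}
    (hd : IsDifference (pullbackProj G σ) (pullbackProj G τ) d) :
    ∃ χ : G →* Multiplicative (ZMod 2), (Nat.card χ.ker : ℤ) ∣ d := by
  classical
  obtain ⟨f, hf⟩ := exists_lift_comparisonFrame (pullbackProj G σ) (pullbackProj G τ)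
  have hdeg := (isDifference_iff (sameOrientation_pullbackProj_iff.2 h) hf d).1 hd
  -- Both x ↦ f(gx) and f lift the same invariant frame field, so they agree up to one global sign;
  -- this sign is the character.
  have hsign (g : G) : (∀ x, f (g • x) = f x) ∨ ∀ x, f (g • x) = -f x := by
    refine eq_or_eq_neg_of_forall (f.continuous.comp (continuous_const_smul g)) f.continuous
      fun x => ?_
    rw [← adFrame_eq_iff, hf, hf, comparisonFrame_pullbackProj,
      comparisonFrame_pullbackProj, proj_smul]
  have hneg {g : G} (hg : ¬ ∀ x, f (g • x) = f x) (x : S3) : f (g • x) = -f x :=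
    (hsign g).resolve_left hg x
  have hne {g : G} (hg : ∀ x, f (g • x) = -f x) : ¬ ∀ x, f (g • x) = f x := fun hg' =>
    ne_neg_self_S3 (f 1) ((hg' 1).symm.trans (hg 1))
  let χ : G →* Multiplicative (ZMod 2) :=
    { toFun := fun g => if ∀ x, f (g • x) = f x then 1 else Multiplicative.ofAdd 1
      map_one' := by simp
      map_mul' := by
        intro g g'
        by_cases hg : ∀ x, f (g • x) = f x <;> by_cases hg' : ∀ x, f (g' • x) = f x
        · have : ∀ x, f ((g * g') • x) = f x := fun x => by rw [mul_smul, hg, hg']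
          rw [if_pos hg, if_pos hg', if_pos this, one_mul]
        · have : ¬ ∀ x, f ((g * g') • x) = f x := hne fun x => by rw [mul_smul, hg, hneg hg']
          rw [if_pos hg, if_neg hg', if_neg this, one_mul]
        · have : ¬ ∀ x, f ((g * g') • x) = f x := hne fun x => by rw [mul_smul, hneg hg, hg']
          rw [if_neg hg, if_pos hg', if_neg this, mul_one]
        · have : ∀ x, f ((g * g') • x) = f x := fun x => by
            rw [mul_smul, hneg hg, hneg hg', neg_neg]
          rw [if_neg hg, if_neg hg', if_pos this]
          rfl }
  refine ⟨χ, card_dvd_degree_of_invariant (G := χ.ker) (fun g x => jacobian_smul_pos τ (g : G) x) f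
    (fun g x => ?_) hdeg⟩
  by_contra hx
  have h1 : χ (g : G) = 1 := g.2
  have h2 : ¬ ∀ x, f ((g : G) • x) = f x := fun h => hx (h x)
  change (if ∀ x, f ((g : G) • x) = f x then (1 : Multiplicative (ZMod 2)) else
    Multiplicative.ofAdd 1) = 1 at h1
  rw [if_neg h2] at h1
  exact absurd h1 (by decide)

/-- The index of the kernel divides 2, so its order is |G| or |G|/2; evenness makes |G| itself a
multiple of |G|/2. -/
lemma card_div_two_dvd_card_ker {G : Type*} [Group G] [Finite G] (hG : Even (Nat.card G))
    (χ : G →* Multiplicative (ZMod 2)) : Nat.card G / 2 ∣ Nat.card χ.ker := by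
  have h1 := χ.ker.card_mul_index
  have h2 : χ.ker.index ∣ 2 := by
    rw [Subgroup.index_ker]
    have := Subgroup.card_subgroup_dvd_card χ.range
    rwa [show Nat.card (Multiplicative (ZMod 2)) = 2 by simp] at this
  obtain ⟨k, hk⟩ := hG
  rcases (Nat.dvd_prime Nat.prime_two).1 h2 with h | h <;> rw [h] at h1
  · exact ⟨2, by omega⟩
  · exact ⟨1, by omega⟩

end Pullback

end SphericalFraming

end

noncomputable section

namespace SphericalFraming

/-! ### First homology and cocycles -/

section Homology

open Simplicial

variable (X : SSet.{0})

/-- The coefficients `ℤ/2`. -/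
abbrev coeffs : ModuleCat.{0} (ZMod 2) := ModuleCat.of (ZMod 2) (ZMod 2)

variable {X}

/-- The linear extension of a cochain. -/
def extendCochain {n : ℕ} {Q : Type} [AddCommGroup Q] [Module (ZMod 2) Q] (φ : X _⦋n⦌ → Q) :
    (X.chainComplex coeffs).X n ⟶ ModuleCat.of (ZMod 2) Q :=
  Limits.Cofan.IsColimit.desc (X.isColimitChainComplexXCofan coeffs n) fun x =>
    ModuleCat.ofHom (LinearMap.toSpanSingleton (ZMod 2) Q (φ x))

lemma ι_extendCochain {n : ℕ} {Q : Type} [AddCommGroup Q] [Module (ZMod 2) Q] (φ : X _⦋n⦌ → Q)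
    (x : X _⦋n⦌) : X.ιChainComplex (R := coeffs) x ≫ extendCochain φ =
      ModuleCat.ofHom (LinearMap.toSpanSingleton (ZMod 2) Q (φ x)) :=
  Limits.Cofan.IsColimit.fac (X.isColimitChainComplexXCofan coeffs n) _ x

lemma d_extendCochain {Q : Type} [AddCommGroup Q] [Module (ZMod 2) Q] {φ : X _⦋1⦌ → Q}
    (hφ : ∀ T : X _⦋2⦌, φ (X.δ 0 T) - φ (X.δ 1 T) + φ (X.δ 2 T) = 0) :
    (X.chainComplex coeffs).d 2 1 ≫ extendCochain φ = 0 := by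
  refine SSet.chainComplex_hom_ext fun T => ?_
  rw [SSet.ιChainComplex_d_assoc, Limits.comp_zero, Fin.sum_univ_three]
  simp only [Preadditive.add_comp, Preadditive.zsmul_comp, ι_extendCochain]
  ext
  simpa [sub_eq_add_neg] using hφ T

lemma exactAt_one_iff : (X.chainComplex coeffs).ExactAt 1 ↔
    ∀ z : (X.chainComplex coeffs).X 1, (X.chainComplex coeffs).d 1 0 z = 0 →
      ∃ w, (X.chainComplex coeffs).d 2 1 w = z := by
  rw [HomologicalComplex.exactAt_iff' _ 2 1 0 (by simp) (by simp), ShortComplex.moduleCat_exact_iff]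
  rfl

/-- A cocycle on a simplicial set with vanishing first homology vanishes on loops. -/
lemma cocycle_loop_eq_zero (hX : (X.chainComplex coeffs).ExactAt 1) {φ : X _⦋1⦌ → ZMod 2}
    (hφ : ∀ T : X _⦋2⦌, φ (X.δ 0 T) - φ (X.δ 1 T) + φ (X.δ 2 T) = 0)
    {s : X _⦋1⦌} (hs : X.δ 0 s = X.δ 1 s) : φ s = 0 := by
  have h1 : X.ιChainComplex (R := coeffs) s ≫ (X.chainComplex coeffs).d 1 0 = 0 := by
    rw [SSet.ιChainComplex_d, Fin.sum_univ_two, hs]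
    simp
  obtain ⟨w, hw⟩ := exactAt_one_iff.1 hX (X.ιChainComplex (R := coeffs) s (1 : ZMod 2))
    (ConcreteCategory.congr_hom h1 (1 : ZMod 2))
  have h2 := ConcreteCategory.congr_hom (ι_extendCochain φ s) (1 : ZMod 2)
  have h3 := ConcreteCategory.congr_hom (d_extendCochain hφ) w
  simp only [ConcreteCategory.comp_apply] at h2 h3
  rw [hw, h2] at h3
  simpa using h3

/-- If every cocycle is a coboundary then the first homology vanishes. -/
lemma exactAt_one_of_cocycle (hX : ∀ (Q : Type) [AddCommGroup Q] [Module (ZMod 2) Q]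
    (φ : X _⦋1⦌ → Q), (∀ T : X _⦋2⦌, φ (X.δ 0 T) - φ (X.δ 1 T) + φ (X.δ 2 T) = 0) →
    ∃ ψ : X _⦋0⦌ → Q, ∀ s : X _⦋1⦌, φ s = ψ (X.δ 0 s) - ψ (X.δ 1 s)) :
    (X.chainComplex coeffs).ExactAt 1 := by
  rw [exactAt_one_iff]
  intro z hz
  let B : Submodule (ZMod 2) ((X.chainComplex coeffs).X 1) :=
    LinearMap.range ((X.chainComplex coeffs).d 2 1).hom
  -- This is the universal cocycle, with values in 1-chains modulo boundaries. Once it is a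
  -- coboundary it vanishes on cycles, so every cycle is a boundary. Hence arbitrary coefficient
  -- modules `Q` are needed.
  let φ : X _⦋1⦌ → ((X.chainComplex coeffs).X 1) ⧸ B := fun s =>
    B.mkQ (X.ιChainComplex (R := coeffs) s (1 : ZMod 2))
  have hφ : extendCochain φ = ModuleCat.ofHom B.mkQ := by
    refine SSet.chainComplex_hom_ext fun s => ?_
    rw [ι_extendCochain]
    ext
    simp [φ]
  have hcoc : ∀ T : X _⦋2⦌, φ (X.δ 0 T) - φ (X.δ 1 T) + φ (X.δ 2 T) = 0 := by
    intro T
    have h1 := ConcreteCategory.congr_hom (SSet.ιChainComplex_d X coeffs T) (1 : ZMod 2)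
    have h2 : B.mkQ ((X.chainComplex coeffs).d 2 1 (X.ιChainComplex (R := coeffs) T (1 : ZMod 2))) = 0 := by
      rw [Submodule.mkQ_apply, Submodule.Quotient.mk_eq_zero]
      exact ⟨_, rfl⟩
    rw [ConcreteCategory.comp_apply] at h1
    rw [h1, Fin.sum_univ_three] at h2
    simpa [φ, sub_eq_add_neg] using h2
  obtain ⟨ψ, hψ⟩ := hX _ φ hcoc
  have h : (X.chainComplex coeffs).d 1 0 ≫ extendCochain ψ = extendCochain φ := by
    refine SSet.chainComplex_hom_ext fun s => ?_
    rw [SSet.ιChainComplex_d_assoc, ι_extendCochain, Fin.sum_univ_two, hψ]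
    simp only [Preadditive.add_comp, Preadditive.zsmul_comp, ι_extendCochain]
    ext
    simp [sub_eq_add_neg]
  have h1 := ConcreteCategory.congr_hom h z
  rw [ConcreteCategory.comp_apply, hz, map_zero, hφ] at h1
  have h2 : z ∈ B := (Submodule.Quotient.mk_eq_zero B).1 h1.symm
  exact h2

lemma firstHomologyModTwoVanishes_iff (Y : Type) [TopologicalSpace Y] :
    FirstHomologyModTwoVanishes Y ↔
      ((TopCat.toSSet.obj (TopCat.of Y)).chainComplex coeffs).ExactAt 1 :=
  (HomologicalComplex.exactAt_iff_isZero_homology _ _).symm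

end Homology

end SphericalFraming

end

noncomputable section

namespace SphericalFraming

/-! ### Singular cocycles in terms of paths -/

section Singular

open Simplicial unitInterval

variable {Y : Type} [TopologicalSpace Y]

/-- The parametrised edge opposite to a vertex of the standard triangle. -/
def edgeParam (i : Fin 3) : C(I, stdSimplex ℝ (Fin 3)) :=
  (⟨stdSimplex.map (S := ℝ) i.succAbove, stdSimplex.continuous_map _⟩ :
    C(stdSimplex ℝ (Fin 2), stdSimplex ℝ (Fin 3))).comp
    ⟨stdSimplexHomeomorphUnitInterval.symm, stdSimplexHomeomorphUnitInterval.symm.continuous⟩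

/-- The edge of a triangle opposite to a vertex, as a path. -/
def edge (T : C(stdSimplex ℝ (Fin 3), Y)) (i : Fin 3) : C(I, Y) := T.comp (edgeParam i)

/-- A function on paths is a cocycle if it is additive along triangles. -/
def IsPathCocycle {Q : Type*} [AddCommGroup Q] (φ : C(I, Y) → Q) : Prop :=
  ∀ T : C(stdSimplex ℝ (Fin 3), Y), φ (edge T 0) - φ (edge T 1) + φ (edge T 2) = 0

/-- Singular 1-simplices are paths. -/
def simplexPathEquiv : (TopCat.toSSet.obj (TopCat.of Y)) _⦋1⦌ ≃ C(I, Y) :=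
  (TopCat.toSSetObjEquiv (TopCat.of Y) _).trans
    (stdSimplexHomeomorphUnitInterval.continuousMapCongr (Homeomorph.refl Y))

/-- Singular 0-simplices are points. -/
def simplexPoint (s : (TopCat.toSSet.obj (TopCat.of Y)) _⦋0⦌) : Y :=
  TopCat.toSSetObjEquiv (TopCat.of Y) _ s (default : stdSimplex ℝ (Fin 1))

lemma exists_simplexPathEquiv_δ (s : (TopCat.toSSet.obj (TopCat.of Y)) _⦋2⦌) :
    ∃ T : C(stdSimplex ℝ (Fin 3), Y), ∀ i : Fin 3,
      simplexPathEquiv ((TopCat.toSSet.obj (TopCat.of Y)).δ i s) = edge T i :=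
  ⟨TopCat.toSSetObjEquiv (TopCat.of Y) _ s, fun _ => rfl⟩

lemma exists_edge_eq (T : C(stdSimplex ℝ (Fin 3), Y)) :
    ∃ s : (TopCat.toSSet.obj (TopCat.of Y)) _⦋2⦌, ∀ i : Fin 3,
      simplexPathEquiv ((TopCat.toSSet.obj (TopCat.of Y)).δ i s) = edge T i :=
  ⟨(TopCat.toSSetObjEquiv (TopCat.of Y) _).symm T, fun _ => rfl⟩

lemma simplexPoint_δ_zero (s : (TopCat.toSSet.obj (TopCat.of Y)) _⦋1⦌) :
    simplexPoint ((TopCat.toSSet.obj (TopCat.of Y)).δ 0 s) = simplexPathEquiv s 1 := by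
  change TopCat.toSSetObjEquiv (TopCat.of Y) _ s (stdSimplex.map (S := ℝ) (Fin.succAbove 0) default) =
    TopCat.toSSetObjEquiv (TopCat.of Y) _ s (stdSimplexHomeomorphUnitInterval.symm 1)
  congr 1
  rw [← stdSimplexHomeomorphUnitInterval_one, Homeomorph.symm_apply_apply,
    Subsingleton.elim (default : stdSimplex ℝ (Fin 1)) (stdSimplex.vertex 0), stdSimplex.map_vertex]
  rfl

lemma simplexPoint_δ_one (s : (TopCat.toSSet.obj (TopCat.of Y)) _⦋1⦌) :
    simplexPoint ((TopCat.toSSet.obj (TopCat.of Y)).δ 1 s) = simplexPathEquiv s 0 := by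
  change TopCat.toSSetObjEquiv (TopCat.of Y) _ s (stdSimplex.map (S := ℝ) (Fin.succAbove 1) default) =
    TopCat.toSSetObjEquiv (TopCat.of Y) _ s (stdSimplexHomeomorphUnitInterval.symm 0)
  congr 1
  rw [← stdSimplexHomeomorphUnitInterval_zero, Homeomorph.symm_apply_apply,
    Subsingleton.elim (default : stdSimplex ℝ (Fin 1)) (stdSimplex.vertex 0), stdSimplex.map_vertex]
  rfl

lemma simplexPoint_injective : Function.Injective (simplexPoint (Y := Y)) := by
  intro s t h
  apply (TopCat.toSSetObjEquiv (TopCat.of Y) _).injective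
  refine ContinuousMap.ext fun x => ?_
  have : x = (default : stdSimplex ℝ (Fin 1)) := Subsingleton.elim (α := stdSimplex ℝ (Fin 1)) _ _
  rw [this]
  exact h

theorem pathCocycle_loop_eq_zero (hY : FirstHomologyModTwoVanishes Y) {φ : C(I, Y) → ZMod 2}
    (hφ : IsPathCocycle φ) {p : C(I, Y)} (hp : p 0 = p 1) : φ p = 0 := by
  obtain ⟨s, rfl⟩ := simplexPathEquiv.surjective p
  refine cocycle_loop_eq_zero ((firstHomologyModTwoVanishes_iff Y).1 hY)
    (φ := fun s => φ (simplexPathEquiv s)) (fun T => ?_) (simplexPoint_injective ?_)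
  · obtain ⟨T', hT'⟩ := exists_simplexPathEquiv_δ T
    have := hφ T'
    rwa [← hT', ← hT', ← hT'] at this
  · rw [simplexPoint_δ_zero, simplexPoint_δ_one, hp]

theorem firstHomologyModTwoVanishes_of_pathCocycle
    (hY : ∀ (Q : Type) [AddCommGroup Q] [Module (ZMod 2) Q] (φ : C(I, Y) → Q), IsPathCocycle φ →
      ∃ ψ : Y → Q, ∀ p : C(I, Y), φ p = ψ (p 1) - ψ (p 0)) : FirstHomologyModTwoVanishes Y := by
  refine (firstHomologyModTwoVanishes_iff Y).2 (exactAt_one_of_cocycle fun Q _ _ φ hφ => ?_)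
  obtain ⟨ψ, hψ⟩ := hY Q (fun p => φ (simplexPathEquiv.symm p)) fun T => by
    obtain ⟨s, hs⟩ := exists_edge_eq T
    have := hφ s
    rw [← hs, ← hs, ← hs]
    simpa only [Equiv.symm_apply_apply] using this
  refine ⟨fun x => ψ (simplexPoint x), fun s => ?_⟩
  dsimp only
  rw [simplexPoint_δ_zero, simplexPoint_δ_one, ← hψ, Equiv.symm_apply_apply]

/-! ### Path cocycles and homotopy -/

lemma edgeParam_apply (i : Fin 3) (t : I) :
    (edgeParam i t : Fin 3 → ℝ) =
      FunOnFinite.linearMap ℝ ℝ i.succAbove (![1 - (t : ℝ), t] : Fin 2 → ℝ) := by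
  change FunOnFinite.linearMap ℝ ℝ i.succAbove _ = _
  congr 1

lemma edgeParam_zero (t : I) :
    edgeParam 0 t 0 = 0 ∧ edgeParam 0 t 1 = 1 - t ∧ edgeParam 0 t 2 = t := by
  rw [edgeParam_apply]
  simp [FunOnFinite.linearMap_apply_apply, Finset.sum_filter, Fin.sum_univ_two]

lemma edgeParam_one (t : I) :
    edgeParam 1 t 0 = 1 - t ∧ edgeParam 1 t 1 = 0 ∧ edgeParam 1 t 2 = t := by
  rw [edgeParam_apply]
  simp [FunOnFinite.linearMap_apply_apply, Finset.sum_filter, Fin.succAbove]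

lemma edgeParam_two (t : I) :
    edgeParam 2 t 0 = 1 - t ∧ edgeParam 2 t 1 = t ∧ edgeParam 2 t 2 = 0 := by
  have h : (2 : Fin 3).succAbove = (![0, 1] : Fin 2 → Fin 3) := by decide
  rw [edgeParam_apply, h]
  simp [FunOnFinite.linearMap_apply_apply, Finset.sum_filter]

lemma stdSimplex_sum_three (x : stdSimplex ℝ (Fin 3)) : x 0 + x 1 + x 2 = 1 := by
  have := stdSimplex.sum_eq_one x
  rwa [Fin.sum_univ_three] at this

lemma continuous_stdSimplex_apply (i : Fin 3) : Continuous fun x : stdSimplex ℝ (Fin 3) => x i :=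
  (continuous_apply i).comp continuous_subtype_val

/-- The affine function on the triangle with values `0, c, 1` at the vertices. -/
def affineCoord (c : I) : C(stdSimplex ℝ (Fin 3), I) where
  toFun x := ⟨c * x 1 + x 2, by
    have h := stdSimplex_sum_three x
    have h0 := stdSimplex.zero_le x 0
    have h1 := stdSimplex.zero_le x 1
    have h2 := stdSimplex.zero_le x 2
    have h3 := mul_nonneg c.2.1 h1
    have h4 := mul_le_of_le_one_left h1 c.2.2
    exact ⟨by linarith, by linarith⟩⟩
  continuous_toFun := Continuous.subtype_mk ((continuous_const.mul (continuous_stdSimplex_apply 1)).add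
    (continuous_stdSimplex_apply 2)) _

lemma affineCoord_edgeParam_zero (c t : I) :
    (affineCoord c (edgeParam 0 t) : ℝ) = c * (1 - t) + t := by
  obtain ⟨-, h1, h2⟩ := edgeParam_zero t
  change (c : ℝ) * edgeParam 0 t 1 + edgeParam 0 t 2 = _
  rw [h1, h2]

lemma affineCoord_edgeParam_one (c t : I) : affineCoord c (edgeParam 1 t) = t := by
  obtain ⟨-, h1, h2⟩ := edgeParam_one t
  refine Subtype.ext ?_
  change (c : ℝ) * edgeParam 1 t 1 + edgeParam 1 t 2 = _
  rw [h1, h2, mul_zero, zero_add]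

lemma affineCoord_edgeParam_two (c t : I) : (affineCoord c (edgeParam 2 t) : ℝ) = c * t := by
  obtain ⟨-, h1, h2⟩ := edgeParam_two t
  change (c : ℝ) * edgeParam 2 t 1 + edgeParam 2 t 2 = _
  rw [h1, h2, add_zero]

variable {Q : Type*} [AddCommGroup Q] {φ : C(I, Y) → Q}

/-- All edges of a constant triangle are the same path, so the cocycle identity reads φ - φ + φ = 0.
-/
lemma IsPathCocycle.const (hφ : IsPathCocycle φ) (y : Y) : φ (ContinuousMap.const I y) = 0 := by
  have h := hφ (ContinuousMap.const _ y)
  simpa [edge] using h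

/-- A path cocycle is additive around the boundary of a square. -/
lemma IsPathCocycle.square (hφ : IsPathCocycle φ) (F : C(I × I, Y)) {a b c d : C(I, Y)}
    (ha : ∀ t, F (t, 0) = a t) (hb : ∀ t, F (1, t) = b t) (hc : ∀ t, F (0, t) = c t)
    (hd : ∀ t, F (t, 1) = d t) : φ a + φ b = φ c + φ d := by
  have e0 (c t : I) (hc : c = 0) : affineCoord c (edgeParam 0 t) = t := Subtype.ext <| by
    rw [affineCoord_edgeParam_zero, hc, Icc.coe_zero, zero_mul, zero_add]
  have e1 (c t : I) (hc : c = 1) : affineCoord c (edgeParam 0 t) = 1 := Subtype.ext <| by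
    rw [affineCoord_edgeParam_zero, hc, Icc.coe_one, one_mul, sub_add_cancel]
  have f0 (c t : I) (hc : c = 0) : affineCoord c (edgeParam 2 t) = 0 := Subtype.ext <| by
    rw [affineCoord_edgeParam_two, hc, Icc.coe_zero, zero_mul]
  have f1 (c t : I) (hc : c = 1) : affineCoord c (edgeParam 2 t) = t := Subtype.ext <| by
    rw [affineCoord_edgeParam_two, hc, Icc.coe_one, one_mul]
  -- The square is cut along its diagonal into triangles with vertices (0,0), (1,0), (1,1) and
  -- (0,0), (0,1), (1,1); the diagonal terms cancel.
  have h1 := hφ (F.comp ((affineCoord 1).prodMk (affineCoord 0)))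
  have h2 := hφ (F.comp ((affineCoord 0).prodMk (affineCoord 1)))
  rw [show edge (F.comp ((affineCoord 1).prodMk (affineCoord 0))) 0 = b from
      ContinuousMap.ext fun t => (congrArg F (Prod.ext (e1 1 t rfl) (e0 0 t rfl))).trans (hb t),
    show edge (F.comp ((affineCoord 1).prodMk (affineCoord 0))) 2 = a from
      ContinuousMap.ext fun t => (congrArg F (Prod.ext (f1 1 t rfl) (f0 0 t rfl))).trans (ha t)]
    at h1
  rw [show edge (F.comp ((affineCoord 0).prodMk (affineCoord 1))) 0 = d from
      ContinuousMap.ext fun t => (congrArg F (Prod.ext (e0 0 t rfl) (e1 1 t rfl))).trans (hd t),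
    show edge (F.comp ((affineCoord 0).prodMk (affineCoord 1))) 2 = c from
      ContinuousMap.ext fun t => (congrArg F (Prod.ext (f0 0 t rfl) (f1 1 t rfl))).trans (hc t),
    show edge (F.comp ((affineCoord 0).prodMk (affineCoord 1))) 1 =
      edge (F.comp ((affineCoord 1).prodMk (affineCoord 0))) 1 from ContinuousMap.ext fun t =>
        congrArg F (Prod.ext ((affineCoord_edgeParam_one 0 t).trans
          (affineCoord_edgeParam_one 1 t).symm) ((affineCoord_edgeParam_one 1 t).trans
          (affineCoord_edgeParam_one 0 t).symm))] at h2
  have h3 : φ a + φ b - (φ c + φ d) = 0 := by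
    rw [← sub_self (0 : Q)]
    nth_rewrite 1 [← h1]
    rw [← h2]
    abel
  exact sub_eq_zero.1 h3

/-- The homotopy is a square with two constant sides, which contribute nothing. -/
lemma IsPathCocycle.eq_of_homotopic (hφ : IsPathCocycle φ) {a b : Y} {p q : Path a b}
    (h : p.Homotopic q) : φ p = φ q := by
  obtain ⟨H⟩ := h
  have := hφ.square (H : C(I × I, Y)) (a := .const I a) (b := q) (c := p) (d := .const I b)
    (fun t => by simp) (fun t => by simp)
    (fun t => by simp) (fun t => by simp)
  rw [hφ.const, hφ.const, zero_add, add_zero] at this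
  exact this.symm

lemma IsPathCocycle.trans (hφ : IsPathCocycle φ) {a b c : Y} (p : Path a b) (q : Path b c) :
    φ (p.trans q) = φ p + φ q := by
  have hhalf : (1 / 2 : ℝ) ∈ I := by norm_num [unitInterval]
  -- The vertices take the values 0, 1/2, 1, so the edges are `p`, `q` and the concatenation.
  have h := hφ ((p.trans q : C(I, Y)).comp (affineCoord ⟨1 / 2, hhalf⟩))
  rw [show edge ((p.trans q : C(I, Y)).comp (affineCoord ⟨1 / 2, hhalf⟩)) 0 = q from ?_,
    show edge ((p.trans q : C(I, Y)).comp (affineCoord ⟨1 / 2, hhalf⟩)) 1 = p.trans q from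
      ContinuousMap.ext fun t => congrArg (p.trans q) (affineCoord_edgeParam_one _ t),
    show edge ((p.trans q : C(I, Y)).comp (affineCoord ⟨1 / 2, hhalf⟩)) 2 = p from ?_] at h
  · rw [← sub_eq_zero, ← neg_eq_zero, ← h]
    abel
  · refine ContinuousMap.ext fun t => ?_
    change (p.trans q) (affineCoord ⟨1 / 2, hhalf⟩ (edgeParam 2 t)) = p t
    have ht := affineCoord_edgeParam_two ⟨1 / 2, hhalf⟩ t
    change _ = 1 / 2 * (t : ℝ) at ht
    have ht2 : ((affineCoord ⟨1 / 2, hhalf⟩ (edgeParam 2 t) : I) : ℝ) ≤ 1 / 2 := by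
      rw [ht]; linarith [t.2.2]
    rw [Path.trans_apply, dif_pos ht2]
    congr 1
    refine Subtype.ext ?_
    change 2 * ((affineCoord ⟨1 / 2, hhalf⟩ (edgeParam 2 t) : I) : ℝ) = t
    rw [ht]
    ring
  · refine ContinuousMap.ext fun t => ?_
    change (p.trans q) (affineCoord ⟨1 / 2, hhalf⟩ (edgeParam 0 t)) = q t
    have ht := affineCoord_edgeParam_zero ⟨1 / 2, hhalf⟩ t
    change _ = 1 / 2 * (1 - (t : ℝ)) + t at ht
    rw [Path.trans_apply]
    split_ifs with h
    -- At t = 0 the parameter is exactly 1/2, which falls under the first path; both paths pass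
    -- through the common endpoint there.
    · have ht0 : t = 0 := Subtype.ext (le_antisymm
        (show (t : ℝ) ≤ 0 by rw [ht] at h; linarith) t.2.1)
      have e : (⟨2 * (affineCoord ⟨1 / 2, hhalf⟩ (edgeParam 0 t) : ℝ),
          (mul_pos_mem_iff zero_lt_two).2 ⟨(affineCoord ⟨1 / 2, hhalf⟩ (edgeParam 0 t)).2.1, h⟩⟩ : I) =
          1 := by
        refine Subtype.ext ?_
        change 2 * (affineCoord ⟨1 / 2, hhalf⟩ (edgeParam 0 t) : ℝ) = 1
        rw [ht, ht0, Icc.coe_zero]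
        norm_num
      rw [e, ht0, p.target, q.source]
    · congr 1
      refine Subtype.ext ?_
      change 2 * (affineCoord ⟨1 / 2, hhalf⟩ (edgeParam 0 t) : ℝ) - 1 = t
      rw [ht]
      ring

/-- On a simply connected space every path cocycle is a coboundary. -/
lemma IsPathCocycle.exists_eq_sub [SimplyConnectedSpace Y] (hφ : IsPathCocycle φ) :
    ∃ ψ : Y → Q, ∀ p : C(I, Y), φ p = ψ (p 1) - ψ (p 0) := by
  obtain ⟨y₀⟩ : Nonempty Y := inferInstance
  refine ⟨fun y => φ (PathConnectedSpace.somePath y₀ y), fun p => ?_⟩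
  let p' : Path (p 0) (p 1) := ⟨p, rfl, rfl⟩
  have h := hφ.trans (PathConnectedSpace.somePath y₀ (p 0)) p'
  rw [hφ.eq_of_homotopic (SimplyConnectedSpace.paths_homotopic _
    (PathConnectedSpace.somePath y₀ (p 1)))] at h
  exact (sub_eq_of_eq_add' h).symm

lemma IsPathCocycle.comp {Z : Type} [TopologicalSpace Z] (hφ : IsPathCocycle φ) (f : C(Z, Y)) :
    IsPathCocycle fun p : C(I, Z) => φ (f.comp p) :=
  fun T => hφ (f.comp T)

end Singular

end SphericalFraming

end

noncomputable section

namespace SphericalFraming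

/-! ### The first homology of the quotient -/

section QuotientHomology

open unitInterval

variable (G : Type*) [Group G] [MulAction G S3]

/-- A point of the sphere over a given point of the quotient. -/
def basePoint (m : SpaceForm G) : S3 := Quotient.out m

lemma proj_basePoint (m : SpaceForm G) : proj G (basePoint G m) = m := Quotient.out_eq m

lemma exists_smul_basePoint (x : S3) : ∃ g : G, g • basePoint G (proj G x) = x :=
  (proj_eq_iff G).1 (proj_basePoint G (proj G x)).symm

variable [Finite G] [FreeSmoothAction G]

lemma isCoveringMap_proj : IsCoveringMap (proj G) :=
  isQuotientCoveringMap_quotientMk_of_properlyDiscontinuousSMul.isCoveringMap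

/-- The projection as a bundled continuous map. -/
def projMap : C(S3, SpaceForm G) := ⟨proj G, proj_continuous G⟩

lemma exists_lift_path (p : C(I, SpaceForm G)) : ∃ γ : C(I, S3), (projMap G).comp γ = p := by
  obtain ⟨γ, hγ, -⟩ := (isCoveringMap_proj G).exists_path_lifts p (basePoint G (p 0))
    (proj_basePoint G (p 0)).symm
  exact ⟨γ, ContinuousMap.ext (congrFun hγ)⟩

/-- Translation of a path by a deck transformation. -/
def smulPath (g : G) (γ : C(I, S3)) : C(I, S3) := ⟨fun t => g • γ t, γ.continuous.const_smul g⟩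

lemma projMap_comp_smulPath (g : G) (γ : C(I, S3)) :
    (projMap G).comp (smulPath G g γ) = (projMap G).comp γ :=
  ContinuousMap.ext fun t => proj_smul G g (γ t)

/-- A deck transformation matches the initial points, and uniqueness of lifts does the rest. -/
lemma exists_smulPath_eq {γ γ' : C(I, S3)} (h : (projMap G).comp γ = (projMap G).comp γ') :
    ∃ g : G, smulPath G g γ = γ' := by
  obtain ⟨g, hg⟩ := (proj_eq_iff G).1 (DFunLike.congr_fun h 0).symm
  refine ⟨g, ContinuousMap.ext fun t => congrFun
    ((isCoveringMap_proj G).eq_of_comp_eq (smulPath G g γ).continuous γ'.continuous ?_ 0 hg) t⟩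
  have := (projMap_comp_smulPath G g γ).trans h
  exact congrArg DFunLike.coe this

/-- A group of odd order acts freely only with quotients whose first homology modulo two
vanishes. -/
theorem firstHomologyModTwoVanishes_of_odd (hG : Odd (Nat.card G)) :
    FirstHomologyModTwoVanishes (SpaceForm G) := by
  have := Fintype.ofFinite G
  refine firstHomologyModTwoVanishes_of_pathCocycle fun Q _ _ φ hφ => ?_
  obtain ⟨ψ, hψ⟩ := (hφ.comp (projMap G)).exists_eq_sub
  -- Transfer: the primitive upstairs is summed over orbits so that it descends. This multiplies the
  -- cocycle by |G|, which acts as 1 on a ℤ/2-module when odd.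
  let Ψ : SpaceForm G → Q := fun m => ∑ g : G, ψ (g • basePoint G m)
  have hΨ (x : S3) : ∑ g : G, ψ (g • x) = Ψ (proj G x) := by
    obtain ⟨h, hh⟩ := exists_smul_basePoint G x
    conv_lhs => rw [← hh]
    simp only [← mul_smul]
    exact Fintype.sum_equiv (Equiv.mulRight h) _ _ fun _ => rfl
  have hcard (q : Q) : Nat.card G • q = q := by
    rw [← Nat.cast_smul_eq_nsmul (ZMod 2), (ZMod.natCast_eq_one_iff_odd).2 hG, one_smul]
  refine ⟨Ψ, fun p => ?_⟩
  obtain ⟨γ, rfl⟩ := exists_lift_path G p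
  change _ = Ψ (proj G (γ 1)) - Ψ (proj G (γ 0))
  rw [← hΨ, ← hΨ, ← Finset.sum_sub_distrib, ← hcard (φ _), Nat.card_eq_fintype_card,
    ← Finset.card_univ, ← Finset.sum_const]
  refine Finset.sum_congr rfl fun g _ => ?_
  rw [← projMap_comp_smulPath G g γ]
  exact hψ (smulPath G g γ)

/-- The triangle as a quotient of the square, with one side collapsed to a vertex. -/
def squareToTriangle : C(I × I, stdSimplex ℝ (Fin 3)) where
  toFun z := ⟨![1 - (z.1 : ℝ), z.1 * (1 - z.2), z.1 * z.2], by
    have h1 := z.1.2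
    have h2 := z.2.2
    refine ⟨fun i => ?_, ?_⟩
    · fin_cases i
      · exact sub_nonneg.2 h1.2
      · exact mul_nonneg h1.1 (sub_nonneg.2 h2.2)
      · exact mul_nonneg h1.1 h2.1
    · rw [Fin.sum_univ_three]
      change (1 - (z.1 : ℝ)) + z.1 * (1 - z.2) + z.1 * z.2 = 1
      ring⟩
  continuous_toFun := by
    refine Continuous.subtype_mk (continuous_pi fun i => ?_) _
    have h1 : Continuous fun z : I × I => (z.1 : ℝ) := continuous_subtype_val.comp continuous_fst
    have h2 : Continuous fun z : I × I => (z.2 : ℝ) := continuous_subtype_val.comp continuous_snd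
    fin_cases i
    · exact continuous_const.sub h1
    · exact h1.mul (continuous_const.sub h2)
    · exact h1.mul h2

/-- The pulled back triangle is a homotopy starting at a constant path, so homotopy lifting applies,
and the lift stays constant on the collapsed side. -/
lemma exists_lift_triangle (T : C(stdSimplex ℝ (Fin 3), SpaceForm G)) :
    ∃ L : C(I × I, S3), (∀ t t', L (0, t) = L (0, t')) ∧
      ∀ z, proj G (L z) = T (squareToTriangle z) := by
  let v : stdSimplex ℝ (Fin 3) := squareToTriangle (0, 0)
  have hv (t : I) : squareToTriangle (0, t) = v := by
    refine stdSimplex.ext (funext fun i => ?_)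
    change (![1 - ((0 : I) : ℝ), (0 : I) * (1 - t), (0 : I) * t] : Fin 3 → ℝ) i =
      (![1 - ((0 : I) : ℝ), (0 : I) * (1 - (0 : I)), (0 : I) * (0 : I)] : Fin 3 → ℝ) i
    simp
  have h0 (t : I) : (T.comp squareToTriangle) (0, t) =
      proj G (ContinuousMap.const I (basePoint G (T v)) t) :=
    (congrArg T (hv t)).trans (proj_basePoint G (T v)).symm
  refine ⟨(isCoveringMap_proj G).liftHomotopy _ _ h0, fun t t' => ?_,
    congrFun ((isCoveringMap_proj G).liftHomotopy_lifts _ _ h0)⟩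
  rw [(isCoveringMap_proj G).liftHomotopy_zero _ _ h0,
    (isCoveringMap_proj G).liftHomotopy_zero _ _ h0]
  rfl

/-- If the first homology modulo two of the quotient vanishes, then the group has no non-trivial
characters of order two. -/
theorem character_eq_one_of_firstHomologyModTwoVanishes
    (hM : FirstHomologyModTwoVanishes (SpaceForm G)) (χ : G →* Multiplicative (ZMod 2)) :
    χ = 1 := by
  choose s hs using exists_smul_basePoint G
  -- `s x` carries the chosen representative of the orbit to `x`, so `ε` is equivariant: translation
  -- by `g` adds χ(g). It need not be continuous.
  let ε : S3 → ZMod 2 := fun x => (χ (s x)).toAdd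
  have hε (g : G) (x : S3) : ε (g • x) = (χ g).toAdd + ε x := by
    have h : s (g • x) = g * s x := by
      have h1 := hs (g • x)
      rw [proj_smul] at h1
      have h2 : (g * s x) • basePoint G (proj G x) = g • x := by rw [mul_smul, hs]
      exact IsCancelSMul.right_cancel _ _ _ (h1.trans h2.symm)
    change (χ (s (g • x))).toAdd = _
    rw [h, map_mul, toAdd_mul]
  choose lift hlift using exists_lift_path G
  -- Another lift shifts both terms by the same χ(g), so the choice of lift does not matter.
  let φ : C(I, SpaceForm G) → ZMod 2 := fun p => ε (lift p 1) - ε (lift p 0)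
  have hφ_proj (γ : C(I, S3)) : φ ((projMap G).comp γ) = ε (γ 1) - ε (γ 0) := by
    obtain ⟨g, hg⟩ := exists_smulPath_eq G (hlift ((projMap G).comp γ))
    have h1 : γ 1 = g • lift ((projMap G).comp γ) 1 := (DFunLike.congr_fun hg 1).symm
    have h0 : γ 0 = g • lift ((projMap G).comp γ) 0 := (DFunLike.congr_fun hg 0).symm
    rw [h1, h0, hε, hε, add_sub_add_left_eq_sub]
  have hφ : IsPathCocycle φ := by
    intro T
    obtain ⟨L, hL0, hL⟩ := exists_lift_triangle G T
    have e0 : edge T 0 = (projMap G).comp (L.comp ⟨fun t => (1, t), Continuous.prodMk_right _⟩) :=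
      ContinuousMap.ext fun t => by
        refine (congrArg T (stdSimplex.ext (funext fun i => ?_))).trans (hL (1, t)).symm
        obtain ⟨h0, h1, h2⟩ := edgeParam_zero t
        fin_cases i
        · exact h0.trans (sub_self (1 : ℝ)).symm
        · exact h1.trans (one_mul (1 - (t : ℝ))).symm
        · exact h2.trans (one_mul (t : ℝ)).symm
    have e1 : edge T 1 = (projMap G).comp (L.comp ⟨fun t => (t, 1), Continuous.prodMk_left _⟩) :=
      ContinuousMap.ext fun t => by
        refine (congrArg T (stdSimplex.ext (funext fun i => ?_))).trans (hL (t, 1)).symm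
        obtain ⟨h0, h1, h2⟩ := edgeParam_one t
        fin_cases i
        · exact h0
        · exact h1.trans (show 0 = (t : ℝ) * (1 - 1) by ring)
        · exact h2.trans (mul_one (t : ℝ)).symm
    have e2 : edge T 2 = (projMap G).comp (L.comp ⟨fun t => (t, 0), Continuous.prodMk_left _⟩) :=
      ContinuousMap.ext fun t => by
        refine (congrArg T (stdSimplex.ext (funext fun i => ?_))).trans (hL (t, 0)).symm
        obtain ⟨h0, h1, h2⟩ := edgeParam_two t
        fin_cases i
        · exact h0
        · exact h1.trans (show (t : ℝ) = (t : ℝ) * (1 - 0) by ring)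
        · exact h2.trans (mul_zero (t : ℝ)).symm
    rw [e0, e1, e2, hφ_proj, hφ_proj, hφ_proj]
    change ε (L (1, 1)) - ε (L (1, 0)) - (ε (L (1, 1)) - ε (L (0, 1))) +
      (ε (L (1, 0)) - ε (L (0, 0))) = 0
    rw [hL0 0 1]
    abel
  ext g
  -- This path projects to a loop on which the cocycle takes the value χ(g).
  let p : Path (1 : S3) (g • (1 : S3)) := PathConnectedSpace.somePath _ _
  have h := pathCocycle_loop_eq_zero hM hφ (p := (projMap G).comp p) (by
    change proj G (p 0) = proj G (p 1)
    rw [p.source, p.target, proj_smul])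
  rw [hφ_proj] at h
  change ε (p 1) - ε (p 0) = 0 at h
  rw [p.source, p.target, hε, add_sub_cancel_right] at h
  exact h

/-- The difference of two pulled back trivialisations is divisible by the order of the group if the
first homology modulo two vanishes, and by half of it otherwise. -/
theorem divisibility_of_isDifference {τ₁ τ₂ : TangentTrivialisation (SpaceForm G)}
    (h : τ₁.SameOrientation τ₂) {d : ℤ}
    (hd : IsDifference (pullbackProj G τ₁) (pullbackProj G τ₂) d) :
    (FirstHomologyModTwoVanishes (SpaceForm G) → (Nat.card G : ℤ) ∣ d) ∧
      (¬ FirstHomologyModTwoVanishes (SpaceForm G) →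
        Even (Nat.card G) ∧ ((Nat.card G / 2 : ℕ) : ℤ) ∣ d) := by
  obtain ⟨χ, hχ⟩ := exists_character_card_ker_dvd h hd
  refine ⟨fun hM => ?_, fun hM => ?_⟩
  · rwa [character_eq_one_of_firstHomologyModTwoVanishes G hM χ, MonoidHom.ker_one,
      Subgroup.card_top] at hχ
  · have heven : Even (Nat.card G) := by
      by_contra hodd
      exact hM (firstHomologyModTwoVanishes_of_odd G (Nat.not_even_iff_odd.1 hodd))
    exact ⟨heven, (Int.natCast_dvd_natCast.2 (card_div_two_dvd_card_ker heven χ)).trans hχ⟩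

end QuotientHomology

end SphericalFraming

end

/-! ### Assembly of the divisibility statement and the framing invariant. -/

theorem mainTheorem7 (G : Type*) [Group G] [Finite G] [MulAction G SphericalFraming.S3]
    [SphericalFraming.FreeSmoothAction G] :
    -- the difference of the pullbacks is a well-defined integer with the stated divisibility
    (∀ τ₁ τ₂ : SphericalFraming.TangentTrivialisation (SphericalFraming.SpaceForm G),
      τ₁.SameOrientation τ₂ →
      ∃ d : ℤ,
        (∀ d' : ℤ, SphericalFraming.IsDifference (SphericalFraming.pullbackProj G τ₁)
          (SphericalFraming.pullbackProj G τ₂) d' ↔ d' = d) ∧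
        (SphericalFraming.FirstHomologyModTwoVanishes (SphericalFraming.SpaceForm G) →
          (Nat.card G : ℤ) ∣ d) ∧
        (¬ SphericalFraming.FirstHomologyModTwoVanishes (SphericalFraming.SpaceForm G) →
          Even (Nat.card G) ∧ ((Nat.card G / 2 : ℕ) : ℤ) ∣ d)) ∧
    -- the framing invariant is well defined
    (∃ F : {τ : SphericalFraming.TangentTrivialisation (SphericalFraming.SpaceForm G) //
        SphericalFraming.IsPositive G τ} → ℤ,
      (∀ τ, ∀ d : ℤ, SphericalFraming.IsDifference (SphericalFraming.pullbackProj G τ.1)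
        SphericalFraming.canonical d ↔ d = F τ) ∧
      ∀ τ₁ τ₂, F τ₁ ≡ F τ₂ [ZMOD (SphericalFraming.modulus G : ℤ)]) := by
  open SphericalFraming TangentTrivialisation in
  have hexists (σ τ : TangentTrivialisation S3) (h : σ.SameOrientation τ) :
      ∃ d : ℤ, ∀ d', IsDifference σ τ d' ↔ d' = d := by
    obtain ⟨d, hd⟩ := exists_isDifference h
    exact ⟨d, fun d' => ⟨fun hd' => hd'.unique h hd, fun hd' => hd' ▸ hd⟩⟩
  refine ⟨fun τ₁ τ₂ h => ?_, ?_⟩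
  · obtain ⟨d, hd⟩ := hexists _ _ (SphericalFraming.sameOrientation_pullbackProj_iff.2 h)
    exact ⟨d, hd, SphericalFraming.divisibility_of_isDifference G h ((hd d).2 rfl)⟩
  · choose F hF using fun τ : {τ : SphericalFraming.TangentTrivialisation
      (SphericalFraming.SpaceForm G) // SphericalFraming.IsPositive G τ} => hexists _ _ τ.2
    refine ⟨F, hF, fun τ₁ τ₂ => ?_⟩
    have h : (SphericalFraming.pullbackProj G τ₁.1).SameOrientation
        (SphericalFraming.pullbackProj G τ₂.1) := τ₁.2.trans τ₂.2.symm
    obtain ⟨d, hd⟩ := hexists _ _ h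
    -- Additivity through the pullback of `τ₂` gives d + F τ₂ = F τ₁, so the two values differ by
    -- the divisible integer `d`.
    have hsum := (hF τ₁ (d + F τ₂)).1
      (SphericalFraming.IsDifference.trans ((hd d).2 rfl) ((hF τ₂ _).2 rfl))
    obtain ⟨h1, h2⟩ := SphericalFraming.divisibility_of_isDifference G
      (SphericalFraming.sameOrientation_pullbackProj_iff.1 h) ((hd d).2 rfl)
    have hdvd : (SphericalFraming.modulus G : ℤ) ∣ d := by
      unfold SphericalFraming.modulus
      split_ifs with hM
      · exact h1 hM
      · exact (h2 hM).2
    refine (Int.modEq_iff_dvd.2 ?_).symm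
    rwa [← hsum, add_sub_cancel_right]
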